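/- Let $n\ge 1$ and let $q$ be an indeterminate. Let $O_q(M(n))$ be the associative unital $\mathbb{Q}(q)$-algebra generated by $Z_{ij}$, $1\le i,j\le n$, with the relations $$Z_{ij}Z_{ik}=q^2Z_{ik}Z_{ij}\ (j<k),\qquad Z_{ij}Z_{kj}=q^2Z_{kj}Z_{ij}\ (i<k),$$ $$Z_{ij}Z_{st}=Z_{st}Z_{ij}\ (i>s,\ j<t),\qquad Z_{ij}Z_{st}=Z_{st}Z_{ij}+(q^2-q^{-2})Z_{it}Z_{sj}\ (i<s,\ j<t),$$ let $\det_q=\sum_{\sigma\in S_n}(-q^2)^{l(\sigma)}Z_{1\sigma(1)}\cdots Z_{n\sigma(n)}$, and let $O_q(SL(n))=O_q(M(n))/(\det_q-1)$, with $X_{ij}$ the image of $Z_{ij}$. For $A=(a_{ij})\in M_n(\mathbb{Z}_+)$, where $\mathbb{Z}_+=\{0,1,2,\dots\}$, let $X(A)$ be the image in $O_q(SL(n))$ of $$Z(A)=q^{-\sum_i\sum_{j>k}a_{ij}a_{ik}-\sum_i\sum_{j>k}a_{ji}a_{ki}}\prod_{i,j}Z_{ij}^{a_{ij}},$$ the factors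 being in the lexicographic order of the positions $(i,j)$. Let $ro(A)\in\mathbb{Z}_+^n$ and $co(A)\in\mathbb{Z}_+^n$ be the vectors of row sums and of column sums of $A$, and let $B<A$ mean that $B\neq A$ and that, at the first position in lexicographic order where the two matrices differ, the entry of $B$ is smaller than that of $A$. Let $$I=\{A\in M_n(\mathbb{Z}_+) : a_{11}a_{22}\cdots a_{nn}=0\}.$$ Theorem. The set $\{X(A) : A\in I\}$ is a $\mathbb{Q}(q)$-basis of $O_q(SL(n))$; put $\tilde L^*=\bigoplus_{A\in I}\mathbb{Z}[q]X(A)$. There is a unique ring anti-automorphism $\phi$ of $O_q(SL(n))$ with $\phi(q)=q^{-1}$ and $\phi(X_{ij})=X_{ij}$ for all $i,j$. There is a unique family $\{b(\tilde A)\}_{A\in I}$ of elements of $O_q(SL(n))$ such that, for all $A\in I$, 1. $\phi(b(\tilde A))=b(\tilde A)$; 2. $b(\tilde A)=X(A)+\sum_{B}h_B(A)X(B)$, a finite sum over $B\in M_n(\mathbb{Z}_+)$ with $B<A$, $ro(B)=ro(A)$, $co(B)=co(A)$, where $h_B(A)\in q\mathbb{Z}[q]$. This family is a $\mathbb{Z}[q]$-basis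 of $\tilde L^*$ and a $\mathbb{Q}(q)$-basis of $O_q(SL(n))$. Expanded in the basis $\{X(B)\}_{B\in I}$, it satisfies 2$'$. $b(\tilde A)=X(A)+\sum_{B}h'_B(A)X(B)$, a finite sum over $B\in I$ with $B<A$ such that, for some $k\in\mathbb{Z}_+$, $ro(A)-ro(B)=co(A)-co(B)=(k,\dots,k)$, where $h'_B(A)\in q\mathbb{Z}[q]$; and it is also the only family satisfying 1 and 2$'$. -/

import Mathlib

namespace QuantumSL

noncomputable section

/-- The ground field `K = ℚ(q)`. -/
abbrev K : Type := RatFunc ℚ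

/-- The indeterminate `q` of `K`. -/
def q : K := RatFunc.X

/-- The polynomial ring `ℤ[q]`, as a subring of `K = ℚ(q)`. -/
abbrev Zq : Subalgebra ℤ K := Algebra.adjoin ℤ {q}

/-- `q` as an element of `ℤ[q]`. -/
def qZ : Zq := ⟨q, Algebra.subset_adjoin (Set.mem_singleton q)⟩

/-- The exponent matrices `M_n(ℤ₊)`. -/
abbrev Mat (n : ℕ) : Type := Matrix (Fin n) (Fin n) ℕ

/-- The free generator attached to the position `(i, j)`. -/
def gen {n : ℕ} (i j : Fin n) : FreeAlgebra K (Fin n × Fin n) := FreeAlgebra.ι K (i, j)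

/-- The defining relations of the quantum matrix algebra. -/
inductive MRel (n : ℕ) :
    FreeAlgebra K (Fin n × Fin n) → FreeAlgebra K (Fin n × Fin n) → Prop
  | row (i j k : Fin n) (h : j < k) :
      MRel n (gen i j * gen i k) (q ^ 2 • (gen i k * gen i j))
  | col (i k j : Fin n) (h : i < k) :
      MRel n (gen i j * gen k j) (q ^ 2 • (gen k j * gen i j))
  | anti (i j s t : Fin n) (h₁ : s < i) (h₂ : j < t) :
      MRel n (gen i j * gen s t) (gen s t * gen i j)
  | diag (i j s t : Fin n) (h₁ : i < s) (h₂ : j < t) :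
      MRel n (gen i j * gen s t)
        (gen s t * gen i j + (q ^ 2 - (q ^ 2)⁻¹) • (gen i t * gen s j))

/-- The coordinate algebra `O_q(M(n))` of quantum `n × n` matrices. -/
abbrev OqM (n : ℕ) : Type := RingQuot (MRel n)

/-- The generators `Z_{ij}` of `O_q(M(n))`. -/
def Z {n : ℕ} (i j : Fin n) : OqM n := RingQuot.mkAlgHom K (MRel n) (gen i j)

/-- The length of a permutation: its number of inversions. -/
def len {n : ℕ} (σ : Equiv.Perm (Fin n)) : ℕ :=
  (Finset.univ.filter fun p : Fin n × Fin n => p.1 < p.2 ∧ σ p.2 < σ p.1).card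

/-- The quantum determinant
`det_q = ∑_σ (-q²)^{l(σ)} Z_{1σ(1)} Z_{2σ(2)} ⋯ Z_{nσ(n)}`. -/
def detq (n : ℕ) : OqM n :=
  ∑ σ : Equiv.Perm (Fin n),
    (-q ^ 2) ^ len σ • (List.ofFn fun i : Fin n => Z i (σ i)).prod

/-- The single relation `det_q = 1`. -/
inductive SLRel (n : ℕ) : OqM n → OqM n → Prop
  | det : SLRel n (detq n) 1

/-- The coordinate algebra `O_q(SL(n))`, the quotient of `O_q(M(n))` by `det_q = 1`. -/
abbrev OqSL (n : ℕ) : Type := RingQuot (SLRel n)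

/-- The quotient map `O_q(M(n)) → O_q(SL(n))`. -/
def toSL (n : ℕ) : OqM n →ₐ[K] OqSL n := RingQuot.mkAlgHom K (SLRel n)

/-- The monomial `Z^A = ∏ Z_{ij}^{a_{ij}}`, with factors in the lexicographic order of the
positions `(i, j)`. -/
def mon {n : ℕ} (A : Mat n) : OqM n :=
  (List.ofFn fun i : Fin n => (List.ofFn fun j : Fin n => Z i j ^ A i j).prod).prod

/-- The nonnegative integer `∑_i ∑_{j > k} a_{ij} a_{ik} + ∑_i ∑_{j > k} a_{ji} a_{ki}`. -/
def dexp {n : ℕ} (A : Mat n) : ℕ :=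
  (∑ i : Fin n, ∑ j : Fin n, ∑ k ∈ Finset.univ.filter (fun k : Fin n => k < j), A i j * A i k) +
  ∑ i : Fin n, ∑ j : Fin n, ∑ k ∈ Finset.univ.filter (fun k : Fin n => k < j), A j i * A k i

/-- The normalized monomial `Z(A) = D(A) Z^A`, where `D(A) = q^{-dexp A}`. -/
def ZN {n : ℕ} (A : Mat n) : OqM n := (q⁻¹ ^ dexp A) • mon A

/-- `X(A)`, the image of `Z(A)` in `O_q(SL(n))`. -/
def X {n : ℕ} (A : Mat n) : OqSL n := toSL n (ZN A)

/-- The strict lexicographic order on matrices: at the first position (read row by row) where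
`B` and `A` differ, the entry of `B` is the smaller one. -/
def LexLT {n : ℕ} (B A : Mat n) : Prop :=
  ∃ i j : Fin n, B i j < A i j ∧
    ∀ s t : Fin n, (s < i ∨ (s = i ∧ t < j)) → B s t = A s t

/-- The row sums `ro(A)`. -/
def ro {n : ℕ} (A : Mat n) : Fin n → ℕ := fun i => ∑ j, A i j

/-- The column sums `co(A)`. -/
def co {n : ℕ} (A : Mat n) : Fin n → ℕ := fun j => ∑ i, A i j

/-- The matrices in `M_n(ℤ₊)` with at least one zero diagonal entry, i.e. with
`a_{11} a_{22} ⋯ a_{nn} = 0`. For `n ≥ 1` these represent the classes of matrices modulo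
adding multiples of the identity matrix, each class once. -/
abbrev Idx (n : ℕ) : Type := {A : Mat n // ∏ i, A i i = 0}

/-- The lattice spanned over `ℤ[q]` by the `X(A)`, `A` in the index set. -/
def lattice (n : ℕ) : Submodule Zq (OqSL n) :=
  Submodule.span Zq (Set.range fun A : Idx n => X A.1)

/-- `φ` is the ring anti-automorphism of `O_q(SL(n))` with `q ↦ q⁻¹` and `X_{ij} ↦ X_{ij}`
(being additive and unital, it is `ℚ`-linear). -/
structure IsPhi {n : ℕ} (φ : OqSL n ≃+* (OqSL n)ᵐᵒᵖ) : Prop where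
  map_q : φ (algebraMap K (OqSL n) q) = MulOpposite.op (algebraMap K (OqSL n) q⁻¹)
  map_gen : ∀ i j : Fin n, φ (toSL n (Z i j)) = MulOpposite.op (toSL n (Z i j))

/-- Every `b(A)` is fixed by `φ`. -/
def Invariant {n : ℕ} (φ : OqSL n ≃+* (OqSL n)ᵐᵒᵖ) (b : Idx n → OqSL n) : Prop :=
  ∀ A : Idx n, φ (b A) = MulOpposite.op (b A)

/-- `b(A) = X(A) + ∑_{B < A} h_B(A) X(B)` with `h_B(A) ∈ qℤ[q]`, where `B` runs through the
matrices in `M_n(ℤ₊)` with the same row sums and the same column sums as `A`. -/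
def Triangular {n : ℕ} (b : Idx n → OqSL n) : Prop :=
  ∀ A : Idx n, ∃ g : Mat n →₀ Zq,
    (∀ B ∈ g.support, LexLT B A.1 ∧ ro B = ro A.1 ∧ co B = co A.1) ∧
    b A = X A.1 + g.sum fun B c => (qZ * c) • X B

/-- `b(A) = X(A) + ∑_{B < A} h_B(A) X(B)` with `h_B(A) ∈ qℤ[q]`, where `B` runs through the
index set only, and the row and column sums of `A` and `B` agree up to a common multiple of
`(1, …, 1)`, the row and column sums of the identity matrix. -/
def IdxTriangular {n : ℕ} (b : Idx n → OqSL n) : Prop :=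
  ∀ A : Idx n, ∃ g : Idx n →₀ Zq,
    (∀ B ∈ g.support, LexLT B.1 A.1 ∧
      ∃ k : ℕ, (∀ i, ro A.1 i = ro B.1 i + k) ∧ ∀ j, co A.1 j = co B.1 j + k) ∧
    b A = X A.1 + g.sum fun B c => (qZ * c) • X B.1

end

end QuantumSL

namespace QuantumSL

noncomputable section

section

/-! ### The ground field and its bar involution -/

/-! The work is done in `OqM n` and then pushed through the quotient. Matrices with fixed row and
column sums are ordered by their north-west sums (`Prec`, with height `mu`). Exchanging two
generators costs a power of `q` and an error term strictly lower in this order. Hence a product of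
generators in any order is, up to an explicit power of `q`, the normalized monomial `ZN` of its
content modulo lower terms over `ℤ[q, q⁻¹]` (`straighten`), and the `ZN A` span. Their independence
comes from a representation built row by row out of operators on a quantum affine space
(`exists_isRTT_linearIndependent`).

The anti-automorphism `ph` reverses words and inverts `q`, so it is unitriangular on the `ZN A`.
Lusztig's argument then gives a `ph`-fixed element `bM A` in `ZN A + qℤ[q]`-combinations of lower
monomials (`exists_invariant`). The arithmetic input is `ℤ[q] ∩ q⁻¹ℤ[q⁻¹] = 0`, which also forces a
fixed element with all coefficients in `qℤ[q]` to vanish.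

Three facts on the quantum determinant are needed: `ph` fixes it (`ph_detq`), multiplication by it
preserves the `ℤ[q]`-lattice of the `ZN A` (`detq_mul_ZN_mem`), and it sends `ZN A` to `ZN (1 + A)`
plus lower terms (`detq_mul_ZN_sub_mem`). The first two rest on commuting minors past a generator of
a higher row (`QRel.minor_mul`). Centrality follows: the commutator of `detq n` with `bM A` is
negated by `ph` and has coefficients in `ℤ[q]`, so each top coefficient satisfies `bar x = -x`
inside `ℤ[q]` and is zero (`commute_detq_bM`).

By centrality the kernel of `toSL n` is `(detq n - 1) * OqM n`. A nonzero `(detq n - 1) * z` has a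
term at some `1 + C`, which has no zero on its diagonal; hence the `X A` with `A` in the index set
are independent. Conversely `detq n = 1` rewrites `X (1 + A)` integrally by lower terms, so they
span, already over `ℤ[q]` for the lattice of all `X A` (`X_mem_XLat`). Finally `ph` descends to `φ`,
the images of the `bM A` are the required family, and two such families differ by fixed elements
with coefficients in `qℤ[q]`, that is, not at all (`IsPhi.eq_bSL`). -/

lemma q_ne_zero : q ≠ 0 := RatFunc.X_ne_zero

lemma transcendental_q : Transcendental ℚ q := by
  convert RatFunc.transcendental_X (K := ℚ)
  · exact Subsingleton.elim _ _
  · rfl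

lemma transcendental_q_inv : Transcendental ℚ q⁻¹ := by
  rw [Transcendental, IsAlgebraic.inv_iff]
  exact transcendental_q

/-- The bar involution of `K`, with `q ↦ q⁻¹`. -/
def bar : K →+* K :=
  RatFunc.liftRingHom (Polynomial.aeval q⁻¹ : Polynomial ℚ →ₐ[ℚ] K).toRingHom (by
    intro p hp
    rw [Submonoid.mem_comap, mem_nonZeroDivisors_iff_ne_zero]
    have hp' := nonZeroDivisors.ne_zero hp
    intro h
    exact hp' (transcendental_iff.1 transcendental_q_inv p h))

@[simp] lemma bar_q : bar q = q⁻¹ := by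
  change RatFunc.liftRingHom _ _ RatFunc.X = q⁻¹
  rw [RatFunc.liftRingHom_X]
  simp

/-- A ring homomorphism out of `K` is determined by its value at `q`. -/
lemma K_hom_ext {S : Type*} [Ring S] {f g : K →+* S} (h : f q = g q) : f = g := by
  have hp : ∀ p : Polynomial ℚ, f (algebraMap _ K p) = g (algebraMap _ K p) := by
    intro p
    have : f.comp (algebraMap (Polynomial ℚ) K) = g.comp (algebraMap (Polynomial ℚ) K) := by
      apply Polynomial.ringHom_ext
      · intro a
        exact congrFun (congrArg DFunLike.coe (RingHom.ext_rat
          ((f.comp (algebraMap (Polynomial ℚ) K)).comp Polynomial.C)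
          ((g.comp (algebraMap (Polynomial ℚ) K)).comp Polynomial.C))) a
      · simpa [RatFunc.algebraMap_X, q] using h
    exact congrFun (congrArg DFunLike.coe this) p
  ext x
  induction x using RatFunc.induction_on with
  | f a b hb =>
    have hb' : algebraMap (Polynomial ℚ) K b ≠ 0 := RatFunc.algebraMap_ne_zero hb
    have hu : g (algebraMap _ K b) * g (algebraMap _ K b)⁻¹ = 1 := by
      rw [← map_mul, mul_inv_cancel₀ hb', map_one]
    have key : f (algebraMap _ K a / algebraMap _ K b) * g (algebraMap _ K b)
        = g (algebraMap _ K a / algebraMap _ K b) * g (algebraMap _ K b) := by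
      rw [← hp b, ← map_mul, hp b, ← map_mul, div_mul_cancel₀ _ hb', hp a]
    have := congrArg (· * g (algebraMap _ K b)⁻¹) key
    simpa [mul_assoc, hu] using this

@[simp] lemma bar_bar (x : K) : bar (bar x) = x := by
  have : bar.comp bar = RingHom.id K := K_hom_ext (by simp)
  exact congrFun (congrArg DFunLike.coe this) x

lemma mem_Zq {x : K} : x ∈ Zq ↔ ∃ p : Polynomial ℤ, Polynomial.aeval q p = x := by
  rw [Zq, Algebra.adjoin_singleton_eq_range_aeval]
  rfl

lemma q_mem_Zq : q ∈ Zq := Algebra.subset_adjoin (Set.mem_singleton q)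

lemma bar_aeval (p : Polynomial ℤ) : bar (Polynomial.aeval q p) = Polynomial.aeval q⁻¹ p := by
  have : bar.comp (Polynomial.aeval q : Polynomial ℤ →ₐ[ℤ] K).toRingHom
      = (Polynomial.aeval q⁻¹ : Polynomial ℤ →ₐ[ℤ] K).toRingHom := by
    apply Polynomial.ringHom_ext <;> simp
  exact congrFun (congrArg DFunLike.coe this) p

lemma aeval_q_injective : Function.Injective (Polynomial.aeval q : Polynomial ℤ →ₐ[ℤ] K) := by
  have h : ∀ p : Polynomial ℤ, Polynomial.aeval q p
      = algebraMap (Polynomial ℚ) K (p.map (Int.castRingHom ℚ)) := by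
    intro p
    have : (Polynomial.aeval q : Polynomial ℤ →ₐ[ℤ] K).toRingHom
        = (algebraMap (Polynomial ℚ) K).comp (Polynomial.mapRingHom (Int.castRingHom ℚ)) := by
      apply Polynomial.ringHom_ext <;> simp [RatFunc.algebraMap_X, q]
    exact congrFun (congrArg DFunLike.coe this) p
  intro p r hpr
  rw [h, h] at hpr
  exact Polynomial.map_injective _ (Int.castRingHom ℚ).injective_int
    (RatFunc.algebraMap_injective ℚ hpr)

/-- `ℤ[q] ∩ q⁻¹ℤ[q⁻¹] = 0`. -/
lemma eq_zero_of_eq_inv_mul_bar {x y : K} (hx : x ∈ Zq) (hy : y ∈ Zq) (h : x = q⁻¹ * bar y) :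
    x = 0 := by
  obtain ⟨p, rfl⟩ := mem_Zq.1 hx
  obtain ⟨r, rfl⟩ := mem_Zq.1 hy
  rw [bar_aeval] at h
  have : Invertible q⁻¹ := invertibleOfNonzero (inv_ne_zero q_ne_zero)
  have h1 := Polynomial.eval₂_reverse_mul_pow (algebraMap ℤ K) q⁻¹ r
  rw [invOf_eq_inv, inv_inv, inv_pow] at h1
  -- Multiplying by `q ^ (deg r + 1)` turns `q⁻¹ r(q⁻¹)` into the reverse of `r`, of degree at most
  -- `deg r`. The left side has degree at least `deg r + 1` unless `p = 0`.
  have h2 : Polynomial.aeval q (Polynomial.X ^ (r.natDegree + 1) * p)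
      = Polynomial.aeval q r.reverse := by
    rw [map_mul, map_pow, Polynomial.aeval_X, h, Polynomial.aeval_def q⁻¹, ← h1,
      Polynomial.aeval_def]
    have := q_ne_zero
    field_simp
    ring
  have h3 := aeval_q_injective h2
  by_cases hp : p = 0
  · simp [hp]
  · have h4 := congrArg Polynomial.natDegree h3
    rw [Polynomial.natDegree_mul (by simp) hp, Polynomial.natDegree_X_pow] at h4
    have h5 := Polynomial.reverse_natDegree_le r
    omega

/-- A bar-invariant element of `qℤ[q]` vanishes. -/
lemma eq_zero_of_bar_eq {x : K} (hx : x ∈ Zq) (h : bar (q * x) = q * x) : x = 0 := by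
  have h1 : q * x = q⁻¹ * bar x := by rw [← h]; simp
  have := eq_zero_of_eq_inv_mul_bar (mul_mem q_mem_Zq hx) hx h1
  exact (mul_eq_zero.1 this).resolve_left q_ne_zero

lemma exists_const_add {x : K} (hx : x ∈ Zq) : ∃ c : ℤ, ∃ y ∈ Zq, x = c + q * y := by
  obtain ⟨p, rfl⟩ := mem_Zq.1 hx
  refine ⟨p.coeff 0, Polynomial.aeval q p.divX, mem_Zq.2 ⟨_, rfl⟩, ?_⟩
  conv_lhs => rw [← Polynomial.X_mul_divX_add p]
  simp [add_comm]

/-- If `x` and `bar x` both lie in `ℤ[q]`, then `x` is bar-invariant. -/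
lemma bar_eq_of_mem {x : K} (hx : x ∈ Zq) (h : bar x ∈ Zq) : bar x = x := by
  obtain ⟨c, y, hy, rfl⟩ := exists_const_add hx
  have h1 : bar (c + q * y) - c = q⁻¹ * bar y := by simp
  have h2 : bar (c + q * y) - c = 0 :=
    eq_zero_of_eq_inv_mul_bar (sub_mem h (intCast_mem Zq c)) hy h1
  rw [h2] at h1
  have h3 : bar y = 0 := (mul_eq_zero.1 h1.symm).resolve_left (inv_ne_zero q_ne_zero)
  have h4 : y = 0 := by rw [← bar_bar y, h3, map_zero]
  simp [h4]

/-- The ring `ℤ[q, q⁻¹]`. -/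
abbrev Zqq : Subalgebra ℤ K := Algebra.adjoin ℤ {q, q⁻¹}

lemma q_mem_Zqq : q ∈ Zqq := Algebra.subset_adjoin (by simp)

lemma q_inv_mem_Zqq : q⁻¹ ∈ Zqq := Algebra.subset_adjoin (by simp)

lemma Zq_le_Zqq : Zq ≤ Zqq := Algebra.adjoin_mono (by simp)

lemma zpow_mem_Zqq (k : ℤ) : q ^ k ∈ Zqq := by
  cases k with
  | ofNat k => simpa using pow_mem q_mem_Zqq k
  | negSucc k =>
    rw [zpow_negSucc, ← inv_pow]
    exact pow_mem q_inv_mem_Zqq _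

lemma bar_zpow (k : ℤ) : bar (q ^ k) = q ^ (-k) := by
  rw [map_zpow₀, bar_q, inv_zpow, zpow_neg]

lemma bar_mem_Zqq {x : K} (hx : x ∈ Zqq) : bar x ∈ Zqq := by
  induction hx using Algebra.adjoin_induction with
  | mem x hx =>
    rcases hx with rfl | hx
    · rw [bar_q]; exact q_inv_mem_Zqq
    · rw [Set.mem_singleton_iff.1 hx, map_inv₀, bar_q, inv_inv]; exact q_mem_Zqq
  | algebraMap r => simp
  | add x y _ _ hx hy => rw [map_add]; exact add_mem hx hy
  | mul x y _ _ hx hy => rw [map_mul]; exact mul_mem hx hy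

/-- `ℤ[q, q⁻¹]` is the sum of `ℤ[q]` and `bar (qℤ[q])`. -/
lemma exists_decomp {x : K} (hx : x ∈ Zqq) : ∃ a ∈ Zq, ∃ b ∈ Zq, x = a + bar b := by
  have hmul : ∀ a ∈ Zq, ∀ b ∈ Zq, ∃ c ∈ Zq, ∃ d ∈ Zq, a * bar b = c + bar d := by
    intro a ha b hb
    obtain ⟨p, rfl⟩ := mem_Zq.1 ha
    obtain ⟨r, rfl⟩ := mem_Zq.1 hb
    induction p using Polynomial.induction_on' with
    | add p p' h h' =>
      obtain ⟨c, hc, d, hd, e⟩ := h (mem_Zq.2 ⟨_, rfl⟩)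
      obtain ⟨c', hc', d', hd', e'⟩ := h' (mem_Zq.2 ⟨_, rfl⟩)
      refine ⟨c + c', add_mem hc hc', d + d', add_mem hd hd', ?_⟩
      rw [map_add, add_mul, e, e', map_add]; ring
    | monomial k z =>
      induction r using Polynomial.induction_on' with
      | add r r' h h' =>
        obtain ⟨c, hc, d, hd, e⟩ := h (mem_Zq.2 ⟨_, rfl⟩)
        obtain ⟨c', hc', d', hd', e'⟩ := h' (mem_Zq.2 ⟨_, rfl⟩)
        refine ⟨c + c', add_mem hc hc', d + d', add_mem hd hd', ?_⟩
        rw [map_add, map_add, mul_add, e, e', map_add]; ring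
      | monomial l y =>
        rcases le_total l k with hlk | hlk
        · refine ⟨(z * y : ℤ) * q ^ (k - l),
            mul_mem (intCast_mem _ _) (pow_mem q_mem_Zq _), 0, zero_mem _, ?_⟩
          rw [pow_sub₀ _ q_ne_zero hlk]
          simp [Polynomial.aeval_monomial]
          ring
        · refine ⟨0, zero_mem _, (z * y : ℤ) * q ^ (l - k),
            mul_mem (intCast_mem _ _) (pow_mem q_mem_Zq _), ?_⟩
          rw [pow_sub₀ _ q_ne_zero hlk]
          simp [Polynomial.aeval_monomial]
          ring
  induction hx using Algebra.adjoin_induction with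
  | mem x hx =>
    rcases hx with rfl | hx
    · exact ⟨q, q_mem_Zq, 0, zero_mem _, by simp⟩
    · exact ⟨0, zero_mem _, q, q_mem_Zq, by simpa using hx⟩
  | algebraMap r => exact ⟨algebraMap ℤ K r, Subalgebra.algebraMap_mem _ _, 0, zero_mem _, by simp⟩
  | add x y _ _ hx hy =>
    obtain ⟨c, hc, d, hd, rfl⟩ := hx
    obtain ⟨c', hc', d', hd', rfl⟩ := hy
    refine ⟨c + c', add_mem hc hc', d + d', add_mem hd hd', ?_⟩
    rw [map_add]; ring
  | mul x y _ _ hx hy =>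
    obtain ⟨c, hc, d, hd, rfl⟩ := hx
    obtain ⟨c', hc', d', hd', rfl⟩ := hy
    obtain ⟨c₁, hc₁, d₁, hd₁, e₁⟩ := hmul c hc d' hd'
    obtain ⟨c₂, hc₂, d₂, hd₂, e₂⟩ := hmul c' hc' d hd
    refine ⟨c * c' + c₁ + c₂, add_mem (add_mem (mul_mem hc hc') hc₁) hc₂,
      d * d' + d₁ + d₂, add_mem (add_mem (mul_mem hd hd') hd₁) hd₂, ?_⟩
    calc (c + bar d) * (c' + bar d') = c * c' + c * bar d' + c' * bar d + bar d * bar d' := by ring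
      _ = _ := by rw [e₁, e₂, map_add, map_add, map_mul]; ring

/-- An element `x` of `ℤ[q, q⁻¹]` with `bar x = -x` is `s - bar s` for some `s ∈ qℤ[q]`. -/
lemma exists_sub_bar {x : K} (hx : x ∈ Zqq) (h : bar x = -x) :
    ∃ s ∈ Zq, x = q * s - bar (q * s) := by
  obtain ⟨a, ha, b, hb, rfl⟩ := exists_decomp hx
  have h1 : bar (a + b) = -(a + b) := by
    rw [map_add, bar_bar] at h
    rw [map_add]; linear_combination h
  -- `a + b` and its bar both lie in `ℤ[q]`, so `a + b` is fixed as well as negated; hence it is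
  -- zero and `x = a - bar a`.
  have h2 : bar (a + b) = a + b := bar_eq_of_mem (add_mem ha hb) (by
    rw [h1]; exact neg_mem (add_mem ha hb))
  have h3 : b = -a := by
    have : (2 : K) * (a + b) = 0 := by linear_combination h1 - h2
    have h0 := (mul_eq_zero.1 this).resolve_left two_ne_zero
    linear_combination h0
  subst h3
  -- The constant term of `a` cancels in `a - bar a`, which leaves a representative in `qℤ[q]`.
  obtain ⟨c, y, hy, rfl⟩ := exists_const_add ha
  refine ⟨y, hy, ?_⟩
  simp only [map_neg, map_add, map_intCast, map_mul, bar_q]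
  ring

end


local instance ringOqM {n : ℕ} : Ring (OqM n) := Algebra.semiringToRing K
local instance negOqM {n : ℕ} : Neg (OqM n) := ringOqM.toNeg
local instance subOqM {n : ℕ} : Sub (OqM n) := ringOqM.toSub

/-! ### Relations of the quantum matrix algebra -/

/-- The parameter `v = q²` of the defining relations. -/
def v : K := q ^ 2

/-- The coefficient `v - v⁻¹` of the defining relations. -/
def lam : K := v - v⁻¹

lemma v_ne_zero : v ≠ 0 := pow_ne_zero _ q_ne_zero

lemma v_mem_Zqq : v ∈ Zqq := pow_mem q_mem_Zqq 2

lemma v_inv_mem_Zqq : v⁻¹ ∈ Zqq := by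
  rw [v, ← inv_pow]; exact pow_mem q_inv_mem_Zqq 2

lemma lam_mem_Zqq : lam ∈ Zqq := sub_mem v_mem_Zqq v_inv_mem_Zqq

@[simp] lemma bar_v : bar v = v⁻¹ := by simp [v]

@[simp] lemma bar_lam : bar lam = -lam := by simp [lam]

variable {n : ℕ}

lemma Z_row (i : Fin n) {j k : Fin n} (h : j < k) : Z i j * Z i k = v • (Z i k * Z i j) := by
  have := RingQuot.mkAlgHom_rel K (MRel.row i j k h)
  rwa [map_smul, map_mul, map_mul] at this

lemma Z_col {i k : Fin n} (j : Fin n) (h : i < k) : Z i j * Z k j = v • (Z k j * Z i j) := by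
  have := RingQuot.mkAlgHom_rel K (MRel.col i k j h)
  rwa [map_smul, map_mul, map_mul] at this

lemma Z_anti {i j s t : Fin n} (h₁ : s < i) (h₂ : j < t) : Z i j * Z s t = Z s t * Z i j := by
  have := RingQuot.mkAlgHom_rel K (MRel.anti i j s t h₁ h₂)
  rwa [map_mul, map_mul] at this

lemma Z_diag {i j s t : Fin n} (h₁ : i < s) (h₂ : j < t) :
    Z i j * Z s t = Z s t * Z i j + lam • (Z i t * Z s j) := by
  have := RingQuot.mkAlgHom_rel K (MRel.diag i j s t h₁ h₂)
  rwa [map_add, map_smul, map_mul, map_mul, map_mul] at this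

/-! ### Words, contents and the Bruhat-type order -/

/-- The generator at a position. -/
def Zp (p : Fin n × Fin n) : OqM n := Z p.1 p.2

/-- The matrix unit at a position. -/
def E (p : Fin n × Fin n) : Mat n := fun i j => if (i, j) = p then 1 else 0

lemma E_apply (p : Fin n × Fin n) (i j : Fin n) : E p i j = if (i, j) = p then 1 else 0 := rfl

/-- The sign of `b - a`. -/
def sg (a b : Fin n) : ℤ := if a < b then 1 else if b < a then -1 else 0

lemma sg_swap (a b : Fin n) : sg b a = -sg a b := by
  unfold sg
  rcases lt_trichotomy a b with h | h | h <;> simp [h, h.not_gt]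

@[simp] lemma sg_self (a : Fin n) : sg a a = 0 := by simp [sg]

/-- Half the exponent of `q` in the quasi-commutation of two generators. -/
def qc (p r : Fin n × Fin n) : ℤ :=
  (if p.1 = r.1 then sg p.2 r.2 else 0) + (if p.2 = r.2 then sg p.1 r.1 else 0)

lemma qc_swap (p r : Fin n × Fin n) : qc r p = -qc p r := by
  unfold qc
  rw [sg_swap p.2, sg_swap p.1]
  simp only [eq_comm (a := r.1), eq_comm (a := r.2)]
  split_ifs <;> ring

/-- The bilinear extension of `qc p`. -/
def pair (p : Fin n × Fin n) (A : Mat n) : ℤ := ∑ r : Fin n × Fin n, qc p r * A r.1 r.2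

lemma pair_add (p : Fin n × Fin n) (A B : Mat n) : pair p (A + B) = pair p A + pair p B := by
  simp [pair, mul_add, Finset.sum_add_distrib]

lemma pair_E (p r : Fin n × Fin n) : pair p (E r) = qc p r := by
  simp [pair, E_apply]

@[simp] lemma pair_zero (p : Fin n × Fin n) : pair p (0 : Mat n) = 0 := by
  simp [pair]

lemma pair_eq (p : Fin n × Fin n) (A : Mat n) :
    pair p A = ∑ j, sg p.2 j * A p.1 j + ∑ s, sg p.1 s * A s p.2 := by
  simp only [pair, qc, add_mul, Finset.sum_add_distrib, Fintype.sum_prod_type]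
  congr 1
  · simp
  · simp

/-- The content of a word in the positions. -/
def content : List (Fin n × Fin n) → Mat n
  | [] => 0
  | p :: w => E p + content w

/-- Half the total quasi-commutation exponent of a word. -/
def wexp : List (Fin n × Fin n) → ℤ
  | [] => 0
  | p :: w => pair p (content w) + wexp w

/-- The product of generators along a word. -/
def wprod (w : List (Fin n × Fin n)) : OqM n := (w.map Zp).prod

@[simp] lemma wprod_nil : wprod ([] : List (Fin n × Fin n)) = 1 := rfl

@[simp] lemma wprod_cons (p : Fin n × Fin n) (w : List (Fin n × Fin n)) :
    wprod (p :: w) = Zp p * wprod w := by simp [wprod]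

@[simp] lemma wprod_append (w w' : List (Fin n × Fin n)) :
    wprod (w ++ w') = wprod w * wprod w' := by simp [wprod]

@[simp] lemma content_append (w w' : List (Fin n × Fin n)) :
    content (w ++ w') = content w + content w' := by
  induction w with
  | nil => simp [content]
  | cons p w ih => simp [content, ih, add_assoc]

lemma content_apply (w : List (Fin n × Fin n)) (i j : Fin n) : content w i j = w.count (i, j) := by
  induction w with
  | nil => simp [content]
  | cons p w ih =>
    simp only [content, Matrix.add_apply, ih, E_apply, List.count_cons, beq_iff_eq]
    rw [add_comm]
    simp [eq_comm]

lemma perm_iff_content {w w' : List (Fin n × Fin n)} : w.Perm w' ↔ content w = content w' := by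
  rw [List.perm_iff_count]
  constructor
  · intro h
    ext i j
    rw [content_apply, content_apply, h]
  · intro h p
    rw [← content_apply w p.1 p.2, h, content_apply]

/-- The sum of the entries of `A` weakly north-west of `(i, k)`. -/
def nw (i k : Fin n) (A : Mat n) : ℕ := ∑ s ∈ Finset.Iic i, ∑ t ∈ Finset.Iic k, A s t

lemma nw_add (i k : Fin n) (A B : Mat n) : nw i k (A + B) = nw i k A + nw i k B := by
  simp [nw, Finset.sum_add_distrib]

lemma nw_E (i k : Fin n) (p : Fin n × Fin n) :
    nw i k (E p) = if p.1 ≤ i ∧ p.2 ≤ k then 1 else 0 := by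
  obtain ⟨a, b⟩ := p
  simp only [nw, E_apply, Prod.mk.injEq, ite_and]
  rw [Finset.sum_congr rfl (fun s _ => Finset.sum_ite_irrel _ _ _ _)]
  simp

/-- The sum of all north-west sums. -/
def mu (A : Mat n) : ℕ := ∑ i, ∑ k, nw i k A

lemma mu_add (A B : Mat n) : mu (A + B) = mu A + mu B := by
  simp [mu, nw_add, Finset.sum_add_distrib]

lemma mu_E_pos (p : Fin n × Fin n) : 0 < mu (E p) := by
  have h : nw p.1 p.2 (E p) = 1 := by simp [nw_E]
  calc 0 < nw p.1 p.2 (E p) := by omega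
    _ ≤ ∑ k, nw p.1 k (E p) :=
      Finset.single_le_sum (f := fun k => nw p.1 k (E p)) (fun _ _ => Nat.zero_le _)
        (Finset.mem_univ _)
    _ ≤ mu (E p) :=
      Finset.single_le_sum (f := fun i => ∑ k, nw i k (E p)) (fun _ _ => Nat.zero_le _)
        (Finset.mem_univ _)

/-- The strict order on matrices with fixed row and column sums defined by the north-west sums. -/
def Prec (B A : Mat n) : Prop :=
  ro B = ro A ∧ co B = co A ∧ (∀ i k, nw i k B ≤ nw i k A) ∧ mu B < mu A

lemma ro_add (A B : Mat n) : ro (A + B) = ro A + ro B := by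
  ext i; simp [ro, Finset.sum_add_distrib]

lemma co_add (A B : Mat n) : co (A + B) = co A + co B := by
  ext i; simp [co, Finset.sum_add_distrib]

lemma ro_E (p : Fin n × Fin n) (i : Fin n) : ro (E p) i = if i = p.1 then 1 else 0 := by
  obtain ⟨a, b⟩ := p
  simp only [ro, E_apply, Prod.mk.injEq, ite_and]
  rw [Finset.sum_ite_irrel]
  simp

lemma co_E (p : Fin n × Fin n) (j : Fin n) : co (E p) j = if j = p.2 then 1 else 0 := by
  obtain ⟨a, b⟩ := p
  simp only [co, E_apply, Prod.mk.injEq, ite_and]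
  simp

lemma Prec.trans {A B C : Mat n} (h : Prec A B) (h' : Prec B C) : Prec A C :=
  ⟨h.1.trans h'.1, h.2.1.trans h'.2.1, fun i k => (h.2.2.1 i k).trans (h'.2.2.1 i k),
    h.2.2.2.trans h'.2.2.2⟩

lemma Prec.add_left {A B : Mat n} (h : Prec A B) (C : Mat n) : Prec (C + A) (C + B) := by
  refine ⟨by rw [ro_add, ro_add, h.1], by rw [co_add, co_add, h.2.1], fun i k => ?_, ?_⟩
  · rw [nw_add, nw_add]; exact Nat.add_le_add_left (h.2.2.1 i k) _
  · rw [mu_add, mu_add]; exact Nat.add_lt_add_left h.2.2.2 _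

lemma Prec.add_right {A B : Mat n} (h : Prec A B) (C : Mat n) : Prec (A + C) (B + C) := by
  rw [add_comm A, add_comm B]; exact h.add_left C

lemma Prec.of_nw_lt {A B : Mat n} (hr : ro B = ro A) (hc : co B = co A)
    (h : ∀ i k, nw i k B ≤ nw i k A) (i k : Fin n) (hik : nw i k B < nw i k A) : Prec B A := by
  refine ⟨hr, hc, h, ?_⟩
  exact Finset.sum_lt_sum (fun i _ => Finset.sum_le_sum fun k _ => h i k)
    ⟨i, Finset.mem_univ _, Finset.sum_lt_sum (fun k _ => h i k) ⟨k, Finset.mem_univ _, hik⟩⟩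

/-- The north-west sums at `(a, b)` drop by one exactly when `i ≤ a < s` and `j ≤ b < t`, and agree
elsewhere. This is what makes the extra term of the diagonal relation lower. -/
lemma prec_swap {i j s t : Fin n} (h₁ : i < s) (h₂ : j < t) :
    Prec (E (i, t) + E (s, j)) (E (i, j) + E (s, t)) := by
  refine Prec.of_nw_lt ?_ ?_ ?_ i j ?_
  · ext a; simp [ro_add, ro_E]
  · ext a; simp [co_add, co_E, add_comm]
  · intro a b
    simp only [nw_add, nw_E]
    split_ifs <;> omega
  · simp [nw_add, nw_E, h₁.not_ge, h₂.not_ge]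

/-- The order in which the positions are read. -/
def Before (r p : Fin n × Fin n) : Prop := r.1 < p.1 ∨ (r.1 = p.1 ∧ r.2 < p.2)

lemma exists_first (P : Fin n × Fin n → Prop) (h : ∃ p, P p) :
    ∃ p, P p ∧ ∀ r, Before r p → ¬ P r := by
  classical
  obtain ⟨p₀, hp₀⟩ := h
  obtain ⟨p, hp, hmin⟩ := Finset.exists_min_image (Finset.univ.filter P)
    (fun r => (toLex r : Fin n ×ₗ Fin n)) ⟨p₀, by simpa using hp₀⟩
  refine ⟨p, by simpa using hp, fun r hr hPr => ?_⟩
  have := hmin r (by simpa using hPr)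
  exact absurd this (not_le.2 ((Prod.Lex.toLex_lt_toLex).2 hr))

/-- At the first position where the matrices differ, all other entries weakly north-west of it
agree, so the inequality of north-west sums is an inequality of the two entries. -/
lemma Prec.lexLT {A B : Mat n} (h : Prec B A) : LexLT B A := by
  have hne : ∃ p : Fin n × Fin n, B p.1 p.2 ≠ A p.1 p.2 := by
    by_contra hcon
    push Not at hcon
    have : B = A := by ext i j; exact hcon (i, j)
    have h' := h.2.2.2
    rw [this] at h'
    exact lt_irrefl _ h'
  obtain ⟨⟨i, j⟩, hp, hmin⟩ := exists_first _ hne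
  have hb : ∀ s t : Fin n, (s < i ∨ (s = i ∧ t < j)) → B s t = A s t := by
    intro s t hst
    simpa using hmin (s, t) hst
  refine ⟨i, j, lt_of_le_of_ne ?_ hp, hb⟩
  have hnw := h.2.2.1 i j
  have split : ∀ C : Mat n, nw i j C = ∑ s ∈ Finset.Iio i, ∑ t ∈ Finset.Iic j, C s t
      + (∑ t ∈ Finset.Iio j, C i t + C i j) := by
    intro C
    rw [nw, ← Finset.Iio_insert, Finset.sum_insert (by simp), add_comm]
    congr 1
    rw [← Finset.Iio_insert, Finset.sum_insert (by simp), add_comm]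
  have e₁ : ∑ s ∈ Finset.Iio i, ∑ t ∈ Finset.Iic j, B s t
      = ∑ s ∈ Finset.Iio i, ∑ t ∈ Finset.Iic j, A s t :=
    Finset.sum_congr rfl fun s hs => Finset.sum_congr rfl fun t _ =>
      hb s t (Or.inl (Finset.mem_Iio.1 hs))
  have e₂ : ∑ t ∈ Finset.Iio j, B i t = ∑ t ∈ Finset.Iio j, A i t :=
    Finset.sum_congr rfl fun t ht => hb i t (Or.inr ⟨rfl, Finset.mem_Iio.1 ht⟩)
  rw [split, split, e₁, e₂] at hnw
  change B i j ≤ A i j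
  omega

/-- The quasi-commutation of two generators, with an error term lower in the order. -/
lemma Zp_mul_Zp (p r : Fin n × Fin n) : ∃ (t : Zqq) (a b : Fin n × Fin n),
    Zp p * Zp r = q ^ (2 * qc p r) • (Zp r * Zp p) + (t : K) • (Zp a * Zp b) ∧
    (t = 0 ∨ Prec (E a + E b) (E p + E r)) := by
  obtain ⟨i, j⟩ := p
  obtain ⟨s, t⟩ := r
  have hv : q ^ (2 : ℤ) = v := by rw [v]; norm_cast
  have hv' : q ^ (-2 : ℤ) = v⁻¹ := by rw [zpow_neg, hv]
  have hvv : v⁻¹ * v = 1 := inv_mul_cancel₀ v_ne_zero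
  rcases lt_trichotomy i s with h₁ | h₁ | h₁
  · rcases lt_trichotomy j t with h₂ | h₂ | h₂
    · refine ⟨⟨lam, lam_mem_Zqq⟩, (i, t), (s, j), ?_, Or.inr (prec_swap h₁ h₂)⟩
      simpa [qc, h₁.ne, h₂.ne, Zp] using Z_diag h₁ h₂
    · subst h₂
      refine ⟨0, (i, j), (i, j), ?_, Or.inl rfl⟩
      simpa [qc, h₁.ne, sg, h₁, Zp, hv] using Z_col j h₁
    · refine ⟨0, (i, j), (i, j), ?_, Or.inl rfl⟩
      simpa [qc, h₁.ne, h₂.ne', Zp] using (Z_anti h₁ h₂).symm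
  · subst h₁
    rcases lt_trichotomy j t with h₂ | h₂ | h₂
    · refine ⟨0, (i, j), (i, j), ?_, Or.inl rfl⟩
      simpa [qc, h₂.ne, sg, h₂, Zp, hv] using Z_row i h₂
    · subst h₂
      exact ⟨0, (i, j), (i, j), by simp [qc], Or.inl rfl⟩
    · refine ⟨0, (i, j), (i, j), ?_, Or.inl rfl⟩
      have := congrArg (v⁻¹ • ·) (Z_row i h₂)
      simp only [smul_smul, hvv, one_smul] at this
      simpa [qc, h₂.ne', sg, h₂, h₂.not_gt, Zp, hv'] using this.symm
  · rcases lt_trichotomy j t with h₂ | h₂ | h₂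
    · refine ⟨0, (i, j), (i, j), ?_, Or.inl rfl⟩
      simpa [qc, h₁.ne', h₂.ne, Zp] using Z_anti h₁ h₂
    · subst h₂
      refine ⟨0, (i, j), (i, j), ?_, Or.inl rfl⟩
      have := congrArg (v⁻¹ • ·) (Z_col j h₁)
      simp only [smul_smul, hvv, one_smul] at this
      simpa [qc, h₁.ne', sg, h₁, h₁.not_gt, Zp, hv'] using this.symm
    · refine ⟨⟨-lam, neg_mem lam_mem_Zqq⟩, (s, j), (i, t), ?_, Or.inr ?_⟩
      · have hd := Z_diag h₁ h₂
        simp only [qc, Zp, h₁.ne', h₂.ne', if_false, add_zero, mul_zero, zpow_zero, one_smul]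
        rw [hd]
        change _ = _ + (-lam) • _
        rw [neg_smul, add_neg_cancel_right]
      · rw [add_comm (E (i, j))]
        exact prec_swap h₁ h₂

section

variable {n : ℕ}

/-! ### Normalized monomials and straightening -/

/-- The positions in lexicographic order. -/
def posList (n : ℕ) : List (Fin n × Fin n) :=
  (List.finRange n).flatMap fun i => (List.finRange n).map fun j => (i, j)

lemma mem_posList (p : Fin n × Fin n) : p ∈ posList n := by
  simp [posList]

lemma pairwise_posList (n : ℕ) : (posList n).Pairwise Before := by
  rw [posList, List.pairwise_flatMap]
  have h : (List.finRange n).Pairwise (· < ·) := List.pairwise_lt_finRange n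
  refine ⟨fun i _ => ?_, ?_⟩
  · rw [List.pairwise_map]
    exact h.imp fun hjk => Or.inr ⟨rfl, hjk⟩
  · refine h.imp fun {i s} his => ?_
    intro x hx y hy
    simp only [List.mem_map] at hx hy
    obtain ⟨j, _, rfl⟩ := hx
    obtain ⟨t, _, rfl⟩ := hy
    exact Or.inl his

lemma mon_eq_posList (A : Mat n) :
    mon A = ((posList n).map fun p => Zp p ^ A p.1 p.2).prod := by
  simp only [mon, posList, List.ofFn_eq_map, List.map_flatMap, List.map_map]
  rw [List.flatMap_def, List.prod_flatten, List.map_map]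
  rfl

lemma before_irrefl (p : Fin n × Fin n) : ¬ Before p p := by
  rintro (h | ⟨_, h⟩) <;> exact lt_irrefl _ h

lemma posList_split (p : Fin n × Fin n) : ∃ l₁ l₂, posList n = l₁ ++ p :: l₂ ∧
    (∀ r ∈ l₁, Before r p) ∧ ∀ r ∈ l₂, Before p r := by
  obtain ⟨l₁, l₂, h⟩ := List.append_of_mem (mem_posList p)
  have hp := pairwise_posList n
  rw [h, List.pairwise_append, List.pairwise_cons] at hp
  exact ⟨l₁, l₂, h, fun r hr => hp.2.2 r hr p (by simp), hp.2.1.1⟩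

/-- If `A` vanishes before the position `p`, then `Z_p` can be put in front of the monomial. -/
lemma mon_E_add {A : Mat n} {p : Fin n × Fin n} (h : ∀ r, Before r p → A r.1 r.2 = 0) :
    mon (E p + A) = Zp p * mon A := by
  obtain ⟨l₁, l₂, hl, h₁, h₂⟩ := posList_split p
  have hone : ∀ B : Mat n, (∀ r, Before r p → B r.1 r.2 = 0) →
      (l₁.map fun r => Zp r ^ B r.1 r.2).prod = 1 := by
    intro B hB
    apply List.prod_eq_one
    simp only [List.mem_map, forall_exists_index, and_imp]
    rintro _ r hr rfl
    rw [hB r (h₁ r hr), pow_zero]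
  have hne : ∀ r, r ≠ p → (E p + A) r.1 r.2 = A r.1 r.2 := by
    intro r hr
    simp [E_apply, hr]
  rw [mon_eq_posList, mon_eq_posList, hl, List.map_append, List.map_append, List.prod_append,
    List.prod_append, hone A h, hone (E p + A) (fun r hr => by
      rw [hne r (fun e => before_irrefl p (e ▸ hr)), h r hr]), one_mul, one_mul, List.map_cons,
    List.map_cons, List.prod_cons, List.prod_cons, ← mul_assoc]
  congr 1
  · rw [Matrix.add_apply, E_apply, if_pos rfl, pow_add, pow_one]
  · congr 1
    apply List.map_congr_left
    intro r hr
    rw [hne r (fun e => before_irrefl p (by simpa [e] using h₂ r hr))]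

lemma mon_zero : mon (0 : Mat n) = 1 := by
  rw [mon_eq_posList]
  apply List.prod_eq_one
  simp

/-- The sum of the entries of `A` in the row and the column of `p`, excluding `p` itself. -/
def hook (p : Fin n × Fin n) (A : Mat n) : ℕ :=
  ∑ j ∈ Finset.univ.erase p.2, A p.1 j + ∑ s ∈ Finset.univ.erase p.1, A s p.2

lemma sum_lt_pairs (f : Fin n → ℕ) (b : Fin n) :
    ∑ j, ∑ k ∈ Finset.univ.filter (fun k : Fin n => k < j),
      ((if j = b then 1 else 0) + f j) * ((if k = b then 1 else 0) + f k)
    = ∑ j, ∑ k ∈ Finset.univ.filter (fun k : Fin n => k < j), f j * f k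
      + ∑ j ∈ Finset.univ.erase b, f j := by
  have e : ∀ j k : Fin n, k < j → ((if j = b then 1 else 0) + f j) * ((if k = b then 1 else 0) + f k)
      = f j * f k + ((if j = b then f k else 0) + (if k = b then f j else 0)) := by
    intro j k hkj
    by_cases h1 : j = b
    · have h2 : k ≠ b := by rintro rfl; exact absurd h1 hkj.ne'
      simp [h1, h2]; ring
    · by_cases h2 : k = b <;> simp [h1, h2]; ring
  rw [Finset.sum_congr rfl fun j _ => Finset.sum_congr rfl fun k hk => e j k (by simpa using hk)]
  simp only [Finset.sum_add_distrib]
  congr 1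
  have h1 : ∑ j, ∑ k ∈ Finset.univ.filter (fun k : Fin n => k < j), (if j = b then f k else 0)
      = ∑ k ∈ Finset.univ.filter (fun k : Fin n => k < b), f k := by
    rw [Finset.sum_eq_single b]
    · simp
    · intro j _ hj; simp [hj]
    · simp
  have h2 : ∑ j, ∑ k ∈ Finset.univ.filter (fun k : Fin n => k < j), (if k = b then f j else 0)
      = ∑ j ∈ Finset.univ.filter (fun j : Fin n => b < j), f j := by
    rw [Finset.sum_filter]
    apply Finset.sum_congr rfl
    intro j _
    simp [Finset.sum_ite_eq']
  rw [h1, h2, ← Finset.sum_union]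
  · apply Finset.sum_congr _ (fun _ _ => rfl)
    ext k
    simp [lt_or_lt_iff_ne]
  · rw [Finset.disjoint_left]
    intro k
    simp only [Finset.mem_filter, Finset.mem_univ, true_and]
    exact fun h h' => lt_asymm h h'

lemma dexp_E_add (p : Fin n × Fin n) (A : Mat n) : dexp (E p + A) = dexp A + hook p A := by
  obtain ⟨a, b⟩ := p
  have h1 : ∀ i, (∑ j : Fin n, ∑ k ∈ Finset.univ.filter (fun k : Fin n => k < j),
        (E (a, b) + A) i j * (E (a, b) + A) i k)
      = ∑ j : Fin n, ∑ k ∈ Finset.univ.filter (fun k : Fin n => k < j), A i j * A i k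
        + if i = a then ∑ j ∈ Finset.univ.erase b, A a j else 0 := by
    intro i
    by_cases h : i = a
    · subst h
      simpa [E_apply] using sum_lt_pairs (A i) b
    · simp [E_apply, h]
  have h2 : ∀ i, (∑ j : Fin n, ∑ k ∈ Finset.univ.filter (fun k : Fin n => k < j),
        (E (a, b) + A) j i * (E (a, b) + A) k i)
      = ∑ j : Fin n, ∑ k ∈ Finset.univ.filter (fun k : Fin n => k < j), A j i * A k i
        + if i = b then ∑ j ∈ Finset.univ.erase a, A j b else 0 := by
    intro i
    by_cases h : i = b
    · subst h
      simpa [E_apply] using sum_lt_pairs (fun s => A s i) a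
    · simp [E_apply, h]
  simp only [dexp, h1, h2, Finset.sum_add_distrib, hook]
  simp
  ring

/-- Only positions not before `p` carry nonzero entries, so every sign `sg` that counts is `+1`.
Thus the normalization `dexp` is the exponent `wexp` of the sorted word. -/
lemma pair_eq_hook {p : Fin n × Fin n} {A : Mat n} (h : ∀ r, Before r p → A r.1 r.2 = 0) :
    pair p A = hook p A := by
  rw [pair_eq, hook]
  push_cast
  congr 1
  · rw [← Finset.add_sum_erase _ _ (Finset.mem_univ p.2)]
    simp only [sg_self, zero_mul, zero_add]
    apply Finset.sum_congr rfl
    intro j hj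
    rcases lt_or_gt_of_ne (Finset.ne_of_mem_erase hj) with hlt | hlt
    · simp [h (p.1, j) (Or.inr ⟨rfl, hlt⟩)]
    · simp [sg, hlt]
  · rw [← Finset.add_sum_erase _ _ (Finset.mem_univ p.1)]
    simp only [sg_self, zero_mul, zero_add]
    apply Finset.sum_congr rfl
    intro s hs
    rcases lt_or_gt_of_ne (Finset.ne_of_mem_erase hs) with hlt | hlt
    · simp [h (s, p.2) (Or.inl hlt)]
    · simp [sg, hlt]

lemma ZN_eq (A : Mat n) : ZN A = q ^ (-(dexp A : ℤ)) • mon A := by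
  rw [ZN, inv_pow, zpow_neg, zpow_natCast]

lemma Zp_mul_ZN {A : Mat n} {p : Fin n × Fin n} (h : ∀ r, Before r p → A r.1 r.2 = 0) :
    Zp p * ZN A = q ^ (hook p A : ℤ) • ZN (E p + A) := by
  rw [ZN_eq, ZN_eq, mon_E_add h, dexp_E_add, mul_smul_comm, smul_smul, ← zpow_add₀ q_ne_zero]
  congr 2
  push_cast
  ring

lemma exists_peel {A : Mat n} (hA : A ≠ 0) : ∃ (p : Fin n × Fin n) (B : Mat n),
    A = E p + B ∧ ∀ r, Before r p → B r.1 r.2 = 0 := by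
  have hne : ∃ p : Fin n × Fin n, A p.1 p.2 ≠ 0 := by
    by_contra hcon
    push Not at hcon
    exact hA (by ext i j; exact hcon (i, j))
  obtain ⟨p, hp, hmin⟩ := exists_first _ hne
  refine ⟨p, Matrix.of fun i j => A i j - E p i j, ?_, fun r hr => ?_⟩
  · ext i j
    rw [Matrix.add_apply, Matrix.of_apply, E_apply]
    split_ifs with h
    · subst h
      simp only at hp
      omega
    · simp
  · have := hmin r hr
    push Not at this
    simp [this]

/-- The sorted word of a matrix. -/
lemma exists_word (A : Mat n) : ∃ w, content w = A ∧ q ^ (-wexp w) • wprod w = ZN A := by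
  induction h : mu A using Nat.strong_induction_on generalizing A with
  | _ m ih =>
    by_cases hA : A = 0
    · subst hA
      refine ⟨[], rfl, ?_⟩
      rw [ZN_eq, mon_zero]
      simp [wexp, dexp]
    · obtain ⟨p, B, rfl, hB⟩ := exists_peel hA
      obtain ⟨w, rfl, hw⟩ := ih (mu B) (by rw [← h, mu_add]; have := mu_E_pos p; omega) B rfl
      refine ⟨p :: w, rfl, ?_⟩
      have h1 := Zp_mul_ZN hB
      rw [← hw, mul_smul_comm, ← pair_eq_hook hB] at h1
      rw [wexp, wprod_cons, neg_add, zpow_add₀ q_ne_zero, ← smul_smul, h1, smul_smul,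
        ← zpow_add₀ q_ne_zero]
      simp

/-- The `ℤ[q, q⁻¹]`-span of the normalized monomials strictly below `A`. -/
def lower (A : Mat n) : Submodule Zqq (OqM n) := Submodule.span Zqq (ZN '' {B | Prec B A})

lemma lower_mono {A B : Mat n} (h : Prec A B) : lower A ≤ lower B :=
  Submodule.span_mono (Set.image_mono fun _ hC => hC.trans h)

lemma ZN_mem_lower {A B : Mat n} (h : Prec B A) : ZN B ∈ lower A :=
  Submodule.subset_span ⟨B, h, rfl⟩

lemma smul_mem_of_mem {S : Submodule Zqq (OqM n)} {c : K} (hc : c ∈ Zqq) {x : OqM n} (hx : x ∈ S) :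
    c • x ∈ S :=
  S.smul_mem ⟨c, hc⟩ hx

lemma smul_mem_iff_of_zpow {S : Submodule Zqq (OqM n)} (k : ℤ) {x : OqM n} :
    q ^ k • x ∈ S ↔ x ∈ S := by
  refine ⟨fun h => ?_, smul_mem_of_mem (zpow_mem_Zqq k)⟩
  have := smul_mem_of_mem (zpow_mem_Zqq (-k)) h
  rwa [smul_smul, ← zpow_add₀ q_ne_zero, neg_add_cancel, zpow_zero, one_smul] at this

/-- Straightening: up to lower terms, a word equals a power of `q` times the normalized monomial
of its content. -/
theorem straighten (w : List (Fin n × Fin n)) :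
    q ^ (-wexp w) • wprod w - ZN (content w) ∈ lower (content w) := by
  induction h : mu (content w) using Nat.strong_induction_on generalizing w with
  | _ m ih =>
    have ih' : ∀ (u : List (Fin n × Fin n)) (A : Mat n), mu A = m → Prec (content u) A →
        wprod u ∈ lower A := by
      intro u A hA hu
      have h1 := ih (mu (content u)) (by rw [← hA]; exact hu.2.2.2) u rfl
      have h2 := add_mem (lower_mono hu h1) (ZN_mem_lower hu)
      rw [sub_add_cancel, smul_mem_iff_of_zpow] at h2
      exact h2
    -- It is enough to compare two words of equal content, since `ZN` is itself a normalized sorted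
    -- word. Induction on the permutation reduces this to exchanging the first two letters.
    have key : ∀ u u' : List (Fin n × Fin n), u.Perm u' → mu (content u) = m →
        q ^ (-wexp u) • wprod u - q ^ (-wexp u') • wprod u' ∈ lower (content u) := by
      intro u u' huu
      induction huu with
      | nil => intro _; simp
      | @cons x u u' hu _ =>
        intro hm
        have hc : content u' = content u := (perm_iff_content.1 hu).symm
        have hmu : mu (content u) < m := by
          rw [← hm, content, mu_add]; have := mu_E_pos x; omega
        have h1 := sub_mem (ih _ hmu u rfl) (hc ▸ ih _ (hc ▸ hmu) u' rfl)
        rw [sub_sub_sub_cancel_right] at h1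
        -- Prepending `x` to the word of a lower monomial gives a word of content below `content (x
        -- :: u)`, which the outer induction on `mu` already straightens.
        have h2 : ∀ y ∈ lower (content u), Zp x * y ∈ lower (content (x :: u)) := by
          intro y hy
          induction hy using Submodule.span_induction with
          | mem y hy =>
            obtain ⟨B, hB, rfl⟩ := hy
            obtain ⟨b, rfl, hb⟩ := exists_word B
            rw [← hb, mul_smul_comm, smul_mem_iff_of_zpow, ← wprod_cons]
            exact ih' _ _ hm (hB.add_left (E x))
          | zero => simp
          | add y z _ _ hy hz => rw [mul_add]; exact add_mem hy hz
          | smul c y _ hy => rw [mul_smul_comm]; exact Submodule.smul_mem _ _ hy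
        have h3 := (smul_mem_iff_of_zpow (-pair x (content u))).2 (h2 _ h1)
        convert h3 using 1
        rw [wexp, wexp, hc, neg_add, neg_add, zpow_add₀ q_ne_zero, zpow_add₀ q_ne_zero,
          wprod_cons, wprod_cons, mul_sub, mul_smul_comm, mul_smul_comm, smul_sub, smul_smul,
          smul_smul]
      | swap x y u =>
        intro hm
        obtain ⟨t, a, b, e, ht⟩ := Zp_mul_Zp y x
        have h1 : (t : K) • wprod (a :: b :: u) ∈ lower (content (y :: x :: u)) := by
          rcases ht with rfl | ht
          · simp
          · refine smul_mem_of_mem t.2 (ih' _ _ hm ?_)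
            have := ht.add_right (content u)
            rwa [add_assoc, add_assoc] at this
        have h2 := (smul_mem_iff_of_zpow (-wexp (y :: x :: u))).2 h1
        convert h2 using 1
        rw [wprod_cons, wprod_cons, ← mul_assoc, e, add_mul, smul_mul_assoc, smul_add, smul_smul,
          ← zpow_add₀ q_ne_zero]
        -- The two exponents differ only in the pair formed by the first two letters, and `qc` is
        -- antisymmetric. The factor 2 is thus the one in `Zp_mul_Zp`.
        have e2 : -wexp (y :: x :: u) + 2 * qc y x = -wexp (x :: y :: u) := by
          simp only [wexp, content, pair_add, pair_E]
          rw [qc_swap y x]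
          ring
        rw [e2, wprod_cons, wprod_cons, wprod_cons, wprod_cons, mul_assoc, smul_mul_assoc,
          mul_assoc, add_sub_cancel_left]
      | @trans u₁ u₂ u₃ h₁₂ _ ih₁ ih₂ =>
        intro hm
        have hc := perm_iff_content.1 h₁₂
        have := add_mem (ih₁ hm) (hc ▸ ih₂ (hc ▸ hm))
        rwa [sub_add_sub_cancel] at this
    obtain ⟨w₀, hw₀, hz⟩ := exists_word (content w)
    rw [← hz]
    exact key w w₀ (perm_iff_content.2 hw₀.symm) h

end

section

/-! ### The RTT relations -/

section RTT

variable {F A : Type*} [Field F] [Ring A] [Algebra F A] {n : ℕ}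

/-- The uniform (R-matrix) form of the defining relations of quantum matrices, for a matrix `T`
whose rows are indexed by a linear order. -/
def IsRTT {ι : Type*} [LinearOrder ι] (x : F) (T : ι → Fin n → A) : Prop :=
  ∀ (i s : ι) (j t : Fin n),
    (if i = s then x else 1) • (T i j * T s t) + (if s < i then x - x⁻¹ else 0) • (T s j * T i t)
    = (if j = t then x else 1) • (T s t * T i j) + (if j < t then x - x⁻¹ else 0) • (T s j * T i t)

/-- Compatibility with the coproduct: the relations of `T` move the row indices `i, s` onto the
summation indices, and those of `L` then move the latter onto the columns `j, t`. Exchanging the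
names of the summation indices links the two steps. -/
lemma IsRTT.mul_sum {ι : Type*} [LinearOrder ι] {x : F} {T : ι → Fin n → A}
    {L : Fin n → Fin n → A} (hT : IsRTT x T) (hL : IsRTT x L)
    (hc : ∀ i j l k, L l k * T i j = T i j * L l k) :
    IsRTT x (fun i j => ∑ l, T i l * L l j) := by
  intro i s j t
  have e : ∀ (i s : ι) (j t : Fin n), (∑ l, T i l * L l j) * (∑ m, T s m * L m t)
      = ∑ l, ∑ m, (T i l * T s m) * (L l j * L m t) := by
    intro i s j t
    rw [Finset.sum_mul_sum]
    refine Finset.sum_congr rfl fun l _ => Finset.sum_congr rfl fun m _ => ?_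
    rw [mul_assoc, ← mul_assoc (L l j), hc, mul_assoc, mul_assoc]
  have e' : ∀ (i s : ι) (j t : Fin n), (∑ l, T i l * L l j) * (∑ m, T s m * L m t)
      = ∑ l, ∑ m, (T i m * T s l) * (L m j * L l t) := by
    intro i s j t
    rw [e, Finset.sum_comm]
  simp only []
  calc _ = ∑ l, ∑ m, ((if i = s then x else 1) • (T i l * T s m)
        + (if s < i then x - x⁻¹ else 0) • (T s l * T i m)) * (L l j * L m t) := by
        rw [e, e]
        simp only [Finset.smul_sum, ← Finset.sum_add_distrib, add_mul, smul_mul_assoc]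
    _ = ∑ l, ∑ m, ((if l = m then x else 1) • ((T s m * T i l) * (L l j * L m t)))
        + ∑ l, ∑ m, ((if l < m then x - x⁻¹ else 0) • ((T s l * T i m) * (L l j * L m t))) := by
        simp only [hT i s, ← Finset.sum_add_distrib, add_mul, smul_mul_assoc]
    _ = ∑ l, ∑ m, (T s m * T i l) * ((if l = m then x else 1) • (L l j * L m t)
        + (if m < l then x - x⁻¹ else 0) • (L m j * L l t)) := by
        rw [Finset.sum_comm (f := fun l m => (if l < m then x - x⁻¹ else 0) •
          ((T s l * T i m) * (L l j * L m t)))]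
        simp only [← Finset.sum_add_distrib, mul_add, mul_smul_comm]
    _ = _ := by
        rw [e', e']
        rw [Finset.smul_sum, Finset.smul_sum, ← Finset.sum_add_distrib]
        refine Finset.sum_congr rfl fun l _ => ?_
        rw [Finset.smul_sum, Finset.smul_sum, ← Finset.sum_add_distrib]
        refine Finset.sum_congr rfl fun m _ => ?_
        rw [hL l m j t, mul_add, mul_smul_comm, mul_smul_comm]

/-- Adds a row on top of the product matrix. A relation between the new row and an old one uses only
the relations between `z` and `L`, because `T` commutes with both. -/
lemma IsRTT.cons {m : ℕ} {x : F} {z : Fin n → A} {T : Fin m → Fin n → A}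
    {L : Fin n → Fin n → A} (hz : IsRTT x (Fin.cons z L : Fin (n + 1) → Fin n → A))
    (hT : IsRTT x T) (hc : ∀ i j l k, L l k * T i j = T i j * L l k)
    (hcz : ∀ i j k, z k * T i j = T i j * z k) :
    IsRTT x (Fin.cons z (fun i j => ∑ l, T i l * L l j) : Fin (m + 1) → Fin n → A) := by
  have hL : IsRTT x L := by
    intro i s j t
    simpa using hz i.succ s.succ j t
  have e : ∀ (i : Fin m) (j t : Fin n), z j * (∑ l, T i l * L l t) = ∑ l, T i l * (z j * L l t) := by
    intro i j t
    rw [Finset.mul_sum]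
    exact Finset.sum_congr rfl fun l _ => by rw [← mul_assoc, hcz, mul_assoc]
  have e' : ∀ (i : Fin m) (j t : Fin n), (∑ l, T i l * L l t) * z j = ∑ l, T i l * (L l t * z j) := by
    intro i j t
    rw [Finset.sum_mul]
    exact Finset.sum_congr rfl fun l _ => by rw [mul_assoc]
  intro i s j t
  refine Fin.cases ?_ (fun i => ?_) i <;> refine Fin.cases ?_ (fun s => ?_) s
  · simpa using hz 0 0 j t
  · have h : ∀ l, _ := fun l => hz 0 (Fin.succ l) j t
    simp only [Fin.cons_zero, Fin.cons_succ, (Fin.succ_ne_zero _).symm, if_false, one_smul,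
      Fin.not_lt_zero, zero_smul, add_zero] at h ⊢
    rw [e, e', e']
    simp only [h, Finset.smul_sum, ← Finset.sum_add_distrib, mul_add, mul_smul_comm]
  · have h : ∀ l, _ := fun l => hz (Fin.succ l) 0 j t
    simp only [Fin.cons_zero, Fin.cons_succ, Fin.succ_ne_zero, if_false, one_smul,
      Fin.succ_pos, if_true] at h ⊢
    rw [e, e', e, Finset.smul_sum, Finset.smul_sum, Finset.smul_sum, ← Finset.sum_add_distrib,
      ← Finset.sum_add_distrib]
    refine Finset.sum_congr rfl fun l _ => ?_
    rw [← mul_smul_comm, ← mul_add, h l, mul_add, mul_smul_comm, mul_smul_comm]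
  · simpa using hT.mul_sum hL hc i s j t

/-- Commuting the RTT defect past the generators of a quantum affine space. -/
lemma rtt_defect_mul {x : F} (hx : x ≠ 0) {z P Q : Fin n → A} (a b : F)
    (hP : ∀ j k, P j * z k = (if j = k then x⁻¹ else 1) • (z k * P j)
      - (if k < j then x - x⁻¹ else 0) • (z j * P k))
    (hQ : ∀ j k, Q j * z k = (if j = k then x⁻¹ else 1) • (z k * Q j)
      - (if k < j then x - x⁻¹ else 0) • (z j * Q k))
    (D : Fin n → Fin n → A)
    (hD : ∀ j t, D j t = a • (P j * Q t) + b • (Q j * P t) - (if j = t then x else 1) • (Q t * P j)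
      - (if j < t then x - x⁻¹ else 0) • (Q j * P t)) (j t k : Fin n) :
    ∃ c₁ c₂ c₃ c₄ : F, D j t * z k = c₁ • (z k * D j t) + c₂ • (z j * D k t) + c₃ • (z t * D j k)
      + c₄ • (z j * D t k) := by
  have hP' : ∀ j k y, P j * (z k * y) = (if j = k then x⁻¹ else 1) • (z k * (P j * y))
      - (if k < j then x - x⁻¹ else 0) • (z j * (P k * y)) := fun j k y => by
    rw [← mul_assoc, hP, sub_mul, smul_mul_assoc, smul_mul_assoc, mul_assoc, mul_assoc]
  have hQ' : ∀ j k y, Q j * (z k * y) = (if j = k then x⁻¹ else 1) • (z k * (Q j * y))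
      - (if k < j then x - x⁻¹ else 0) • (z j * (Q k * y)) := fun j k y => by
    rw [← mul_assoc, hQ, sub_mul, smul_mul_assoc, smul_mul_assoc, mul_assoc, mul_assoc]
  refine ⟨(if t = k then x⁻¹ else 1) * (if j = k then x⁻¹ else 1),
    -(if k < j then (x - x⁻¹) * (if t = k then x⁻¹ else 1) else 0),
    -(if k < t then (x - x⁻¹) * (if j = t then x⁻¹ else 1) else 0),
    if k < t ∧ t < j then (x - x⁻¹) ^ 2 else 0, ?_⟩
  simp only [hD, add_mul, sub_mul, smul_mul_assoc, mul_assoc, hQ, hP, mul_add, mul_sub,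
    mul_smul_comm, hP', hQ']
  -- The relative order of `j, t, k` decides every conditional; each consistent order leaves an
  -- identity of rational functions of `x`.
  rcases lt_trichotomy j t with h₁ | h₁ | h₁ <;> rcases lt_trichotomy t k with h₂ | h₂ | h₂ <;>
  rcases lt_trichotomy j k with h₃ | h₃ | h₃ <;>
  first
  | (exfalso; order)
  | (try subst h₁
     try subst h₂
     try subst h₃
     simp only [if_true, if_false, lt_irrefl, *, lt_asymm, ne_of_lt, ne_of_gt, and_self, and_true,
       true_and, and_false, zero_smul, one_smul, sub_zero, add_zero]
     match_scalars <;> field_simp <;> ring)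

end RTT

end

section

/-! ### A faithful family of representations -/

section Fock

variable {F : Type} [Field F] {W : Type} [AddCommGroup W] [Module F W] {n : ℕ}

/-- The operator moving the basis element `α` to `f α` with the coefficient `g α`. -/
def shiftOp {ι : Type} (f : ι → ι) (g : ι → F) : Module.End F (ι →₀ W) :=
  Finsupp.lsum F fun α => g α • Finsupp.lsingle (f α)

lemma shiftOp_single {ι : Type} (f : ι → ι) (g : ι → F) (α : ι) (w : W) :
    shiftOp f g (Finsupp.single α w) = g α • Finsupp.single (f α) w := by
  simp [shiftOp]

/-- The sum of the entries before `t`. -/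
def pre (α : Fin n → ℕ) (t : Fin n) : ℤ := ∑ k ∈ Finset.Iio t, (α k : ℤ)

lemma pre_add_single (α : Fin n → ℕ) (k t : Fin n) :
    pre (α + Pi.single k 1) t = pre α t + if k < t then 1 else 0 := by
  simp only [pre, Pi.add_apply, Nat.cast_add, Finset.sum_add_distrib, Pi.single_apply]
  simp

/-- Multiplication by a generator of the quantum affine space. -/
def zOp (x : F) (t : Fin n) : Module.End F ((Fin n → ℕ) →₀ W) :=
  shiftOp (fun α => α + Pi.single t 1) (fun α => x ^ (-pre α t))

lemma zOp_single (x : F) (t : Fin n) (α : Fin n → ℕ) (w : W) :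
    zOp x t (Finsupp.single α w) = x ^ (-pre α t) • Finsupp.single (α + Pi.single t 1) w :=
  shiftOp_single _ _ _ _

/-- The coefficients of the upper triangular RTT matrix acting on the quantum affine space. -/
def lCoef (x : F) (l j : Fin n) (α : Fin n → ℕ) : F :=
  if l = j then x ^ (-(α j : ℤ))
  else if l < j then x * (x ^ (-(α l : ℤ)) - x ^ (α l : ℤ)) * x ^ (pre α l - pre α j) else 0

/-- The upper triangular RTT matrix acting on the quantum affine space. -/
def lOp (x : F) (l j : Fin n) : Module.End F ((Fin n → ℕ) →₀ W) :=
  shiftOp (fun α => if l = j then α else α - Pi.single l 1 + Pi.single j 1) (lCoef x l j)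

lemma lOp_self (x : F) (j : Fin n) (α : Fin n → ℕ) (w : W) :
    lOp x j j (Finsupp.single α w) = x ^ (-(α j : ℤ)) • Finsupp.single α w := by
  simp [lOp, shiftOp_single, lCoef]

lemma lOp_gt (x : F) {l j : Fin n} (h : j < l) : lOp (W := W) x l j = 0 := by
  refine Finsupp.lhom_ext fun α w => ?_
  simp [lOp, shiftOp_single, lCoef, h.ne', h.not_gt]

lemma lOp_lt_zero (x : F) {l j : Fin n} (h : l < j) (α : Fin n → ℕ) (hα : α l = 0) (w : W) :
    lOp x l j (Finsupp.single α w) = 0 := by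
  simp [lOp, shiftOp_single, lCoef, h.ne, hα]

/-- A vector with `α l ≠ 0` is written `β + Pi.single l 1`, so that the truncated subtraction in
`lOp` disappears. -/
lemma lOp_lt_add (x : F) {l j : Fin n} (h : l < j) (β : Fin n → ℕ) (w : W) :
    lOp x l j (Finsupp.single (β + Pi.single l 1) w) =
      (x * (x ^ (-(β l : ℤ) - 1) - x ^ (β l + 1 : ℤ)) * x ^ (pre β l - pre β j - 1)) •
        Finsupp.single (β + Pi.single j 1) w := by
  simp only [lOp, shiftOp_single, lCoef, h.ne, if_false, h, if_true, add_tsub_cancel_right,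
    pre_add_single, lt_irrefl, Pi.add_apply, Pi.single_eq_same]
  congr 3
  · congr 2 <;> push_cast <;> ring_nf
  · ring

lemma zOp_mul (x : F) (hx : x ≠ 0) {j k : Fin n} (h : j < k) :
    zOp (W := W) x j * zOp x k = x • (zOp x k * zOp x j) := by
  refine Finsupp.lhom_ext fun α w => ?_
  simp only [Module.End.mul_apply, LinearMap.smul_apply, zOp_single, map_smul, smul_smul,
    pre_add_single, h, if_true, h.not_gt, if_false]
  rw [add_right_comm]
  congr 1
  rw [add_zero, neg_add, zpow_add₀ hx, zpow_neg_one]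
  field_simp

lemma exists_add_single (α : Fin n → ℕ) {l : Fin n} (h : α l ≠ 0) :
    ∃ β : Fin n → ℕ, α = β + Pi.single l 1 := by
  refine ⟨α - Pi.single l 1, ?_⟩
  ext i
  by_cases hi : i = l
  · subst hi; simp; omega
  · simp [hi]

/-- Exchange relation between `lOp` and the affine generators. It is the mixed part of the RTT
relations for the row `zOp` on top of `lOp`, and it lets identities for `lOp` be checked on the
vacuum alone. -/
lemma lOp_mul_zOp (x : F) (hx : x ≠ 0) (l j k : Fin n) :
    lOp (W := W) x l j * zOp x k = (if j = k then x⁻¹ else 1) • (zOp x k * lOp x l j)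
      - (if k < j then x - x⁻¹ else 0) • (zOp x j * lOp x l k) := by
  refine Finsupp.lhom_ext fun α w => ?_
  rcases lt_trichotomy j l with hjl | rfl | hjl
  · rw [lOp_gt x hjl, zero_mul, mul_zero, smul_zero]
    by_cases hkj : k < j
    · rw [lOp_gt x (hkj.trans hjl)]; simp
    · simp [hkj]
  · have h0 : (if k < j then x - x⁻¹ else 0) • (zOp x j * lOp (W := W) x j k) = 0 := by
      by_cases hkj : k < j
      · rw [lOp_gt x hkj]; simp
      · simp [hkj]
    rw [h0, sub_zero]
    simp only [Module.End.mul_apply, LinearMap.smul_apply, zOp_single, map_smul, smul_smul,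
      lOp_self]
    by_cases hjk : j = k
    · subst hjk
      simp only [if_true, Pi.add_apply, Pi.single_eq_same]
      congr 1
      push_cast
      rw [neg_add, zpow_add₀ hx, zpow_neg_one]
      ring
    · simp only [hjk, if_false, Pi.add_apply, Pi.single_eq_of_ne hjk, add_zero]
      congr 1
      ring
  · by_cases hα : α l = 0
    · rw [LinearMap.sub_apply, LinearMap.smul_apply, LinearMap.smul_apply, Module.End.mul_apply,
        Module.End.mul_apply, Module.End.mul_apply, lOp_lt_zero x hjl α hα, map_zero, smul_zero,
        zero_sub, zOp_single, map_smul]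
      rcases lt_trichotomy k l with hkl | rfl | hkl
      · rw [lOp_gt x hkl, lOp_lt_zero x hjl _ (by simp [hα, hkl.ne'])]
        simp
      · rw [lOp_lt_add x hjl, lOp_self, map_smul, zOp_single, if_pos hjl, hα, smul_smul, smul_smul,
          smul_smul, ← neg_smul]
        congr 1
        have h2 : pre α j = pre α k + (pre α j - pre α k) := by ring
        generalize pre α j = y at *
        generalize pre α k = u at *
        simp only [Nat.cast_zero, neg_zero, zero_sub, zero_add, zpow_zero, zpow_one, zpow_neg,
          zpow_sub₀ hx]
        field_simp
        ring
      · rw [lOp_lt_zero x hkl _ hα, lOp_lt_zero x hjl _ (by simp [hα, hkl.ne])]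
        simp
    · obtain ⟨β, rfl⟩ := exists_add_single α hα
      rw [LinearMap.sub_apply, LinearMap.smul_apply, LinearMap.smul_apply, Module.End.mul_apply,
        Module.End.mul_apply, Module.End.mul_apply, zOp_single, map_smul, add_right_comm,
        lOp_lt_add x hjl, lOp_lt_add x hjl, map_smul, zOp_single]
      have hs : β + Pi.single k 1 + Pi.single j 1 = β + Pi.single j 1 + Pi.single k 1 :=
        add_right_comm _ _ _
      rcases lt_trichotomy k l with hkl | rfl | hkl
      · rw [lOp_gt x hkl, hs]
        simp only [LinearMap.zero_apply, map_zero, smul_zero, sub_zero, smul_smul]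
        congr 1
        have hkj := hkl.trans hjl
        simp only [pre_add_single, hkj.ne', hkl, hkj, hkl.not_gt, hkj.not_gt, if_true, if_false,
          Pi.add_apply, Pi.single_eq_of_ne hkl.ne', add_zero]
        rw [show pre β l + 1 - (pre β j + 1) - 1 = pre β l - pre β j - 1 by ring]
        ring
      · rw [lOp_self, map_smul, zOp_single, hs]
        simp only [smul_smul, ← sub_smul]
        congr 1
        simp only [pre_add_single, hjl.ne', hjl, hjl.not_gt, if_true, if_false, lt_irrefl,
          Pi.add_apply, Pi.single_eq_same, add_zero]
        generalize pre β j = y at *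
        generalize pre β k = u at *
        push_cast
        simp only [neg_add, zpow_neg, zpow_sub₀ hx, zpow_add₀ hx, zpow_one]
        field_simp
        ring
      · rw [lOp_lt_add x hkl, map_smul, zOp_single, hs]
        simp only [smul_smul, ← sub_smul]
        congr 1
        rcases lt_trichotomy k j with hkj | rfl | hkj
        · simp only [pre_add_single, hkj.ne', hkl, hkj, hkl.not_gt, hjl.not_gt, hjl, hkj.not_gt,
            if_true, if_false, lt_irrefl, Pi.add_apply, Pi.single_eq_of_ne hkl.ne, add_zero]
          generalize pre β j = y at *
          generalize pre β l = u at *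
          generalize pre β k = u' at *
          simp only [neg_add, zpow_neg, zpow_sub₀ hx, zpow_add₀ hx, zpow_one]
          field_simp
          ring
        · simp only [pre_add_single, hkl, hkl.not_gt, if_true, if_false, lt_irrefl, Pi.add_apply,
            Pi.single_eq_of_ne hkl.ne, add_zero, zero_mul, sub_zero]
          simp only [neg_add, zpow_neg, zpow_add₀ hx, zpow_one]
          field_simp
        · simp only [pre_add_single, hkj.ne, hkl, hkj, hkl.not_gt, hjl.not_gt, hjl, hkj.not_gt,
            if_true, if_false, lt_irrefl, Pi.add_apply, Pi.single_eq_of_ne hkl.ne, add_zero,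
            zero_mul, sub_zero]
          ring

end Fock

end

/-! ### The RTT matrix on the quantum affine space and independence of ordered monomials -/

section

section Fock

variable {F : Type} [Field F] {W : Type} [AddCommGroup W] [Module F W] {n : ℕ}

lemma lOp_vac (x : F) (l j : Fin n) (w : W) :
    lOp x l j (Finsupp.single 0 w) = if l = j then Finsupp.single 0 w else 0 := by
  rcases lt_trichotomy j l with h | rfl | h
  · simp [lOp_gt x h, h.ne']
  · simp [lOp_self]
  · simp [lOp_lt_zero x h, h.ne]

/-- The defect `D` of the relation kills the vacuum, where `lOp` is the identity matrix. By
`rtt_defect_mul` it passes each `zOp` at the price of other defects, and the `zOp` generate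
everything from the vacuum; so `D` vanishes by induction on the degree. -/
lemma isRTT_lOp (x : F) (hx : x ≠ 0) : IsRTT x (lOp (n := n) (W := W) x) := by
  intro i s
  set D : Fin n → Fin n → Module.End F ((Fin n → ℕ) →₀ W) := fun j t =>
    (if i = s then x else 1) • (lOp x i j * lOp x s t)
    + (if s < i then x - x⁻¹ else 0) • (lOp x s j * lOp x i t)
    - (if j = t then x else 1) • (lOp x s t * lOp x i j)
    - (if j < t then x - x⁻¹ else 0) • (lOp x s j * lOp x i t) with hD
  have hmul := rtt_defect_mul hx (z := zOp (W := W) x) (P := lOp x i) (Q := lOp x s) _ _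
    (fun j k => lOp_mul_zOp x hx i j k) (fun j k => lOp_mul_zOp x hx s j k) D
    (fun j t => rfl)
  have hvac : ∀ j t w, D j t (Finsupp.single 0 w) = 0 := by
    intro j t w
    simp only [hD, LinearMap.sub_apply, LinearMap.add_apply, LinearMap.smul_apply,
      Module.End.mul_apply, lOp_vac, apply_ite (lOp x _ _), map_zero]
    generalize (Finsupp.single 0 w : (Fin n → ℕ) →₀ W) = e
    clear hmul hD D
    split_ifs <;> first | (exfalso; omega) | simp
  have hall : ∀ (N : ℕ) (α : Fin n → ℕ), ∑ k, α k = N → ∀ j t w,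
      D j t (Finsupp.single α w) = 0 := by
    intro N
    induction N with
    | zero =>
      intro α hα
      have : α = 0 := by
        ext k
        simpa using (Finset.sum_eq_zero_iff.1 hα) k (Finset.mem_univ k)
      rw [this]; exact hvac
    | succ N ih =>
      intro α hα j t w
      have : ∃ k, α k ≠ 0 := by
        by_contra! h
        simp [h] at hα
      obtain ⟨k, hk⟩ := this
      obtain ⟨β, rfl⟩ := exists_add_single α hk
      have hβ : ∑ k, β k = N := by
        simp only [Pi.add_apply, Finset.sum_add_distrib, Finset.sum_pi_single'] at hα
        simpa using hα
      have e : Finsupp.single (β + Pi.single k 1) w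
          = x ^ (pre β k) • zOp x k (Finsupp.single β w) := by
        rw [zOp_single, smul_smul, ← zpow_add₀ hx]; simp
      obtain ⟨c₁, c₂, c₃, c₄, h⟩ := hmul j t k
      rw [e, map_smul, ← Module.End.mul_apply, h]
      simp [ih β hβ]
  intro j t
  have h0 : D j t = 0 := Finsupp.lhom_ext fun α w => by
    rw [hall _ α rfl, LinearMap.zero_apply]
  simp only [hD] at h0
  rwa [sub_sub, sub_eq_zero] at h0

lemma isRTT_cons_zOp (x : F) (hx : x ≠ 0) :
    IsRTT x (Fin.cons (zOp x) (lOp x) : Fin (n + 1) → Fin n → Module.End F ((Fin n → ℕ) →₀ W)) := by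
  intro i s j t
  have hz := fun j k => zOp_mul (W := W) (n := n) x hx (j := j) (k := k)
  have hL := fun l j k => lOp_mul_zOp (W := W) (n := n) x hx l j k
  refine Fin.cases ?_ (fun i => ?_) i <;> refine Fin.cases ?_ (fun s => ?_) s
  · simp only [Fin.cons_zero, if_true, lt_irrefl, if_false, zero_smul, add_zero]
    rcases lt_trichotomy j t with h | rfl | h
    · rw [hz _ _ h]
      simp only [h, h.ne, if_true, if_false]
      match_scalars; field_simp; ring
    · simp
    · rw [hz _ _ h]
      simp [h.ne', h.not_gt]
  · simp only [Fin.cons_zero, Fin.cons_succ, (Fin.succ_ne_zero _).symm, if_false, one_smul,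
      Fin.not_lt_zero, zero_smul, add_zero, hL]
    rcases lt_trichotomy j t with h | rfl | h
    · simp only [h, h.ne, h.ne', h.not_gt, if_true, if_false]
      match_scalars <;> field_simp <;> ring
    · simp [hx]
    · simp [h, h.ne, h.ne', h.not_gt]
  · simp only [Fin.cons_zero, Fin.cons_succ, Fin.succ_ne_zero, if_false, one_smul,
      Fin.succ_pos, if_true, hL]
    rcases lt_trichotomy j t with h | rfl | h
    · simp [h, h.ne, h.ne', h.not_gt]
    · simp only [if_true, lt_irrefl, if_false]
      match_scalars <;> field_simp <;> ring
    · simp [h, h.ne, h.ne', h.not_gt]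
  · simpa using isRTT_lOp (W := W) x hx i s j t

/-- A linear endomorphism of the coefficients acts on finitely supported functions. -/
def liftEnd (ι : Type) (Y : Module.End F W) : Module.End F (ι →₀ W) := Finsupp.mapRange.linearMap Y

lemma liftEnd_single {ι : Type} (Y : Module.End F W) (α : ι) (w : W) :
    liftEnd ι Y (Finsupp.single α w) = Finsupp.single α (Y w) := by
  simp [liftEnd]

lemma liftEnd_comm {ι : Type} (Y : Module.End F W) (f : ι → ι) (g : ι → F) :
    shiftOp f g * liftEnd ι Y = liftEnd ι Y * shiftOp f g := by
  refine Finsupp.lhom_ext fun α w => ?_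
  simp [Module.End.mul_apply, shiftOp_single, liftEnd_single]

lemma IsRTT.liftEnd {ι κ : Type} [LinearOrder κ] {x : F} {T : κ → Fin n → Module.End F W}
    (hT : IsRTT x T) : IsRTT x (fun i j => liftEnd ι (T i j)) := by
  intro i s j t
  have h := hT i s j t
  refine Finsupp.lhom_ext fun α w => ?_
  have h' := congrArg (fun Y : Module.End F W => Finsupp.single α (Y w)) h
  simpa only [LinearMap.add_apply, LinearMap.smul_apply, Module.End.mul_apply, liftEnd_single,
    Finsupp.smul_single, ← Finsupp.single_add] using h'

/-- The ordered monomial with exponents `A` in a matrix `T`. -/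
def monT {R : Type*} [Monoid R] {m : ℕ} (T : Fin m → Fin n → R) (A : Fin m → Fin n → ℕ) : R :=
  (List.ofFn fun i : Fin m => (List.ofFn fun j : Fin n => T i j ^ A i j).prod).prod

lemma monT_cons {R : Type*} [Monoid R] {m : ℕ} (z : Fin n → R) (T : Fin m → Fin n → R)
    (A : Fin (m + 1) → Fin n → ℕ) :
    monT (Fin.cons z T : Fin (m + 1) → Fin n → R) A
      = (List.ofFn fun j : Fin n => z j ^ A 0 j).prod * monT T (Fin.tail A) := by
  simp [monT, List.ofFn_succ, Fin.tail]

lemma zOp_pow_single (x : F) (hx : x ≠ 0) (t : Fin n) (a : ℕ) (α : Fin n → ℕ) :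
    ∃ c : Fˣ, ∀ w : W, (zOp x t ^ a) (Finsupp.single α w)
      = c • Finsupp.single (α + Pi.single t a) w := by
  induction a with
  | zero => exact ⟨1, by simp⟩
  | succ a ih =>
    obtain ⟨c, hc⟩ := ih
    refine ⟨c * Units.mk0 (x ^ (-pre (α + Pi.single t a) t)) (zpow_ne_zero _ hx), fun w => ?_⟩
    rw [pow_succ', Module.End.mul_apply, hc, Units.smul_def, map_smul, zOp_single, mul_smul,
      Units.smul_def, Units.smul_def, Units.val_mk0, add_assoc, ← Pi.single_add]

lemma zOp_list_single (x : F) (hx : x ≠ 0) (a : Fin n → ℕ) (l : List (Fin n)) (α : Fin n → ℕ) :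
    ∃ c : Fˣ, ∀ w : W, (l.map fun j => zOp x j ^ a j).prod (Finsupp.single α w)
      = c • Finsupp.single (α + (l.map fun j => Pi.single j (a j)).sum) w := by
  induction l with
  | nil => exact ⟨1, by simp⟩
  | cons j l ih =>
    obtain ⟨c, hc⟩ := ih
    obtain ⟨d, hd⟩ := zOp_pow_single (W := W) x hx j (a j)
      (α + (l.map fun j => Pi.single j (a j)).sum)
    refine ⟨c * d, fun w => ?_⟩
    rw [List.map_cons, List.prod_cons, Module.End.mul_apply, hc, Units.smul_def, map_smul, hd,
      mul_smul, List.map_cons, List.sum_cons, Units.smul_def, add_assoc,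
      add_comm ((l.map fun j => Pi.single j (a j)).sum)]
    rfl

/-- Used for the embedding `e` of `W` as the vacuum component, on which the enlarged matrix acts
like the old one. -/
lemma monT_vac {m : ℕ} {V : Type} [AddCommGroup V] [Module F V]
    (T : Fin m → Fin n → Module.End F W) (T' : Fin m → Fin n → Module.End F V) (e : W →ₗ[F] V)
    (h : ∀ i j w, T' i j (e w) = e (T i j w)) (A : Fin m → Fin n → ℕ) (w : W) :
    monT T' A (e w) = e (monT T A w) := by
  have hp : ∀ (i j) (a : ℕ) (w : W), (T' i j ^ a) (e w) = e ((T i j ^ a) w) := by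
    intro i j a
    induction a with
    | zero => simp
    | succ a ih => intro w; rw [pow_succ, pow_succ, Module.End.mul_apply, Module.End.mul_apply, h, ih]
  have hl : ∀ (l : List (Module.End F W × Module.End F V)),
      (∀ P ∈ l, ∀ w, P.2 (e w) = e (P.1 w)) → ∀ w,
      (l.map Prod.snd).prod (e w) = e ((l.map Prod.fst).prod w) := by
    intro l
    induction l with
    | nil => simp
    | cons P l ih =>
      intro hl w
      simp only [List.map_cons, List.prod_cons, Module.End.mul_apply]
      rw [ih (fun P hP => hl P (List.mem_cons_of_mem _ hP)), hl P List.mem_cons_self]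
  have hr : ∀ i w, (List.ofFn fun j : Fin n => T' i j ^ A i j).prod (e w)
      = e ((List.ofFn fun j : Fin n => T i j ^ A i j).prod w) := by
    intro i w
    have := hl (List.ofFn fun j => (T i j ^ A i j, T' i j ^ A i j)) (by
      intro P hP
      rw [List.mem_ofFn] at hP
      obtain ⟨j, rfl⟩ := hP
      exact hp i j _) w
    simpa [List.map_ofFn, Function.comp_def] using this
  have := hl (List.ofFn fun i => ((List.ofFn fun j : Fin n => T i j ^ A i j).prod,
      (List.ofFn fun j : Fin n => T' i j ^ A i j).prod)) (by
      intro P hP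
      rw [List.mem_ofFn] at hP
      obtain ⟨j, rfl⟩ := hP
      exact hr j) w
  simpa [monT, List.map_ofFn, Function.comp_def] using this

/-- RTT matrices all of whose ordered monomials are independent. -/
theorem exists_isRTT_linearIndependent (x : F) (hx : x ≠ 0) (n m : ℕ) :
    ∃ (W : Type) (_ : AddCommGroup W) (_ : Module F W) (T : Fin m → Fin n → Module.End F W) (w : W),
      IsRTT x T ∧ LinearIndependent F fun A : Fin m → Fin n → ℕ => monT T A w := by
  induction m with
  | zero =>
    refine ⟨F, inferInstance, inferInstance, fun i => i.elim0, 1, fun i => i.elim0, ?_⟩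
    rw [linearIndependent_unique_iff]
    simp [monT]
  | succ m ih =>
    obtain ⟨W, _, _, T, w, hT, hi⟩ := ih
    set T' : Fin m → Fin n → Module.End F ((Fin n → ℕ) →₀ W) :=
      fun i j => ∑ l, liftEnd _ (T i l) * lOp x l j with hT'
    refine ⟨(Fin n → ℕ) →₀ W, Finsupp.instAddCommGroup, Finsupp.module _ _, Fin.cons (zOp x) T',
      Finsupp.single 0 w, ?_, ?_⟩
    · exact (isRTT_cons_zOp x hx).cons hT.liftEnd (fun i j l k => liftEnd_comm _ _ _)
        (fun i j k => liftEnd_comm _ _ _)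
    · have hv : ∀ i j (w : W), T' i j (Finsupp.lsingle (R := F) 0 w)
          = Finsupp.lsingle (R := F) 0 (T i j w) := by
        intro i j w
        simp only [hT', LinearMap.sum_apply, Module.End.mul_apply, Finsupp.lsingle_apply, lOp_vac]
        rw [Finset.sum_eq_single j]
        · simp [liftEnd_single]
        · intro l _ hl; simp [hl]
        · simp
      -- The lower rows act inside the vacuum component and the first row then moves it to the
      -- component `A 0`, up to a unit. Independence therefore splits into distinct components and
      -- the induction hypothesis in each.
      have hz : ∀ A : Fin (m + 1) → Fin n → ℕ, ∃ c : Fˣ,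
          monT (Fin.cons (zOp x) T' : Fin (m + 1) → Fin n → _) A (Finsupp.single 0 w)
            = c • Finsupp.single (A 0) (monT T (Fin.tail A) w) := by
        intro A
        obtain ⟨c, hc⟩ := zOp_list_single (W := W) x hx (A 0) (List.finRange n) 0
        refine ⟨c, ?_⟩
        have := monT_vac T T' (Finsupp.lsingle 0) hv (Fin.tail A) w
        rw [monT_cons, Module.End.mul_apply]
        simp only [Finsupp.lsingle_apply] at this
        rw [this, List.ofFn_eq_map, hc]
        congr 2
        rw [zero_add, ← List.ofFn_eq_map, List.sum_ofFn, Finset.univ_sum_single]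
      choose c hc using hz
      have h1 := Finsupp.linearIndependent_single (R := F)
        (φ := fun _ : Fin n → ℕ => Fin m → Fin n → ℕ) (f := fun _ A => monT T A w) (fun _ => hi)
      have h2 := (h1.comp (fun A : Fin (m + 1) → Fin n → ℕ => ⟨A 0, Fin.tail A⟩) (by
        intro A B hAB
        simp only [Sigma.mk.injEq, heq_eq_eq] at hAB
        rw [← Fin.cons_self_tail A, ← Fin.cons_self_tail B, hAB.1, hAB.2])).units_smul c
      have e : (fun A : Fin (m + 1) → Fin n → ℕ => monT (Fin.cons (zOp x) T' :
          Fin (m + 1) → Fin n → _) A (Finsupp.single 0 w)) = c • ((fun ix : Σ _ : Fin n → ℕ,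
          Fin m → Fin n → ℕ => Finsupp.single ix.1 (monT T ix.2 w)) ∘
          fun A => ⟨A 0, Fin.tail A⟩) := funext hc
      rw [e]
      exact h2

end Fock

end

section

variable {n : ℕ}

/-! ### The normalized monomials form a basis -/

/-- An RTT matrix with parameter `v` gives a representation of `O_q(M(n))`. -/
lemma exists_hom_of_isRTT {B : Type*} [Ring B] [Algebra K B] {T : Fin n → Fin n → B}
    (hT : IsRTT v T) : ∃ Φ : OqM n →ₐ[K] B, ∀ i j, Φ (Z i j) = T i j := by
  let Φ₀ : FreeAlgebra K (Fin n × Fin n) →ₐ[K] B := FreeAlgebra.lift K fun p => T p.1 p.2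
  have hg : ∀ i j, Φ₀ (gen i j) = T i j := fun i j => by simp [Φ₀, gen]
  have hv := v_ne_zero
  have hanti : ∀ i s j t, s < i → j < t → T i j * T s t = T s t * T i j := by
    intro i s j t h₁ h₂
    have := hT i s j t
    simpa [h₁, h₂, h₁.ne', h₂.ne] using this
  have hrel : ∀ ⦃a b⦄, MRel n a b → Φ₀ a = Φ₀ b := by
    intro a b h
    cases h with
    | row i j k h =>
      simp only [map_mul, map_smul, hg]
      have := hT i i j k
      simp only [if_true, lt_irrefl, if_false, zero_smul, add_zero, h.ne, h, one_smul] at this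
      rw [← sub_eq_iff_eq_add, ← sub_smul, sub_sub_cancel] at this
      rw [← this, smul_smul]
      change _ = (v * v⁻¹) • _
      rw [mul_inv_cancel₀ hv, one_smul]
    | col i k j h =>
      simp only [map_mul, map_smul, hg]
      have := hT i k j j
      simp only [if_true, lt_irrefl, if_false, zero_smul, add_zero, h.ne, h.not_gt, one_smul]
        at this
      exact this
    | anti i j s t h₁ h₂ =>
      simp only [map_mul, hg]
      exact hanti i s j t h₁ h₂
    | diag i j s t h₁ h₂ =>
      simp only [map_mul, map_add, map_smul, hg]
      rw [← hanti s i j t h₁ h₂]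
      have := hT i s j t
      simp only [if_true, if_false, zero_smul, add_zero, h₁.ne, h₁.not_gt, h₂.ne, h₂, one_smul]
        at this
      exact this
  refine ⟨RingQuot.liftAlgHom K ⟨Φ₀, hrel⟩, fun i j => ?_⟩
  rw [Z, RingQuot.liftAlgHom_mkAlgHom_apply, hg]

/-- Evaluating the representation at `w` sends the `ZN A` to unit multiples of independent vectors.
-/
theorem linearIndependent_ZN (n : ℕ) : LinearIndependent K (ZN : Mat n → OqM n) := by
  obtain ⟨W, _, _, T, w, hT, hi⟩ := exists_isRTT_linearIndependent v v_ne_zero n n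
  obtain ⟨Φ, hΦ⟩ := exists_hom_of_isRTT hT
  let Ψ : OqM n →ₗ[K] W := (LinearMap.applyₗ w).comp Φ.toLinearMap
  have hmon : ∀ A : Mat n, Ψ (mon A) = monT T A w := by
    intro A
    simp only [Ψ, LinearMap.comp_apply, AlgHom.toLinearMap_apply, LinearMap.applyₗ_apply_apply, mon,
      monT]
    congr 1
    simp only [map_list_prod, List.map_ofFn, Function.comp_def, map_pow, hΦ]
  have h := (hi.units_smul fun A : Mat n => Units.mk0 (q⁻¹ ^ dexp A)
    (pow_ne_zero _ (inv_ne_zero q_ne_zero)))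
  refine LinearIndependent.of_comp Ψ ?_
  have e : Ψ ∘ (ZN : Mat n → OqM n) = (fun A : Mat n => Units.mk0 (q⁻¹ ^ dexp A)
      (pow_ne_zero _ (inv_ne_zero q_ne_zero))) • fun A : Mat n => monT T A w := by
    funext A
    simp only [Function.comp_apply, ZN, map_smul, hmon]
    rfl
  rw [e]
  exact h

lemma wprod_mem_span (w : List (Fin n × Fin n)) :
    wprod w ∈ Submodule.span K (Set.range (ZN : Mat n → OqM n)) := by
  have h : ∀ A : Mat n, ZN A ∈ Submodule.span K (Set.range (ZN : Mat n → OqM n)) :=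
    fun A => Submodule.subset_span ⟨A, rfl⟩
  have hl : ∀ y ∈ lower (content w), y ∈ Submodule.span K (Set.range (ZN : Mat n → OqM n)) := by
    intro y hy
    induction hy using Submodule.span_induction with
    | mem y hy => obtain ⟨B, _, rfl⟩ := hy; exact h B
    | zero => exact zero_mem _
    | add y z _ _ hy hz => exact add_mem hy hz
    | smul c y _ hy => exact Submodule.smul_mem _ (c : K) hy
  have h1 := add_mem (hl _ (straighten w)) (h (content w))
  rw [sub_add_cancel] at h1
  have h2 := Submodule.smul_mem _ (q ^ wexp w) h1
  rwa [smul_smul, ← zpow_add₀ q_ne_zero, add_neg_cancel, zpow_zero, one_smul] at h2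

lemma span_wprod (n : ℕ) :
    Submodule.span K (Set.range (wprod : List (Fin n × Fin n) → OqM n)) = ⊤ := by
  rw [eq_top_iff]
  rintro y -
  obtain ⟨f, rfl⟩ := RingQuot.mkAlgHom_surjective K (MRel n) y
  set S := Submodule.span K (Set.range (wprod : List (Fin n × Fin n) → OqM n))
  have hone : (1 : OqM n) ∈ S := Submodule.subset_span ⟨[], rfl⟩
  induction f using FreeAlgebra.induction with
  | grade0 r =>
    rw [AlgHom.commutes, Algebra.algebraMap_eq_smul_one]
    exact Submodule.smul_mem _ _ hone
  | grade1 p => exact Submodule.subset_span ⟨[p], by simp [Zp, Z, gen]⟩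
  | mul a b ha hb =>
    rw [map_mul]
    have : S * S ≤ S := by
      rw [Submodule.span_mul_span, Submodule.span_le]
      rintro _ ⟨_, ⟨w, rfl⟩, _, ⟨w', rfl⟩, rfl⟩
      exact Submodule.subset_span ⟨w ++ w', by simp⟩
    exact this (Submodule.mul_mem_mul ha hb)
  | add a b ha hb => rw [map_add]; exact add_mem ha hb

theorem span_ZN (n : ℕ) : Submodule.span K (Set.range (ZN : Mat n → OqM n)) = ⊤ := by
  rw [eq_top_iff, ← span_wprod, Submodule.span_le]
  rintro _ ⟨w, rfl⟩
  exact wprod_mem_span w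

end

section

variable {n : ℕ}

/-! ### Anti-automorphisms -/

/-- The target is only a semiring, so that opposite algebras, including the twisted one `OpBar n`,
are allowed. -/
lemma exists_hom_of_rel {B : Type*} [Semiring B] [Algebra K B] (T : Fin n → Fin n → B)
    (hrow : ∀ i j k, j < k → T i j * T i k = v • (T i k * T i j))
    (hcol : ∀ i k j, i < k → T i j * T k j = v • (T k j * T i j))
    (hanti : ∀ i j s t, s < i → j < t → T i j * T s t = T s t * T i j)
    (hdiag : ∀ i j s t, i < s → j < t → T i j * T s t = T s t * T i j + lam • (T i t * T s j)) :
    ∃ Φ : OqM n →ₐ[K] B, ∀ i j, Φ (Z i j) = T i j := by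
  let Φ₀ : FreeAlgebra K (Fin n × Fin n) →ₐ[K] B := FreeAlgebra.lift K fun p => T p.1 p.2
  have hg : ∀ i j, Φ₀ (gen i j) = T i j := fun i j => by simp [Φ₀, gen]
  have hrel : ∀ ⦃a b⦄, MRel n a b → Φ₀ a = Φ₀ b := by
    intro a b h
    cases h with
    | row i j k h => simp only [map_mul, map_smul, hg]; exact hrow i j k h
    | col i k j h => simp only [map_mul, map_smul, hg]; exact hcol i k j h
    | anti i j s t h₁ h₂ => simp only [map_mul, hg]; exact hanti i j s t h₁ h₂
    | diag i j s t h₁ h₂ =>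
      simp only [map_mul, map_add, map_smul, hg]; exact hdiag i j s t h₁ h₂
  refine ⟨RingQuot.liftAlgHom K ⟨Φ₀, hrel⟩, fun i j => ?_⟩
  rw [Z, RingQuot.liftAlgHom_mkAlgHom_apply, hg]

/-- The opposite algebra of `O_q(M(n))`, with scalars twisted by `q ↦ q⁻¹`. -/
def OpBar (n : ℕ) : Type := (OqM n)ᵐᵒᵖ

instance (n : ℕ) : Semiring (OpBar n) := inferInstanceAs (Semiring (OqM n)ᵐᵒᵖ)

instance (n : ℕ) : Algebra K (OpBar n) :=
  RingHom.toAlgebra' ((algebraMap K (OqM n)ᵐᵒᵖ).comp bar)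
    (fun c x => Algebra.commutes (A := (OqM n)ᵐᵒᵖ) (bar c) x)

/-- The identity map to the twisted opposite algebra. -/
def toOpBar (x : OqM n) : OpBar n := MulOpposite.op x

lemma toOpBar_smul (c : K) (x : OqM n) : c • toOpBar x = toOpBar (bar c • x) := by
  rw [Algebra.smul_def]
  change (algebraMap K (OqM n)ᵐᵒᵖ (bar c)) * MulOpposite.op x = MulOpposite.op (bar c • x)
  rw [← Algebra.smul_def, MulOpposite.op_smul]

lemma toOpBar_mul (x y : OqM n) : toOpBar x * toOpBar y = toOpBar (y * x) := rfl

lemma toOpBar_add (x y : OqM n) : toOpBar x + toOpBar y = toOpBar (x + y) := rfl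

lemma exists_phiM (n : ℕ) : ∃ f : OqM n →+* (OqM n)ᵐᵒᵖ,
    (∀ c : K, f (algebraMap K _ c) = MulOpposite.op (algebraMap K _ (bar c))) ∧
      ∀ i j, f (Z i j) = MulOpposite.op (Z i j) := by
  have hv := v_ne_zero
  -- With scalars twisted by `bar`, the semilinear anti-automorphism is an ordinary `K`-algebra map,
  -- so the presentation applies.
  obtain ⟨Φ, hΦ⟩ := exists_hom_of_rel (B := OpBar n) (fun i j => toOpBar (Z i j))
    (fun i j k h => by
      simp only [toOpBar_mul, toOpBar_smul, bar_v]
      rw [Z_row i h, smul_smul, inv_mul_cancel₀ hv, one_smul])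
    (fun i k j h => by
      simp only [toOpBar_mul, toOpBar_smul, bar_v]
      rw [Z_col j h, smul_smul, inv_mul_cancel₀ hv, one_smul])
    (fun i j s t h₁ h₂ => by
      simp only [toOpBar_mul]
      rw [Z_anti h₁ h₂])
    (fun i j s t h₁ h₂ => by
      simp only [toOpBar_mul, toOpBar_smul, toOpBar_add, bar_lam]
      rw [Z_diag h₁ h₂, Z_anti h₁ h₂, add_assoc, ← add_smul, add_neg_cancel, zero_smul, add_zero])
  exact ⟨Φ.toRingHom, fun c => Φ.commutes c, hΦ⟩

/-- The anti-automorphism of `O_q(M(n))` fixing the generators and inverting `q`. -/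
def phiM (n : ℕ) : OqM n →+* (OqM n)ᵐᵒᵖ := (exists_phiM n).choose

/-- `phiM` as a self-map. -/
def ph (y : OqM n) : OqM n := (phiM n y).unop

lemma ph_algebraMap (c : K) : ph (algebraMap K (OqM n) c) = algebraMap K _ (bar c) := by
  rw [ph, phiM, (exists_phiM n).choose_spec.1 c]; rfl

@[simp] lemma ph_Z (i j : Fin n) : ph (Z i j) = Z i j := by
  rw [ph, phiM, (exists_phiM n).choose_spec.2 i j]; rfl

@[simp] lemma ph_mul (x y : OqM n) : ph (x * y) = ph y * ph x := by simp [ph]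

@[simp] lemma ph_add (x y : OqM n) : ph (x + y) = ph x + ph y := by simp [ph]

@[simp] lemma ph_zero : ph (0 : OqM n) = 0 := by simp [ph]

@[simp] lemma ph_one : ph (1 : OqM n) = 1 := by simp [ph]

@[simp] lemma ph_smul (c : K) (x : OqM n) : ph (c • x) = bar c • ph x := by
  rw [Algebra.smul_def, ph_mul, ph_algebraMap, ← Algebra.commutes, ← Algebra.smul_def]

lemma ph_sub (x y : OqM n) : ph (x - y) = ph x - ph y := by
  rw [eq_sub_iff_add_eq, ← ph_add, sub_add_cancel]

lemma ph_wprod (w : List (Fin n × Fin n)) : ph (wprod w) = wprod w.reverse := by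
  induction w with
  | nil => simp
  | cons p w ih => simp [ih, Zp]

lemma wexp_append_singleton (w : List (Fin n × Fin n)) (p : Fin n × Fin n) :
    wexp (w ++ [p]) = wexp w - pair p (content w) := by
  induction w with
  | nil => simp [wexp, content]
  | cons r w ih =>
    simp only [List.cons_append, wexp, ih, content_append, pair_add, content, pair_E, pair_zero,
      add_zero]
    rw [qc_swap p r]
    ring

lemma content_reverse (w : List (Fin n × Fin n)) : content w.reverse = content w :=
  perm_iff_content.1 w.reverse_perm

/-- Reversal exchanges the order of every pair of letters, and `qc` is antisymmetric. -/
lemma wexp_reverse (w : List (Fin n × Fin n)) : wexp w.reverse = -wexp w := by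
  induction w with
  | nil => simp [wexp]
  | cons p w ih =>
    rw [List.reverse_cons, wexp_append_singleton, ih, content_reverse, wexp]
    ring

/-- `ph` reverses the sorted word and inverts its power of `q`. By `wexp_reverse` the result is the
correctly normalized reversed word, which straightens to the same leading term. -/
lemma ph_ZN_sub_mem (A : Mat n) : ph (ZN A) - ZN A ∈ lower A := by
  obtain ⟨w, rfl, hw⟩ := exists_word A
  have h := straighten w.reverse
  rw [content_reverse, wexp_reverse, neg_neg] at h
  nth_rewrite 1 [← hw]
  rwa [ph_smul, bar_zpow, neg_neg, ph_wprod]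

lemma ph_ph (y : OqM n) : ph (ph y) = y := by
  have hy : y ∈ Submodule.span K (Set.range (wprod : List (Fin n × Fin n) → OqM n)) := by
    rw [span_wprod]; trivial
  induction hy using Submodule.span_induction with
  | mem y hy => obtain ⟨w, rfl⟩ := hy; rw [ph_wprod, ph_wprod, List.reverse_reverse]
  | zero => simp
  | add y z _ _ hy hz => rw [ph_add, ph_add, hy, hz]
  | smul c y _ hy => rw [ph_smul, ph_smul, hy, bar_bar]

/-! ### Rotation -/

/-- The half turn reverses the orders of rows and of columns, and passing to the opposite reverses
the products; together they preserve each relation. The map later turns left multiplication by `detq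
n` into right multiplication. -/
lemma exists_rotM (n : ℕ) : ∃ f : OqM n →ₐ[K] (OqM n)ᵐᵒᵖ,
      ∀ i j, f (Z i j) = MulOpposite.op (Z i.rev j.rev) := by
  refine exists_hom_of_rel _ (fun i j k h => ?_) (fun i k j h => ?_) (fun i j s t h₁ h₂ => ?_)
    (fun i j s t h₁ h₂ => ?_)
  · rw [← MulOpposite.op_mul, ← MulOpposite.op_mul, Z_row _ (Fin.rev_lt_rev.2 h),
      MulOpposite.op_smul]
  · rw [← MulOpposite.op_mul, ← MulOpposite.op_mul, Z_col _ (Fin.rev_lt_rev.2 h),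
      MulOpposite.op_smul]
  · rw [← MulOpposite.op_mul, ← MulOpposite.op_mul,
      Z_anti (Fin.rev_lt_rev.2 h₁) (Fin.rev_lt_rev.2 h₂)]
  · rw [← MulOpposite.op_mul, ← MulOpposite.op_mul, ← MulOpposite.op_mul,
      Z_diag (Fin.rev_lt_rev.2 h₁) (Fin.rev_lt_rev.2 h₂), MulOpposite.op_add, MulOpposite.op_smul]

/-- The anti-automorphism of `O_q(M(n))` rotating the matrix of generators by a half turn. -/
def rotM (n : ℕ) : OqM n →ₐ[K] (OqM n)ᵐᵒᵖ := (exists_rotM n).choose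

/-- `rotM` as a linear self-map. -/
def rt : OqM n →ₗ[K] OqM n := (MulOpposite.opLinearEquiv K).symm.toLinearMap ∘ₗ (rotM n).toLinearMap

lemma rt_mul (x y : OqM n) : rt (x * y) = rt y * rt x := by simp [rt]

lemma rt_one : rt (1 : OqM n) = 1 := by simp [rt]

lemma rt_Z (i j : Fin n) : rt (Z i j) = Z i.rev j.rev := by
  have := (exists_rotM n).choose_spec i j
  simp only [rt, rotM, LinearMap.comp_apply, AlgHom.toLinearMap_apply, this]
  rfl

lemma rt_pow (x : OqM n) (a : ℕ) : rt (x ^ a) = rt x ^ a := by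
  induction a with
  | zero => simp [rt_one]
  | succ a ih => rw [pow_succ, rt_mul, ih, pow_succ']

lemma rt_list_prod (l : List (OqM n)) : rt l.prod = (l.reverse.map rt).prod := by
  induction l with
  | nil => simp [rt_one]
  | cons x l ih => simp [rt_mul, ih]

/-- The half turn of a position. -/
def rotp (p : Fin n × Fin n) : Fin n × Fin n := (p.1.rev, p.2.rev)

/-- The half turn of a matrix. -/
def rot (A : Mat n) : Mat n := fun i j => A i.rev j.rev

/-- The half turn reverses the lexicographic order, which undoes the reversal of products under
`rotM`; so ordered monomials go to ordered monomials. -/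
lemma posList_reverse_map_rotp (n : ℕ) : (posList n).reverse.map rotp = posList n := by
  have hr : ∀ p r : Fin n × Fin n, Before p r → Before (rotp r) (rotp p) := by
    rintro p r (h | ⟨h, h'⟩)
    · exact Or.inl (Fin.rev_lt_rev.2 h)
    · exact Or.inr ⟨by simp [rotp, h], Fin.rev_lt_rev.2 h'⟩
  have hp : ((posList n).reverse.map rotp).Pairwise Before := by
    rw [List.pairwise_map, List.pairwise_reverse]
    exact (pairwise_posList n).imp fun h => hr _ _ h
  have hnd : ∀ l : List (Fin n × Fin n), l.Pairwise Before → l.Nodup := fun l hl =>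
    hl.imp (S := (· ≠ ·)) fun {a b} h (e : a = b) => before_irrefl a (by rw [← e] at h; exact h)
  refine List.Perm.eq_of_pairwise (le := Before) ?_ hp (pairwise_posList n) ?_
  · rintro a b _ _ (h | ⟨h, h'⟩) (g | ⟨g, g'⟩) <;> exfalso <;> omega
  · rw [List.perm_ext_iff_of_nodup (hnd _ hp) (hnd _ (pairwise_posList n))]
    intro p
    simp only [mem_posList, iff_true, List.mem_map, List.mem_reverse, true_and]
    exact ⟨rotp p, by simp [rotp]⟩

lemma sum_rev_pairs (f : Fin n → ℕ) :
    ∑ j : Fin n, ∑ k ∈ Finset.univ.filter (fun k : Fin n => k < j), f j.rev * f k.rev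
      = ∑ j : Fin n, ∑ k ∈ Finset.univ.filter (fun k : Fin n => k < j), f j * f k := by
  simp only [Finset.sum_filter]
  rw [← Equiv.sum_comp Fin.revPerm]
  simp only [Fin.revPerm_apply, Fin.rev_rev]
  conv_lhs => enter [2, j]; rw [← Equiv.sum_comp Fin.revPerm]
  simp only [Fin.revPerm_apply, Fin.rev_rev, Fin.rev_lt_rev]
  rw [Finset.sum_comm]
  simp only [mul_comm]

lemma dexp_rot (A : Mat n) : dexp (rot A) = dexp A := by
  unfold dexp rot
  congr 1
  · refine (Finset.sum_congr rfl fun i _ => sum_rev_pairs (fun j => A i.rev j)).trans ?_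
    exact Equiv.sum_comp Fin.revPerm (fun i => ∑ j : Fin n,
      ∑ k ∈ Finset.univ.filter (fun k : Fin n => k < j), A i j * A i k)
  · refine (Finset.sum_congr rfl fun i _ => sum_rev_pairs (fun j => A j i.rev)).trans ?_
    exact Equiv.sum_comp Fin.revPerm (fun i => ∑ j : Fin n,
      ∑ k ∈ Finset.univ.filter (fun k : Fin n => k < j), A j i * A k i)

lemma rt_ZN (A : Mat n) : rt (ZN A) = ZN (rot A) := by
  rw [ZN, ZN, map_smul, dexp_rot, mon_eq_posList, mon_eq_posList, rt_list_prod]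
  nth_rewrite 2 [← posList_reverse_map_rotp]
  rw [← List.map_reverse, List.map_map, List.map_map]
  congr 3
  funext p
  simp [rt_pow, Zp, rt_Z, rotp, rot]

lemma len_conj_rev (σ : Equiv.Perm (Fin n)) : len (Fin.revPerm * σ * Fin.revPerm) = len σ := by
  unfold len
  refine Finset.card_bij (fun p _ => (p.2.rev, p.1.rev)) ?_ ?_ ?_
  · rintro ⟨i, j⟩ h
    simpa [Equiv.Perm.mul_apply, Fin.rev_lt_rev] using h
  · rintro ⟨i, j⟩ _ ⟨i', j'⟩ _ h
    simpa [and_comm] using h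
  · rintro ⟨i, j⟩ h
    refine ⟨(j.rev, i.rev), ?_, by simp⟩
    simpa [Equiv.Perm.mul_apply, Fin.rev_lt_rev] using h

lemma rt_detq (n : ℕ) : rt (detq n) = detq n := by
  unfold detq
  rw [map_sum, ← Equiv.sum_comp (MulAut.conj (Fin.revPerm (n := n))).toEquiv]
  refine Finset.sum_congr rfl fun σ _ => ?_
  have hr : (Fin.revPerm (n := n))⁻¹ = Fin.revPerm := rfl
  have hc : (MulAut.conj (Fin.revPerm (n := n))).toEquiv σ = Fin.revPerm * σ * Fin.revPerm := by
    simp [MulAut.conj_apply, hr]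
  rw [hc, len_conj_rev, map_smul, rt_list_prod]
  congr 2
  rw [List.map_reverse, List.map_ofFn]
  apply List.ext_getElem
  · simp
  · intro m h₁ h₂
    simp only [List.length_reverse, List.length_ofFn] at h₁
    simp only [List.getElem_reverse, List.getElem_ofFn, List.length_ofFn, Function.comp_apply,
      rt_Z, Equiv.Perm.mul_apply, Fin.revPerm_apply]
    have e : Fin.rev (⟨n - 1 - m, by omega⟩ : Fin n) = ⟨m, h₁⟩ := by
      ext; simp [Fin.rev]; omega
    have e' : (⟨n - 1 - m, by omega⟩ : Fin n) = Fin.rev ⟨m, h₁⟩ := by rw [← e, Fin.rev_rev]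
    rw [e', Fin.rev_rev, Fin.rev_rev]

end

section

/-! ### Quantum minors -/

section Minors

variable {F A : Type*} [Field F] [Ring A] [Algebra F A] {n : ℕ}

/-- The defining relations of quantum matrices with parameter `v`. -/
structure QRel (v : F) (z : Fin n → Fin n → A) : Prop where
  ne_zero : v ≠ 0
  row : ∀ i j k, j < k → z i j * z i k = v • (z i k * z i j)
  col : ∀ i k j, i < k → z i j * z k j = v • (z k j * z i j)
  anti : ∀ i j s t, s < i → j < t → z i j * z s t = z s t * z i j
  diag : ∀ i j s t, i < s → j < t → z i j * z s t = z s t * z i j + (v - v⁻¹) • (z i t * z s j)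

/-- The signed sum over the elements `j ≥ c` of `M` of the products `z j * f j`. -/
def Hs (u : F) (z : Fin n → A) (c : ℕ) (M : Finset (Fin n)) (f : Fin n → A) : A :=
  ∑ j ∈ M.filter (fun j : Fin n => c ≤ (j : ℕ)), u ^ (M.filter fun l : Fin n => c ≤ (l : ℕ) ∧ l < j).card • (z j * f j)

variable {u : F} {z : Fin n → A}

lemma Hs_congr {c : ℕ} {M N : Finset (Fin n)} {f g : Fin n → A}
    (h : ∀ j : Fin n, c ≤ (j : ℕ) → (j ∈ M ↔ j ∈ N))
    (hf : ∀ j ∈ N, c ≤ (j : ℕ) → f j = g j) : Hs u z c M f = Hs u z c N g := by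
  unfold Hs
  refine Finset.sum_congr ?_ fun j hj => ?_
  · ext j; simp only [Finset.mem_filter]; constructor
    · rintro ⟨a, b⟩; exact ⟨(h j b).1 a, b⟩
    · rintro ⟨a, b⟩; exact ⟨(h j b).2 a, b⟩
  · rw [Finset.mem_filter] at hj
    rw [hf j hj.1 hj.2]
    congr 3
    ext l; simp only [Finset.mem_filter]; constructor
    · rintro ⟨a, b⟩; exact ⟨(h l b.1).1 a, b⟩
    · rintro ⟨a, b⟩; exact ⟨(h l b.1).2 a, b⟩

lemma Hs_congr_right {c : ℕ} {N : Finset (Fin n)} {f g : Fin n → A}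
    (hf : ∀ j ∈ N, c ≤ (j : ℕ) → f j = g j) : Hs u z c N f = Hs u z c N g :=
  Hs_congr (fun _ _ => Iff.rfl) hf

lemma Hs_top {c : ℕ} (hc : n ≤ c) (M : Finset (Fin n)) (f : Fin n → A) : Hs u z c M f = 0 := by
  unfold Hs
  refine Finset.sum_eq_zero fun j hj => ?_
  have := (Finset.mem_filter.1 hj).2
  have := j.2
  omega

lemma Hs_mem {k : Fin n} {M : Finset (Fin n)} (hk : k ∈ M) (f : Fin n → A) :
    Hs u z k M f = z k * f k + u • Hs u z (k + 1) M f := by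
  unfold Hs
  have e : (M.filter fun j : Fin n => (k : ℕ) ≤ j)
      = insert k (M.filter fun j : Fin n => (k : ℕ) + 1 ≤ j) := by
    ext j; simp only [Finset.mem_filter, Finset.mem_insert]
    constructor
    · rintro ⟨h, h'⟩
      rcases h'.eq_or_lt with h' | h'
      · exact Or.inl (Fin.ext h'.symm)
      · exact Or.inr ⟨h, h'⟩
    · rintro (rfl | ⟨h, h'⟩)
      · exact ⟨hk, le_rfl⟩
      · exact ⟨h, by omega⟩
  rw [e, Finset.sum_insert (by simp), Finset.smul_sum]
  congr 1
  · have : (M.filter fun l : Fin n => (k : ℕ) ≤ l ∧ l < k) = ∅ := by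
      ext l; simp only [Finset.mem_filter, Finset.notMem_empty, iff_false]; rintro ⟨_, h, h'⟩; omega
    rw [this]; simp
  · refine Finset.sum_congr rfl fun j hj => ?_
    rw [Finset.mem_filter] at hj
    have : (M.filter fun l : Fin n => (k : ℕ) ≤ l ∧ l < j)
        = insert k (M.filter fun l : Fin n => (k : ℕ) + 1 ≤ l ∧ l < j) := by
      ext l; simp only [Finset.mem_filter, Finset.mem_insert]
      constructor
      · rintro ⟨h, h', h''⟩
        rcases h'.eq_or_lt with h' | h'
        · exact Or.inl (Fin.ext h'.symm)
        · exact Or.inr ⟨h, h', h''⟩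
      · rintro (rfl | ⟨h, h', h''⟩)
        · exact ⟨hk, le_rfl, by omega⟩
        · exact ⟨h, by omega, h''⟩
    rw [this, Finset.card_insert_of_notMem (by simp), pow_succ', mul_smul]

lemma Hs_notMem {k : Fin n} {M : Finset (Fin n)} (hk : k ∉ M) (f : Fin n → A) :
    Hs u z k M f = Hs u z (k + 1) M f := by
  have e : ∀ j ∈ M, (k : ℕ) ≤ j ↔ (k : ℕ) + 1 ≤ j := by
    intro j hj
    have : (k : ℕ) ≠ j := fun h => hk (by rw [Fin.ext h]; exact hj)
    omega
  unfold Hs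
  rw [Finset.filter_congr e]
  refine Finset.sum_congr rfl fun j hj => ?_
  rw [Finset.filter_congr fun l hl => and_congr_left fun _ => e l hl]

lemma Hs_add (c : ℕ) (M : Finset (Fin n)) (f g : Fin n → A) :
    Hs u z c M (fun j => f j + g j) = Hs u z c M f + Hs u z c M g := by
  simp only [Hs, mul_add, smul_add, Finset.sum_add_distrib]

lemma Hs_sub (c : ℕ) (M : Finset (Fin n)) (f g : Fin n → A) :
    Hs u z c M (fun j => f j - g j) = Hs u z c M f - Hs u z c M g := by
  simp only [Hs, mul_sub, smul_sub, Finset.sum_sub_distrib]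

lemma Hs_smul (c : ℕ) (M : Finset (Fin n)) (a : F) (f : Fin n → A) :
    Hs u z c M (fun j => a • f j) = a • Hs u z c M f := by
  simp only [Hs, mul_smul_comm, Finset.smul_sum]
  exact Finset.sum_congr rfl fun j _ => smul_comm _ _ _

lemma Hs_mul (c : ℕ) (M : Finset (Fin n)) (f : Fin n → A) (y : A) :
    Hs u z c M f * y = Hs u z c M (fun j => f j * y) := by
  simp only [Hs, Finset.sum_mul, smul_mul_assoc, mul_assoc]

lemma Hs_mul_left {c : ℕ} {y : A} {a : F} (h : ∀ j : Fin n, c ≤ (j : ℕ) → z j * y = a • (y * z j))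
    (M : Finset (Fin n)) (f : Fin n → A) :
    Hs u z c M (fun j => y * f j) = a • (y * Hs u z c M f) := by
  simp only [Hs, Finset.mul_sum, Finset.smul_sum]
  refine Finset.sum_congr rfl fun j hj => ?_
  rw [← mul_assoc, h j (Finset.mem_filter.1 hj).2, smul_mul_assoc, mul_smul_comm, mul_assoc,
    smul_comm]

lemma descending_induction {P : ℕ → Prop} (m : ℕ) (hm : P m) (h : ∀ c < m, P (c + 1) → P c) :
    ∀ c ≤ m, P c := by
  intro c hc
  exact Nat.decreasingInduction (motive := fun k _ => P k) (fun k hk hP => h k hk hP) hm hc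

section Rows

variable {v : F} {Z : Fin n → Fin n → A}

lemma QRel.Hs_mul_left_lt (hZ : QRel v Z) {i s : Fin n} (hs : s < i) {c : ℕ} {k : Fin n}
    (hkc : (k : ℕ) < c) (M : Finset (Fin n)) (f : Fin n → A) :
    Hs u (Z s) c M (fun j => Z i k * f j) = Z i k * Hs u (Z s) c M f := by
  rw [Hs_mul_left (a := 1), one_smul]
  intro j hj
  rw [one_smul, hZ.anti i _ s j hs (Fin.lt_def.2 (by omega))]

lemma QRel.Hs_mul_left_gt (hZ : QRel v Z) {i s : Fin n} (hs : s < i) {c : ℕ} {k : Fin n}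
    (hkc : (k : ℕ) < c) (M : Finset (Fin n)) (f : Fin n → A) :
    Hs u (Z i) c M (fun j => Z s k * f j) =
      Z s k * Hs u (Z i) c M f - (v - v⁻¹) • (Z i k * Hs u (Z s) c M f) := by
  simp only [Hs, Finset.mul_sum, Finset.smul_sum, ← Finset.sum_sub_distrib]
  refine Finset.sum_congr rfl fun j hj => ?_
  have hkj : k < j := Fin.lt_def.2 (by
    have := (Finset.mem_filter.1 hj).2; omega)
  rw [← mul_assoc, eq_sub_of_add_eq (hZ.diag s _ i j hs hkj).symm, sub_mul, smul_mul_assoc,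
    ← hZ.anti i _ s j hs hkj, smul_sub, mul_smul_comm, mul_smul_comm, mul_assoc, mul_assoc,
    smul_comm (u ^ _)]

lemma QRel.Hs_mul_left_eq (hZ : QRel v Z) {s : Fin n} {c : ℕ} {k : Fin n}
    (hkc : (k : ℕ) < c) (M : Finset (Fin n)) (f : Fin n → A) :
    Hs u (Z s) c M (fun j => Z s k * f j) = v⁻¹ • (Z s k * Hs u (Z s) c M f) := by
  refine Hs_mul_left (fun j hj => ?_) M f
  rw [hZ.row s _ j (Fin.lt_def.2 (by omega)), smul_smul, inv_mul_cancel₀ hZ.ne_zero, one_smul]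

/-- The quantum minor with rows `rs` and columns `M`. -/
def minor (v : F) (Z : Fin n → Fin n → A) : List (Fin n) → Finset (Fin n) → A
  | [], M => if M = ∅ then 1 else 0
  | s :: rs, M => Hs (-v) (Z s) 0 M fun j => minor v Z rs (M.erase j)

/-- The truncated expansion along the first row of a quantum minor. -/
def Hm (v : F) (Z : Fin n → Fin n → A) (s : Fin n) (rs : List (Fin n)) (c : ℕ)
    (M : Finset (Fin n)) : A :=
  Hs (-v) (Z s) c M fun j => minor v Z rs (M.erase j)

lemma minor_cons (s : Fin n) (rs : List (Fin n)) (M : Finset (Fin n)) :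
    minor v Z (s :: rs) M = Hm v Z s rs 0 M := rfl

lemma Hm_top {c : ℕ} (hc : n ≤ c) (s : Fin n) (rs : List (Fin n)) (M : Finset (Fin n)) :
    Hm v Z s rs c M = 0 := Hs_top hc _ _

lemma Hm_mem {k : Fin n} {M : Finset (Fin n)} (hk : k ∈ M) (s : Fin n) (rs : List (Fin n)) :
    Hm v Z s rs k M = Z s k * minor v Z rs (M.erase k) + (-v) • Hm v Z s rs (k + 1) M :=
  Hs_mem hk _

lemma Hm_notMem {k : Fin n} {M : Finset (Fin n)} (hk : k ∉ M) (s : Fin n) (rs : List (Fin n)) :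
    Hm v Z s rs k M = Hm v Z s rs (k + 1) M := Hs_notMem hk _

lemma Hm_mem_nat {c : ℕ} (hc : c < n) {M : Finset (Fin n)} (hk : (⟨c, hc⟩ : Fin n) ∈ M) (s : Fin n)
    (rs : List (Fin n)) : Hm v Z s rs c M
      = Z s ⟨c, hc⟩ * minor v Z rs (M.erase ⟨c, hc⟩) + (-v) • Hm v Z s rs (c + 1) M :=
  Hm_mem hk _ _

lemma Hm_notMem_nat {c : ℕ} (hc : c < n) {M : Finset (Fin n)} (hk : (⟨c, hc⟩ : Fin n) ∉ M)
    (s : Fin n) (rs : List (Fin n)) : Hm v Z s rs c M = Hm v Z s rs (c + 1) M :=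
  Hm_notMem hk _ _

lemma Hs_mem_nat {c : ℕ} (hc : c < n) {M : Finset (Fin n)} (hk : (⟨c, hc⟩ : Fin n) ∈ M)
    (f : Fin n → A) : Hs u z c M f = z ⟨c, hc⟩ * f ⟨c, hc⟩ + u • Hs u z (c + 1) M f :=
  Hs_mem hk _

lemma Hs_notMem_nat {c : ℕ} (hc : c < n) {M : Finset (Fin n)} (hk : (⟨c, hc⟩ : Fin n) ∉ M)
    (f : Fin n → A) : Hs u z c M f = Hs u z (c + 1) M f :=
  Hs_notMem hk _

lemma Hs_erase_eq_Hm {k : Fin n} {c : ℕ} (hc : (k : ℕ) < c) (N : Finset (Fin n)) (s : Fin n)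
    (rs : List (Fin n)) :
    Hs (-v) (Z s) c N (fun t => minor v Z rs ((N.erase t).erase k)) = Hm v Z s rs c (N.erase k) := by
  refine Hs_congr (fun j hj => ?_) fun j _ _ => by rw [Finset.erase_right_comm]
  have : j ≠ k := by rintro rfl; omega
  simp [this]

/-- Double expansions along two rows. -/
lemma QRel.double_Hm (hZ : QRel v Z) {i s : Fin n} (hs : s < i) (rs : List (Fin n))
    (N : Finset (Fin n)) : ∀ c ≤ n,
    Hs (-v) (Z i) c N (fun j => Hm v Z s rs c (N.erase j)) =
      (-v) • Hs (-v) (Z s) c N (fun j => Hm v Z i rs c (N.erase j)) := by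
  have hv := hZ.ne_zero
  refine descending_induction n ?_ ?_
  · rw [Hs_top le_rfl, Hs_top le_rfl, smul_zero]
  · intro c hc ih
    set k : Fin n := ⟨c, hc⟩ with hk
    have hkc : (k : ℕ) = c := rfl
    by_cases hkN : k ∈ N
    · have h1 : ∀ a : Fin n, ∀ j ∈ N, c + 1 ≤ (j : ℕ) → Hm v Z a rs c (N.erase j)
          = Z a k * minor v Z rs ((N.erase j).erase k) + (-v) • Hm v Z a rs (c + 1) (N.erase j) := by
        intro a j _ hcj
        have : k ≠ j := by rintro rfl; omega
        exact Hm_mem_nat hc (Finset.mem_erase.2 ⟨this, hkN⟩) a rs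
      have h2 : ∀ a : Fin n, Hm v Z a rs c (N.erase k) = Hm v Z a rs (c + 1) (N.erase k) :=
        fun a => Hm_notMem_nat hc (Finset.notMem_erase _ _) a rs
      -- Separates the terms in which the column `k` is used by the outer expansion, by the inner
      -- one, or by neither; the last are covered by the induction hypothesis.
      have h3 : ∀ a b : Fin n, Hs (-v) (Z a) c N (fun j => Hm v Z b rs c (N.erase j))
          = Z a k * Hm v Z b rs (c + 1) (N.erase k)
            + (-v) • (Hs (-v) (Z a) (c + 1) N (fun j => Z b k * minor v Z rs ((N.erase j).erase k))
            + (-v) • Hs (-v) (Z a) (c + 1) N (fun j => Hm v Z b rs (c + 1) (N.erase j))) := by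
        intro a b
        refine (Hs_mem_nat hc hkN _).trans ?_
        rw [h2, Hs_congr_right (h1 b), Hs_add, Hs_smul]
      rw [h3, h3, ih, hZ.Hs_mul_left_lt hs (k := k) (Nat.lt_succ_self c),
        hZ.Hs_mul_left_gt hs (k := k) (Nat.lt_succ_self c), Hs_erase_eq_Hm (Nat.lt_succ_self c),
        Hs_erase_eq_Hm (Nat.lt_succ_self c)]
      match_scalars <;> field_simp <;> ring
    · have h2 : ∀ a : Fin n, ∀ j, Hm v Z a rs c (N.erase j) = Hm v Z a rs (c + 1) (N.erase j) :=
        fun a j => Hm_notMem_nat hc (fun h => hkN (Finset.mem_of_mem_erase h)) a rs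
      have h3 : ∀ a b : Fin n, Hs (-v) (Z a) c N (fun j => Hm v Z b rs c (N.erase j))
          = Hs (-v) (Z a) (c + 1) N (fun j => Hm v Z b rs (c + 1) (N.erase j)) := by
        intro a b
        refine (Hs_notMem_nat hc hkN _).trans ?_
        exact Hs_congr_right fun j _ _ => h2 b j
      rw [h3, h3, ih]

/-- Double expansions along the same row vanish. -/
lemma QRel.double_Hm_self (hZ : QRel v Z) (s : Fin n) (rs : List (Fin n))
    (N : Finset (Fin n)) : ∀ c ≤ n,
    Hs (-v) (Z s) c N (fun j => Hm v Z s rs c (N.erase j)) = 0 := by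
  have hv := hZ.ne_zero
  refine descending_induction n (Hs_top le_rfl _ _) ?_
  intro c hc ih
  set k : Fin n := ⟨c, hc⟩ with hk
  by_cases hkN : k ∈ N
  · refine (Hs_mem_nat hc hkN _).trans ?_
    have h1 : Hs (-v) (Z s) (c + 1) N (fun j => Hm v Z s rs c (N.erase j))
        = Hs (-v) (Z s) (c + 1) N (fun j => Z s k * minor v Z rs ((N.erase j).erase k)
          + (-v) • Hm v Z s rs (c + 1) (N.erase j)) := by
      refine Hs_congr_right fun j _ hcj => ?_
      have : k ≠ j := by rintro rfl; simp [hk] at hcj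
      exact Hm_mem_nat hc (Finset.mem_erase.2 ⟨this, hkN⟩) s rs
    have h2 : Hm v Z s rs c (N.erase k) = Hm v Z s rs (c + 1) (N.erase k) :=
      Hm_notMem_nat hc (Finset.notMem_erase _ _) s rs
    change Z s k * Hm v Z s rs c (N.erase k) + (-v) • Hs (-v) (Z s) (c + 1) N _ = 0
    rw [h1, h2, Hs_add, Hs_smul, ih, hZ.Hs_mul_left_eq (k := k) (Nat.lt_succ_self c),
      Hs_erase_eq_Hm (Nat.lt_succ_self c), smul_zero, add_zero, smul_smul, neg_mul,
      mul_inv_cancel₀ hv, neg_one_smul, add_neg_cancel]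
  · refine (Hs_notMem_nat hc hkN _).trans ?_
    rw [← ih]
    exact Hs_congr_right fun j _ _ => Hm_notMem_nat hc (fun h => hkN (Finset.mem_of_mem_erase h)) s rs

/-- Commuting a quantum minor past a generator in a row above it. -/
lemma QRel.minor_mul (hZ : QRel v Z) (s : Fin n) : ∀ rs : List (Fin n), (∀ i ∈ rs, s < i) →
    (∀ (M : Finset (Fin n)) (k : Fin n), k ∈ M →
      minor v Z rs M * Z s k = v⁻¹ • (Z s k * minor v Z rs M)) ∧
    ∀ (M : Finset (Fin n)) (k : Fin n), k ∉ M →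
      minor v Z rs M * Z s k
        = Z s k * minor v Z rs M - (v - v⁻¹) • Hm v Z s rs (k + 1) (insert k M) := by
  have hv := hZ.ne_zero
  intro rs
  induction rs with
  | nil =>
    intro _
    have h0 : ∀ (M : Finset (Fin n)) (k : Fin n), k ∈ M → minor v Z [] M = 0 := by
      intro M k hk
      rw [minor, if_neg (Finset.ne_empty_of_mem hk)]
    refine ⟨fun M k hk => by simp [h0 M k hk], fun M k hk => ?_⟩
    have h1 : Hm v Z s [] (k + 1) (insert k M) = 0 := by
      unfold Hm Hs
      refine Finset.sum_eq_zero fun j hj => ?_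
      have hkj : k ≠ j := by
        rintro rfl; have := (Finset.mem_filter.1 hj).2; omega
      have e := h0 ((insert k M).erase j) k (by simp [hkj])
      simp only [e, mul_zero, smul_zero]
    rw [h1, smul_zero, sub_zero, minor]
    split_ifs <;> simp
  | cons i rs ih =>
    intro hs
    have hsi := hs i List.mem_cons_self
    obtain ⟨hmem, hnot⟩ := ih fun i hi => hs i (List.mem_cons_of_mem _ hi)
    constructor
    · intro M k hk
      have ha : Hm v Z i rs (k + 1) M * Z s k = v⁻¹ • (Z s k * Hm v Z i rs (k + 1) M
          - (v - v⁻¹) • (Z i k * Hm v Z s rs (k + 1) M)) := by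
        rw [Hm, Hs_mul, Hs_congr_right (g := fun j => v⁻¹ • (Z s k * minor v Z rs (M.erase j))),
          Hs_smul, hZ.Hs_mul_left_gt hsi (Nat.lt_succ_self _)]
        · rfl
        · intro j _ hj
          have hkj : k ≠ j := by rintro rfl; omega
          exact hmem _ _ (Finset.mem_erase.2 ⟨hkj, hk⟩)
      -- The correction made when `Z s k` passes the minor on `M.erase k` cancels the correction in
      -- `ha`, because `-v * v⁻¹ = -1`.
      have hb : Hm v Z i rs k M * Z s k = v⁻¹ • (Z s k * Hm v Z i rs k M) := by
        rw [Hm_mem hk, add_mul, smul_mul_assoc, ha, mul_assoc,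
          hnot _ _ (Finset.notMem_erase k M), Finset.insert_erase hk, mul_sub, ← mul_assoc,
          eq_inv_smul_iff₀ hv |>.2 (hZ.col s i k hsi).symm, mul_smul_comm, mul_add, mul_smul_comm,
          smul_mul_assoc, mul_assoc]
        match_scalars <;> field_simp <;> ring
      rw [minor_cons]
      refine descending_induction (P := fun c => Hm v Z i rs c M * Z s k
        = v⁻¹ • (Z s k * Hm v Z i rs c M)) k hb ?_ 0 (Nat.zero_le _)
      -- Columns to the left of `k` add no correction of their own: there `Z i c` commutes with `Z s
      -- k`.
      intro c hck ihc
      have hc : c < n := hck.trans k.2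
      by_cases hcM : (⟨c, hc⟩ : Fin n) ∈ M
      · have hck' : (⟨c, hc⟩ : Fin n) < k := hck
        rw [Hm_mem_nat hc hcM, add_mul, smul_mul_assoc, ihc, mul_assoc,
          hmem _ _ (Finset.mem_erase.2 ⟨hck'.ne', hk⟩), mul_smul_comm, ← mul_assoc,
          hZ.anti _ _ _ _ hsi hck', mul_add, mul_assoc, mul_smul_comm]
        match_scalars <;> ring
      · rw [Hm_notMem_nat hc hcM, ihc]
    · intro M k hk
      set N := insert k M with hN
      have hNM : ∀ {f : Fin n → A} {a : Fin n} {c : ℕ}, (k : ℕ) < c →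
          Hs (-v) (Z a) c M f = Hs (-v) (Z a) c N f := by
        intro f a c hc
        refine Hs_congr (fun j hj => ?_) fun _ _ _ => rfl
        have : j ≠ k := by rintro rfl; omega
        simp [hN, this]
      have hNk : N.erase k = M := Finset.erase_insert hk
      have hkj : ∀ j : Fin n, (k : ℕ) + 1 ≤ j → k ≠ j := by
        rintro j hj rfl; omega
      have hkN : k ∈ N := Finset.mem_insert_self k M
      have hMj : ∀ j : Fin n, k ≠ j → insert k (M.erase j) = N.erase j := by
        intro j hj
        rw [hN, Finset.erase_insert_of_ne hj]
      have ha : Hm v Z i rs (k + 1) M * Z s k = Z s k * Hm v Z i rs (k + 1) M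
          - (v - v⁻¹) • (Z i k * Hm v Z s rs (k + 1) M + (-v) •
            Hs (-v) (Z s) (k + 1) N (fun j => Hm v Z i rs (k + 1) (N.erase j))) := by
        rw [Hm, Hs_mul, Hs_congr_right (g := fun j => Z s k * minor v Z rs (M.erase j) -
          (v - v⁻¹) • Hm v Z s rs (k + 1) (N.erase j)), Hs_sub, Hs_smul,
          hZ.Hs_mul_left_gt hsi (Nat.lt_succ_self _),
          hNM (f := fun j => Hm v Z s rs (k + 1) (N.erase j)) (Nat.lt_succ_self _),
          hZ.double_Hm hsi rs N (k + 1) k.2, sub_sub, ← smul_add]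
        · rfl
        · intro j _ hj
          rw [hnot _ _ (fun h => hk (Finset.mem_of_mem_erase h)), hMj j (hkj j hj)]
      have hb : Hm v Z i rs k M * Z s k = Z s k * Hm v Z i rs k M
          - (v - v⁻¹) • Hs (-v) (Z s) (k + 1) N (fun j => Hm v Z i rs k (N.erase j)) := by
        have h1 : Hs (-v) (Z s) (k + 1) N (fun j => Hm v Z i rs k (N.erase j))
            = Hs (-v) (Z s) (k + 1) N (fun j => Z i k * minor v Z rs (M.erase j) +
              (-v) • Hm v Z i rs (k + 1) (N.erase j)) := by
          refine Hs_congr_right fun j _ hj => ?_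
          rw [Hm_mem (Finset.mem_erase.2 ⟨hkj j hj, hkN⟩), Finset.erase_right_comm, hNk]
        rw [Hm_notMem hk, ha, h1, Hs_add, Hs_smul, hZ.Hs_mul_left_lt hsi (Nat.lt_succ_self _),
          ← hNM (f := fun j => minor v Z rs (M.erase j)) (Nat.lt_succ_self _)]
        rfl
      rw [minor_cons]
      -- At `c = 0` the inner expansion is the full minor with rows `i :: rs`, so the correction
      -- becomes the one claimed.
      refine descending_induction (P := fun c => Hm v Z i rs c M * Z s k
        = Z s k * Hm v Z i rs c M
          - (v - v⁻¹) • Hs (-v) (Z s) (k + 1) N (fun j => Hm v Z i rs c (N.erase j)))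
        k hb ?_ 0 (Nat.zero_le _)
      intro c hck ihc
      have hc : c < n := hck.trans k.2
      have hck' : (⟨c, hc⟩ : Fin n) < k := hck
      by_cases hcM : (⟨c, hc⟩ : Fin n) ∈ M
      · have hkc : k ∉ M.erase ⟨c, hc⟩ := fun h => hk (Finset.mem_of_mem_erase h)
        have h1 : Hs (-v) (Z s) (k + 1) N (fun j => Hm v Z i rs c (N.erase j))
            = Hs (-v) (Z s) (k + 1) N (fun j => Z i ⟨c, hc⟩ *
              minor v Z rs ((N.erase j).erase ⟨c, hc⟩) +
              (-v) • Hm v Z i rs (c + 1) (N.erase j)) := by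
          refine Hs_congr_right fun j _ hj => ?_
          have : (⟨c, hc⟩ : Fin n) ≠ j := by rintro rfl; simp at hj; omega
          rw [Hm_mem_nat hc (Finset.mem_erase.2 ⟨this, Finset.mem_insert_of_mem hcM⟩)]
        rw [h1, Hs_add, Hs_smul, hZ.Hs_mul_left_lt hsi (by simp; omega),
          Hs_erase_eq_Hm (by simp; omega), Hm_mem_nat hc hcM, add_mul, smul_mul_assoc, ihc,
          mul_assoc, hnot _ _ hkc, ← Finset.erase_insert_of_ne hck'.ne', mul_sub, ← mul_assoc,
          hZ.anti _ _ _ _ hsi hck', mul_add, mul_assoc, mul_smul_comm, mul_smul_comm]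
        match_scalars <;> ring
      · have h1 : Hs (-v) (Z s) (k + 1) N (fun j => Hm v Z i rs c (N.erase j))
            = Hs (-v) (Z s) (k + 1) N (fun j => Hm v Z i rs (c + 1) (N.erase j)) :=
          Hs_congr_right fun j _ hj => Hm_notMem_nat hc (fun h => by
            rcases Finset.mem_insert.1 (Finset.mem_of_mem_erase h) with h | h
            · exact hck'.ne h
            · exact hcM h) _ _
        rw [Hm_notMem_nat hc hcM, ihc, h1]

lemma QRel.Hm_mul_of_mem (hZ : QRel v Z) {s : Fin n} {rs : List (Fin n)} (hs : ∀ i ∈ rs, s < i)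
    {M : Finset (Fin n)} {k : Fin n} (hk : k ∈ M) :
    Hm v Z s rs (k + 1) M * Z s k = (v⁻¹ * v⁻¹) • (Z s k * Hm v Z s rs (k + 1) M) := by
  rw [Hm, Hs_mul, Hs_congr_right (g := fun j => v⁻¹ • (Z s k * minor v Z rs (M.erase j))),
    Hs_smul, hZ.Hs_mul_left_eq (Nat.lt_succ_self _), smul_smul]
  intro j _ hj
  have hkj : k ≠ j := by rintro rfl; omega
  exact (hZ.minor_mul s rs hs).1 _ _ (Finset.mem_erase.2 ⟨hkj, hk⟩)

/-- The corrections from the individual minors add up to a double expansion along the same row,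
which vanishes by `double_Hm_self`. -/
lemma QRel.Hm_mul_of_notMem (hZ : QRel v Z) {s : Fin n} {rs : List (Fin n)} (hs : ∀ i ∈ rs, s < i)
    {M : Finset (Fin n)} {k : Fin n} (hk : k ∉ M) :
    Hm v Z s rs (k + 1) M * Z s k = v⁻¹ • (Z s k * Hm v Z s rs (k + 1) M) := by
  have h : Hs (-v) (Z s) (k + 1) M (fun j => Hm v Z s rs (k + 1) ((insert k M).erase j)) = 0 := by
    rw [← hZ.double_Hm_self s rs (insert k M) (k + 1) k.2]
    refine Hs_congr (fun j hj => ?_) fun _ _ _ => rfl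
    have : j ≠ k := by rintro rfl; omega
    simp [this]
  rw [Hm, Hs_mul, Hs_congr_right (g := fun j => Z s k * minor v Z rs (M.erase j) -
    (v - v⁻¹) • Hm v Z s rs (k + 1) ((insert k M).erase j)), Hs_sub, Hs_smul, h, smul_zero,
    sub_zero, hZ.Hs_mul_left_eq (Nat.lt_succ_self _)]
  intro j _ hj
  have hkj : k ≠ j := by rintro rfl; omega
  rw [(hZ.minor_mul s rs hs).2 _ _ (fun h => hk (Finset.mem_of_mem_erase h)),
    Finset.erase_insert_of_ne hkj]

end Rows

end Minors

end

/-! ### Invariance of quantum minors and their Leibniz expansion -/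

section

variable {n : ℕ}

lemma qrel_Z (n : ℕ) : QRel v (Z : Fin n → Fin n → OqM n) where
  ne_zero := v_ne_zero
  row i _ _ h := Z_row i h
  col _ _ j h := Z_col j h
  anti _ _ _ _ h₁ h₂ := Z_anti h₁ h₂
  diag _ _ _ _ h₁ h₂ := Z_diag h₁ h₂

/-- Quantum minors are fixed by the anti-automorphism `ph`. -/
lemma ph_minor : ∀ rs : List (Fin n), rs.Pairwise (· < ·) → ∀ M : Finset (Fin n),
    ph (minor v Z rs M) = minor v Z rs M := by
  intro rs
  induction rs with
  | nil => intro _ M; rw [minor]; split_ifs <;> simp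
  | cons s rs ih =>
    intro hrs M
    rw [List.pairwise_cons] at hrs
    rw [minor_cons]
    refine descending_induction (P := fun c => ph (Hm v Z s rs c M) = Hm v Z s rs c M) n
      (by rw [Hm_top le_rfl, ph_zero]) (fun c hc h => ?_) 0 (Nat.zero_le _)
    by_cases hcM : (⟨c, hc⟩ : Fin n) ∈ M
    · have h1 := ((qrel_Z n).minor_mul s rs hrs.1).2 _ _ (Finset.notMem_erase ⟨c, hc⟩ M)
      rw [Finset.insert_erase hcM] at h1
      -- Reversing the product creates `-(v - v⁻¹)` times the truncated expansion; the change of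
      -- `-v` under `bar` compensates for it exactly.
      have hb : bar (-v) = -v + (v - v⁻¹) := by rw [map_neg, bar_v]; ring
      rw [Hm_mem_nat hc hcM, ph_add, ph_mul, ph_smul, ph_Z, ih hrs.2, h, h1, hb, add_smul,
        add_comm (-v • _), ← add_assoc, sub_add_cancel]
    · rw [Hm_notMem_nat hc hcM, h]

lemma len_eq_sum {m : ℕ} (σ : Equiv.Perm (Fin m)) :
    len σ = ∑ i, ∑ j, if i < j ∧ σ j < σ i then 1 else 0 := by
  rw [len, Finset.card_filter, Fintype.sum_prod_type]

/-- Extend a permutation by sending `0` to `p`. -/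
def consPerm {m : ℕ} (p : Fin (m + 1)) (τ : Equiv.Perm (Fin m)) : Equiv.Perm (Fin (m + 1)) :=
  ((finSuccEquiv' 0).trans (Equiv.optionCongr τ)).trans (finSuccEquiv' p).symm

@[simp] lemma consPerm_zero {m : ℕ} (p : Fin (m + 1)) (τ : Equiv.Perm (Fin m)) :
    consPerm p τ 0 = p := by
  simp [consPerm]

@[simp] lemma consPerm_succ {m : ℕ} (p : Fin (m + 1)) (τ : Equiv.Perm (Fin m)) (i : Fin m) :
    consPerm p τ i.succ = p.succAbove (τ i) := by
  have : finSuccEquiv' (0 : Fin (m + 1)) i.succ = some i := by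
    rw [← Fin.succAbove_zero]; exact finSuccEquiv'_succAbove 0 i
  simp [consPerm, this]

lemma consPerm_bijective (m : ℕ) : Function.Bijective
    fun x : Fin (m + 1) × Equiv.Perm (Fin m) => consPerm x.1 x.2 := by
  rw [Fintype.bijective_iff_injective_and_card]
  constructor
  · rintro ⟨p, τ⟩ ⟨p', τ'⟩ h
    have hp : p = p' := by simpa using congrArg (fun σ : Equiv.Perm (Fin (m + 1)) => σ 0) h
    subst hp
    have : τ = τ' := by
      ext1 i
      simpa using congrArg (fun σ : Equiv.Perm (Fin (m + 1)) => σ i.succ) h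
    rw [this]
  · simp [Fintype.card_perm, Nat.factorial_succ]

lemma card_filter_lt {m : ℕ} (p : Fin m) : (Finset.univ.filter fun x : Fin m => x < p).card = p := by
  rw [← Fin.card_Iio]
  congr 1
  ext; simp

lemma card_castSucc_lt {m : ℕ} (p : Fin (m + 1)) :
    (∑ l : Fin m, if l.castSucc < p then 1 else 0) = (p : ℕ) := by
  have h : ∑ l : Fin (m + 1), (if l < p then 1 else 0) = (p : ℕ) := by
    simpa [← Finset.card_filter] using card_filter_lt p
  rw [Fin.sum_univ_castSucc] at h
  simpa [(Fin.le_last p).not_gt] using h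

lemma len_consPerm {m : ℕ} (p : Fin (m + 1)) (τ : Equiv.Perm (Fin m)) :
    len (consPerm p τ) = p + len τ := by
  rw [len_eq_sum, len_eq_sum, Fin.sum_univ_succ]
  congr 1
  · rw [Fin.sum_univ_succ]
    simp only [consPerm_zero, consPerm_succ, lt_irrefl, false_and, if_false, zero_add,
      Fin.succ_pos, true_and, Fin.succAbove_lt_iff_castSucc_lt]
    rw [Equiv.sum_comp τ (fun l => if l.castSucc < p then 1 else 0)]
    exact card_castSucc_lt p
  · refine Finset.sum_congr rfl fun i _ => ?_
    rw [Fin.sum_univ_succ]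
    simp [Fin.succAbove_lt_succAbove_iff]

section Generic

variable {F A : Type*} [Field F] [Ring A] [Algebra F A]

/-- The Leibniz expansion of a quantum minor. -/
lemma minor_eq_sum (v : F) (Z : Fin n → Fin n → A) : ∀ (m : ℕ) (r : Fin m → Fin n)
    (e : Fin m ↪o Fin n), minor v Z (List.ofFn r) (Finset.univ.map e.toEmbedding)
      = ∑ σ : Equiv.Perm (Fin m), (-v) ^ len σ •
        (List.ofFn fun i => Z (r i) (e (σ i))).prod := by
  intro m
  induction m with
  | zero =>
    intro r e
    simp [minor, len]
  | succ m ih =>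
    intro r e
    rw [List.ofFn_succ, minor, ← Fintype.sum_bijective _ (consPerm_bijective m) _ _ fun _ => rfl,
      Fintype.sum_prod_type, Hs]
    have h0 : (Finset.univ.map e.toEmbedding).filter (fun j : Fin n => 0 ≤ (j : ℕ))
        = Finset.univ.map e.toEmbedding := by simp
    rw [h0, Finset.sum_map]
    refine Finset.sum_congr rfl fun p _ => ?_
    have h1 : (Finset.univ.map e.toEmbedding).erase (e p)
        = Finset.univ.map (p.succAboveOrderEmb.trans e).toEmbedding := by
      ext j
      simp only [Finset.mem_erase, Finset.mem_map, Finset.mem_univ, true_and]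
      constructor
      · rintro ⟨h, l, rfl⟩
        obtain ⟨i, hi⟩ := Fin.exists_succAbove_eq (x := l) (y := p) (fun h' => h (by rw [h']; rfl))
        exact ⟨i, by rw [← hi]; rfl⟩
      · rintro ⟨i, rfl⟩
        refine ⟨fun h => Fin.succAbove_ne p i (e.injective h), _, rfl⟩
    have h2 : ((Finset.univ.map e.toEmbedding).filter
        fun l : Fin n => 0 ≤ (l : ℕ) ∧ l < e p).card = p := by
      rw [Finset.filter_map, Finset.card_map]
      simpa using card_filter_lt p
    change (-v) ^ ((Finset.univ.map e.toEmbedding).filter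
        fun l : Fin n => 0 ≤ (l : ℕ) ∧ l < e p).card • (Z (r 0) (e p) * minor v Z (List.ofFn fun i =>
          r i.succ) ((Finset.univ.map e.toEmbedding).erase (e p))) = _
    rw [h2, h1, ih, Finset.mul_sum, Finset.smul_sum]
    refine Finset.sum_congr rfl fun τ _ => ?_
    simp only [len_consPerm, List.ofFn_succ, List.prod_cons, consPerm_zero, consPerm_succ]
    rw [mul_smul_comm, smul_smul, ← pow_add]
    rfl

end Generic

lemma minor_eq_detq (n : ℕ) : minor v Z (List.finRange n) Finset.univ = detq n := by
  have h := minor_eq_sum v (Z : Fin n → Fin n → OqM n) n id (OrderIso.refl _).toOrderEmbedding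
  have e : List.ofFn (id : Fin n → Fin n) = List.finRange n := by simp [List.ofFn_eq_map]
  have e' : Finset.univ.map ((OrderIso.refl (Fin n)).toOrderEmbedding).toEmbedding = Finset.univ := by
    ext; simp
  rw [e, e'] at h
  exact h

lemma ph_detq (n : ℕ) : ph (detq n) = detq n := by
  rw [← minor_eq_detq, ph_minor _ (List.pairwise_lt_finRange n)]

end

/-! ### Commuting minors past powers of a generator -/

section

section Powers

variable {F A : Type*} [Field F] [Ring A] [Algebra F A] {n : ℕ} {v : F} {Z : Fin n → Fin n → A}

lemma mul_pow_of_mul_eq_smul {x z : A} {c : F} (h : x * z = c • (z * x)) (a : ℕ) :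
    x * z ^ a = c ^ a • (z ^ a * x) := by
  induction a with
  | zero => simp
  | succ a ih =>
    rw [pow_succ, ← mul_assoc, ih, smul_mul_assoc, mul_assoc, h, mul_smul_comm, smul_smul,
      ← mul_assoc, ← pow_succ]

lemma QRel.minor_mul_pow_of_mem (hZ : QRel v Z) {s : Fin n} {rs : List (Fin n)}
    (hs : ∀ i ∈ rs, s < i) {M : Finset (Fin n)} {k : Fin n} (hk : k ∈ M) (a : ℕ) :
    minor v Z rs M * Z s k ^ a = v⁻¹ ^ a • (Z s k ^ a * minor v Z rs M) :=
  mul_pow_of_mul_eq_smul ((hZ.minor_mul s rs hs).1 M k hk) a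

lemma QRel.Hm_mul_pow_of_mem (hZ : QRel v Z) {s : Fin n} {rs : List (Fin n)}
    (hs : ∀ i ∈ rs, s < i) {M : Finset (Fin n)} {k : Fin n} (hk : k ∈ M) (a : ℕ) :
    Hm v Z s rs (k + 1) M * Z s k ^ a
      = (v⁻¹ * v⁻¹) ^ a • (Z s k ^ a * Hm v Z s rs (k + 1) M) :=
  mul_pow_of_mul_eq_smul (hZ.Hm_mul_of_mem hs hk) a

lemma QRel.Hm_mul_pow_of_notMem (hZ : QRel v Z) {s : Fin n} {rs : List (Fin n)}
    (hs : ∀ i ∈ rs, s < i) {M : Finset (Fin n)} {k : Fin n} (hk : k ∉ M) (a : ℕ) :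
    Hm v Z s rs (k + 1) M * Z s k ^ a = v⁻¹ ^ a • (Z s k ^ a * Hm v Z s rs (k + 1) M) :=
  mul_pow_of_mul_eq_smul (hZ.Hm_mul_of_notMem hs hk) a

/-- Each further factor contributes `(v - v⁻¹)` times the next power of `v⁻²`; the coefficient is
the sum of this geometric progression. -/
lemma QRel.minor_mul_pow_of_notMem (hZ : QRel v Z) {s : Fin n} {rs : List (Fin n)}
    (hs : ∀ i ∈ rs, s < i) {M : Finset (Fin n)} {k : Fin n} (hk : k ∉ M) (a : ℕ) :
    minor v Z rs M * Z s k ^ (a + 1) = Z s k ^ (a + 1) * minor v Z rs M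
      - (v * (1 - (v⁻¹ * v⁻¹) ^ (a + 1))) • (Z s k ^ a * Hm v Z s rs (k + 1) (insert k M)) := by
  have hv := hZ.ne_zero
  induction a with
  | zero =>
    rw [zero_add, pow_one, (hZ.minor_mul s rs hs).2 M k hk, pow_zero, one_mul, pow_one, mul_sub,
      mul_one, mul_inv_cancel_left₀ hv]
  | succ a ih =>
    rw [pow_succ, ← mul_assoc, ih, sub_mul, smul_mul_assoc, mul_assoc, mul_assoc,
      (hZ.minor_mul s rs hs).2 M k hk, hZ.Hm_mul_of_mem hs (Finset.mem_insert_self k M), mul_sub,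
      mul_smul_comm, mul_smul_comm, ← mul_assoc, ← mul_assoc, ← pow_succ, ← pow_succ, sub_sub,
      smul_smul, ← add_smul]
    congr 2
    rw [pow_succ (v⁻¹ * v⁻¹) (a + 1)]
    generalize (v⁻¹ * v⁻¹) ^ (a + 1) = y
    field_simp
    ring

/-- The two contributions to the last term, `-v * (1 - v⁻²ᵃ)` and `-v * v⁻²ᵃ`, add up to `-v`. No
negative power of `v` is left, which is the source of integrality. -/
lemma QRel.Hm_mul_pow (hZ : QRel v Z) {s : Fin n} {rs : List (Fin n)}
    (hs : ∀ i ∈ rs, s < i) {M : Finset (Fin n)} {k : Fin n} (hk : k ∈ M) (a : ℕ) :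
    Hm v Z s rs k M * Z s k ^ a = Z s k ^ (a + 1) * minor v Z rs (M.erase k)
      + (-v) • (Z s k ^ a * Hm v Z s rs (k + 1) M) := by
  have hv := hZ.ne_zero
  have hk' : k ∉ M.erase k := Finset.notMem_erase k M
  cases a with
  | zero => rw [pow_zero, mul_one, zero_add, pow_one, one_mul, Hm_mem hk]
  | succ a =>
    rw [Hm_mem hk, add_mul, mul_assoc, hZ.minor_mul_pow_of_notMem hs hk', smul_mul_assoc,
      hZ.Hm_mul_pow_of_mem hs hk, Finset.insert_erase hk, mul_sub, mul_smul_comm, ← mul_assoc,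
      ← mul_assoc, ← pow_succ', ← pow_succ', smul_smul, sub_add, ← sub_smul, sub_eq_add_neg,
      ← neg_smul]
    congr 2
    ring

end Powers

variable {n : ℕ}

/-! ### The integral lattice and the quantum determinant -/

/-- The `ℤ[q]`-span of the normalized monomials with exponents in `S`. -/
def Lat (S : Set (Mat n)) : Submodule Zq (OqM n) := Submodule.span Zq (ZN '' S)

lemma smul_mem_Lat {S : Set (Mat n)} {c : K} (hc : c ∈ Zq) {x : OqM n} (hx : x ∈ Lat S) :
    c • x ∈ Lat S := (Lat S).smul_mem ⟨c, hc⟩ hx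

lemma zpow_mem_Zq {m : ℤ} (hm : 0 ≤ m) : q ^ m ∈ Zq := by
  obtain ⟨k, rfl⟩ := Int.eq_ofNat_of_zero_le hm
  rw [zpow_natCast]
  exact pow_mem q_mem_Zq k

/-- The entries of `A` strictly before the position `(i, k)` vanish. -/
def ZeroBefore (i k : ℕ) (A : Mat n) : Prop :=
  ∀ s t : Fin n, ((s : ℕ) < i ∨ ((s : ℕ) = i ∧ (t : ℕ) < k)) → A s t = 0

lemma ro_smul_E (a : ℕ) (p : Fin n × Fin n) (i : Fin n) :
    ro (a • E p) i = if i = p.1 then a else 0 := by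
  have : ro (a • E p) i = a * ro (E p) i := by simp [ro, Finset.mul_sum]
  rw [this, ro_E]; simp

lemma co_smul_E (a : ℕ) (p : Fin n × Fin n) (j : Fin n) :
    co (a • E p) j = if j = p.2 then a else 0 := by
  have : co (a • E p) j = a * co (E p) j := by simp [co, Finset.mul_sum]
  rw [this, co_E]; simp

lemma smul_E_apply (a : ℕ) (p : Fin n × Fin n) (s t : Fin n) :
    (a • E p : Mat n) s t = if (s, t) = p then a else 0 := by
  change a • E p s t = _
  rw [E_apply]
  split_ifs <;> simp

lemma ZeroBefore.exists_split {i k : Fin n} {A : Mat n} (h : ZeroBefore i k A) :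
    ∃ (a : ℕ) (B : Mat n), A = a • E (i, k) + B ∧ ZeroBefore i (k + 1) B := by
  refine ⟨A i k, fun s t => if (s, t) = (i, k) then 0 else A s t, ?_, ?_⟩
  · ext s t
    change A s t = (A i k • E (i, k) : Mat n) s t + (if (s, t) = (i, k) then 0 else A s t)
    rw [smul_E_apply]
    split_ifs with hst
    · simp only [Prod.mk.injEq] at hst; simp [hst.1, hst.2]
    · simp
  · intro s t hst
    dsimp only
    split_ifs with h'
    · rfl
    · refine h s t ?_
      rcases hst with hst | ⟨hst, ht⟩
      · exact Or.inl hst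
      · refine Or.inr ⟨hst, lt_of_le_of_ne (Nat.lt_succ_iff.1 ht) fun e => h' ?_⟩
        rw [Fin.ext hst, Fin.ext e]

lemma Zp_pow_mul_ZN {i k : Fin n} {B : Mat n} (h : ZeroBefore i (k + 1) B) (b : ℕ) :
    Zp (i, k) ^ b * ZN B = q ^ ((b * (ro B i + co B k) : ℕ) : ℤ) • ZN (b • E (i, k) + B) := by
  induction b with
  | zero => simp
  | succ b ih =>
    have hz : ∀ r, Before r (i, k) → (b • E (i, k) + B) r.1 r.2 = 0 := by
      rintro ⟨s, t⟩ hr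
      have hne : (s, t) ≠ (i, k) := by rintro e; rw [e] at hr; exact before_irrefl _ hr
      have : B s t = 0 := h s t (by
        rcases hr with hr | ⟨hr, hr'⟩
        · exact Or.inl hr
        · exact Or.inr ⟨congrArg Fin.val hr, Nat.lt_succ_of_lt hr'⟩)
      rw [Matrix.add_apply, smul_E_apply, if_neg hne, this]
    have hh : hook (i, k) (b • E (i, k) + B) = ro B i + co B k := by
      have hik : B i k = 0 := h i k (Or.inr ⟨rfl, Nat.lt_succ_self _⟩)
      unfold hook ro co
      rw [← Finset.sum_erase (a := k) Finset.univ hik, ← Finset.sum_erase (a := i) Finset.univ hik]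
      congr 1
      · refine Finset.sum_congr rfl fun j hj => ?_
        simp [smul_E_apply, -nsmul_eq_mul, -Matrix.smul_apply, Finset.ne_of_mem_erase hj]
      · refine Finset.sum_congr rfl fun j hj => ?_
        simp [smul_E_apply, -nsmul_eq_mul, -Matrix.smul_apply, Finset.ne_of_mem_erase hj]
    rw [pow_succ', mul_assoc, ih, mul_smul_comm, Zp_mul_ZN hz, hh, smul_smul,
      ← zpow_add₀ q_ne_zero, succ_nsmul', add_assoc]
    congr 2
    push_cast
    ring

/-- Matrices vanishing before `(i, k)`, with prescribed `i`-th row sum and column sums. -/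
def Supp (i : Fin n) (k : ℕ) (r : ℕ) (g : Fin n → ℕ) : Set (Mat n) :=
  {B | ZeroBefore i k B ∧ ro B i = r ∧ ∀ l, co B l = g l}

/-- Bookkeeping for integrality: putting `Z i k ^ b` in front of a normalized monomial with row sum
`r` and column sum `g k` costs `q ^ (b * (r + g k))`. Hypothesis `hc` asks that the total power of
`q` be integral. -/
lemma smul_Zp_pow_mul_mem {i k : Fin n} {r b r' : ℕ} {g g' : Fin n → ℕ} {e : ℤ} {y : OqM n} {c : K}
    (hy : q ^ e • y ∈ Lat (Supp i (k + 1) r g))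
    (hr : r' = r + b) (hg : ∀ l, g' l = g l + if l = k then b else 0)
    (hc : c * q ^ ((b * (r + g k) : ℕ) - e : ℤ) ∈ Zq) :
    c • (Z i k ^ b * y) ∈ Lat (Supp i k r' g') := by
  have key : ∀ x ∈ Lat (Supp i (k + 1) r g), q ^ (-((b * (r + g k) : ℕ) : ℤ)) • (Z i k ^ b * x) ∈
      Lat (Supp i k r' g') := by
    intro x hx
    induction hx using Submodule.span_induction with
    | mem x hx =>
      obtain ⟨B, ⟨hB, hBr, hBg⟩, rfl⟩ := hx
      have := Zp_pow_mul_ZN hB b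
      rw [hBr, hBg] at this
      change q ^ (-((b * (r + g k) : ℕ) : ℤ)) • (Zp (i, k) ^ b * ZN B) ∈ _
      rw [this, smul_smul, ← zpow_add₀ q_ne_zero, neg_add_cancel, zpow_zero, one_smul]
      refine Submodule.subset_span ⟨_, ⟨?_, ?_, ?_⟩, rfl⟩
      · intro s t hst
        have hne : (s, t) ≠ (i, k) := by
          rintro e
          simp only [Prod.mk.injEq] at e
          rw [e.1, e.2] at hst
          omega
        have : B s t = 0 := hB s t (hst.imp_right fun h => ⟨h.1, Nat.lt_succ_of_lt h.2⟩)
        rw [Matrix.add_apply, smul_E_apply, if_neg hne, this]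
      · rw [ro_add, Pi.add_apply, ro_smul_E, if_pos rfl, hBr, hr, add_comm]
      · intro l
        rw [co_add, Pi.add_apply, co_smul_E, hBg, hg, add_comm]
    | zero => simp
    | add x y _ _ hx hy => rw [mul_add (Z i k ^ b), smul_add]; exact add_mem hx hy
    | smul a x _ hx =>
      have : (a : K) • (q ^ (-((b * (r + g k) : ℕ) : ℤ)) • (Z i k ^ b * x)) ∈ Lat (Supp i k r' g') :=
        smul_mem_Lat a.2 hx
      rw [smul_comm, ← mul_smul_comm] at this
      exact this
  have h := smul_mem_Lat hc (key _ hy)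
  rwa [mul_smul_comm, smul_smul, smul_smul, mul_assoc, ← zpow_add₀ q_ne_zero, mul_assoc,
    ← zpow_add₀ q_ne_zero, show ((b * (r + g k) : ℕ) : ℤ) - e + (-((b * (r + g k) : ℕ) : ℤ) + e) = 0
      by ring, zpow_zero, mul_one] at h

end

/-! ### Integrality of multiplication by quantum minors -/

section

variable {n : ℕ}

/-- The indicator function of a set of columns. -/
def ind (M : Finset (Fin n)) (l : Fin n) : ℕ := if l ∈ M then 1 else 0

/-- The sum of the column sums over the columns outside `M`. -/
def cosum (M : Finset (Fin n)) (A : Mat n) : ℕ := ∑ l ∈ Mᶜ, co A l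

lemma cosum_add (M : Finset (Fin n)) (A B : Mat n) : cosum M (A + B) = cosum M A + cosum M B := by
  simp [cosum, co_add, Finset.sum_add_distrib]

lemma cosum_smul_E (M : Finset (Fin n)) (a : ℕ) (p : Fin n × Fin n) :
    cosum M (a • E p) = if p.2 ∈ M then 0 else a := by
  simp only [cosum, co_smul_E, Finset.sum_ite_eq', Finset.mem_compl]
  split_ifs <;> simp_all

lemma cosum_erase {M : Finset (Fin n)} {k : Fin n} (hk : k ∈ M) (A : Mat n) :
    cosum (M.erase k) A = cosum M A + co A k := by
  rw [cosum, cosum, Finset.compl_erase, Finset.sum_insert (by simpa using hk), add_comm]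

lemma cosum_insert {M : Finset (Fin n)} {k : Fin n} (hk : k ∉ M) (A : Mat n) :
    cosum M A = cosum (insert k M) A + co A k := by
  rw [← cosum_erase (Finset.mem_insert_self k M), Finset.erase_insert hk]

/-- Integrality of the truncated expansions. -/
def HmInt (i : Fin n) (rs : List (Fin n)) (k : ℕ) : Prop :=
  ∀ (M : Finset (Fin n)) (A : Mat n), ZeroBefore i k A →
    q ^ (cosum M A : ℤ) • (Hm v Z i rs k M * ZN A)
      ∈ Lat (Supp i k (ro A i + 1) fun l => co A l + ind M l)

/-- Integrality of the minors with rows below `i`. -/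
def MinorInt (i : Fin n) (rs : List (Fin n)) (k : ℕ) : Prop :=
  ∀ (M : Finset (Fin n)) (A : Mat n), ZeroBefore i k A →
    q ^ (ro A i + cosum M A : ℤ) • (minor v Z rs M * ZN A)
      ∈ Lat (Supp i k (ro A i) fun l => co A l + ind M l)

lemma v_inv_pow (a : ℕ) : v⁻¹ ^ a = q ^ (-2 * a : ℤ) := by
  rw [v, ← zpow_natCast, ← zpow_natCast, ← zpow_neg, ← zpow_mul]
  congr 1

lemma v_inv_mul_pow (a : ℕ) : (v⁻¹ * v⁻¹) ^ a = q ^ (-4 * a : ℤ) := by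
  rw [mul_pow, v_inv_pow, ← zpow_add₀ q_ne_zero]
  congr 1; ring

lemma v_eq_zpow : v = q ^ (2 : ℤ) := by rw [v]; norm_cast

lemma ZN_smul_E_add {i k : Fin n} {B : Mat n} (h : ZeroBefore i (k + 1) B) (a : ℕ) :
    ZN (a • E (i, k) + B) = q ^ (-(a * (ro B i + co B k) : ℤ)) • (Z i k ^ a * ZN B) := by
  have := Zp_pow_mul_ZN h a
  change Z i k ^ a * ZN B = _ at this
  rw [this, smul_smul, ← zpow_add₀ q_ne_zero]
  push_cast
  rw [neg_add_cancel, zpow_zero, one_smul]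

/-- The power `Z i k ^ a` is moved in front of the expansion, after which both integrality
statements at `k + 1` apply to the rest. The shift `cosum` is chosen so that the remaining exponents
of `q` are nonnegative. -/
lemma HmInt.step {i : Fin n} {rs : List (Fin n)} (hs : ∀ x ∈ rs, i < x) {k : Fin n}
    (h0 : HmInt i rs (k + 1)) (h1 : MinorInt i rs (k + 1)) : HmInt i rs k := by
  intro M A hA
  obtain ⟨a, B, rfl, hB⟩ := hA.exists_split
  have hq := q_ne_zero
  have hr : ro (a • E (i, k) + B) i = ro B i + a := by
    rw [ro_add, Pi.add_apply, ro_smul_E, if_pos rfl, add_comm]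
  have hc : ∀ l, co (a • E (i, k) + B) l = co B l + if l = k then a else 0 := by
    intro l; rw [co_add, Pi.add_apply, co_smul_E, add_comm]
  rw [cosum_add, cosum_smul_E, ZN_smul_E_add hB, hr, mul_smul_comm, ← mul_assoc]
  by_cases hk : k ∈ M
  · rw [(qrel_Z n).Hm_mul_pow hs hk, if_pos hk, add_mul, smul_mul_assoc, mul_assoc, mul_assoc,
      smul_add, smul_add, smul_smul, smul_smul, smul_smul]
    refine add_mem ?_ ?_
    · refine smul_Zp_pow_mul_mem (h1 (M.erase k) B hB) (by ring) (fun l => ?_) ?_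
      · rw [hc]
        by_cases hl : l = k
        · subst hl; simp [ind, hk]; ring
        · simp [ind, hl]
      · rw [cosum_erase hk, ← zpow_add₀ hq, ← zpow_add₀ hq]
        -- The exponents cancel exactly here; in the second summand they add up to `2 * a + 2`.
        refine zpow_mem_Zq (le_of_eq ?_)
        simp [ind]
        ring
    · refine smul_Zp_pow_mul_mem (h0 M B hB) (by ring) (fun l => ?_) ?_
      · rw [hc]; ring
      · rw [mul_neg, neg_mul, v_eq_zpow, ← zpow_add₀ hq, ← zpow_add₀ hq, ← zpow_add₀ hq]
        refine neg_mem (zpow_mem_Zq ?_)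
        simp only [ind, hk, if_true]
        push_cast
        ring_nf
        positivity
  · rw [Hm_notMem hk, (qrel_Z n).Hm_mul_pow_of_notMem hs hk, if_neg hk, smul_mul_assoc, mul_assoc,
      smul_smul, smul_smul, v_inv_pow]
    refine smul_Zp_pow_mul_mem (h0 M B hB) (by ring) (fun l => ?_) ?_
    · rw [hc]; ring
    · rw [← zpow_add₀ hq, ← zpow_add₀ hq, ← zpow_add₀ hq]
      refine zpow_mem_Zq (le_of_eq ?_)
      simp only [ind, hk, if_false]
      push_cast
      ring

/-- For `k ∉ M` the correction is a truncated expansion along row `i` with columns `insert k M`, so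
this induction has to run together with that of `HmInt`. -/
lemma MinorInt.step {i : Fin n} {rs : List (Fin n)} (hs : ∀ x ∈ rs, i < x) {k : Fin n}
    (h0 : HmInt i rs (k + 1)) (h1 : MinorInt i rs (k + 1)) : MinorInt i rs k := by
  intro M A hA
  obtain ⟨a, B, rfl, hB⟩ := hA.exists_split
  have hq := q_ne_zero
  have hr : ro (a • E (i, k) + B) i = ro B i + a := by
    rw [ro_add, Pi.add_apply, ro_smul_E, if_pos rfl, add_comm]
  have hc : ∀ l, co (a • E (i, k) + B) l = co B l + if l = k then a else 0 := by
    intro l; rw [co_add, Pi.add_apply, co_smul_E, add_comm]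
  rw [cosum_add, cosum_smul_E, ZN_smul_E_add hB, hr, mul_smul_comm, ← mul_assoc]
  by_cases hk : k ∈ M
  · rw [(qrel_Z n).minor_mul_pow_of_mem hs hk, if_pos hk, smul_mul_assoc, mul_assoc,
      smul_smul, smul_smul, v_inv_pow]
    refine smul_Zp_pow_mul_mem (h1 M B hB) (by ring) (fun l => ?_) ?_
    · rw [hc]; ring
    · rw [← zpow_add₀ hq, ← zpow_add₀ hq, ← zpow_add₀ hq]
      refine zpow_mem_Zq (le_of_eq ?_)
      simp only [ind, hk, if_true]
      push_cast
      ring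
  · rw [if_neg hk]
    cases a with
    | zero =>
      rw [pow_zero, mul_one]
      have := smul_Zp_pow_mul_mem (b := 0) (c := q ^ (ro B i + cosum M B : ℤ)) (r' := ro B i)
        (g' := fun l => co B l + ind M l) (h1 M B hB) (by ring) (fun l => by simp) (by
          rw [← zpow_add₀ hq]
          exact zpow_mem_Zq (le_of_eq (by simp)))
      rw [pow_zero, one_mul] at this
      convert this using 2
      · simp
      · simp
      · rw [Nat.cast_zero, zero_mul, neg_zero, zpow_zero, one_smul]
    | succ a =>
      have hn := h0 (insert k M) B hB
      rw [(qrel_Z n).minor_mul_pow_of_notMem hs hk, sub_mul, smul_mul_assoc, mul_assoc, mul_assoc,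
        smul_sub, smul_sub, smul_smul, smul_smul, smul_smul, v_inv_mul_pow]
      refine sub_mem ?_ ?_
      · refine smul_Zp_pow_mul_mem (h1 M B hB) (by ring) (fun l => ?_) ?_
        · rw [hc]; ring
        · rw [← zpow_add₀ hq, ← zpow_add₀ hq]
          refine zpow_mem_Zq ?_
          simp only [ind, hk, if_false]
          push_cast
          ring_nf
          positivity
      · refine smul_Zp_pow_mul_mem hn (by ring) (fun l => ?_) ?_
        · rw [hc]
          by_cases hl : l = k
          · subst hl; simp [ind, hk]; ring
          · simp [ind, hl]
        · have e : ∀ x y z : ℤ, x + y + 2 + z = 4 * a + 4 →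
              q ^ x * q ^ y * (v * (1 - q ^ (-4 * (a + 1 : ℕ) : ℤ))) * q ^ z
                = q ^ (4 * a + 4 : ℤ) - 1 := by
            intro x y z h
            rw [← h, v_eq_zpow, ← zpow_add₀ hq, mul_sub, mul_one, ← zpow_add₀ hq, mul_sub, sub_mul,
              ← zpow_add₀ hq, ← zpow_add₀ hq, ← zpow_add₀ hq, ← zpow_add₀ hq]
            have : x + y + (2 + -4 * ((a + 1 : ℕ) : ℤ)) + z = 0 := by push_cast; linarith
            rw [this, zpow_zero]
          rw [e]
          · exact sub_mem (zpow_mem_Zq (by positivity)) (one_mem _)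
          · rw [cosum_insert hk]
            simp only [ind, Finset.mem_insert_self, if_true]
            push_cast
            ring

lemma HmInt.zero {i : Fin n} {rs : List (Fin n)} (hs : ∀ x ∈ rs, i < x)
    (h1 : MinorInt i rs n) : HmInt i rs 0 := by
  refine (descending_induction (P := fun k => HmInt i rs k ∧ MinorInt i rs k) n ⟨?_, h1⟩ ?_ 0
    (Nat.zero_le _)).1
  · intro M A _
    rw [Hm_top le_rfl, zero_mul, smul_zero]
    exact zero_mem _
  · rintro k hk ⟨h, h'⟩
    exact ⟨HmInt.step hs (k := ⟨k, hk⟩) h h', MinorInt.step hs (k := ⟨k, hk⟩) h h'⟩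

/-- Integrality of the minors with all rows from the `i`-th on. -/
lemma minor_drop_int : ∀ i ≤ n, ∀ (M : Finset (Fin n)) (A : Mat n),
    (∀ s t : Fin n, (s : ℕ) < i → A s t = 0) →
    q ^ (cosum M A : ℤ) • (minor v Z ((List.finRange n).drop i) M * ZN A)
      ∈ Lat {B | (∀ s t : Fin n, (s : ℕ) < i → B s t = 0) ∧ ∀ l, co B l = co A l + ind M l} := by
  refine descending_induction n ?_ ?_
  · intro M A hA
    have hA0 : A = 0 := by ext s t; exact hA s t s.2
    subst hA0
    have hd : (List.finRange n).drop n = [] := by simp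
    have hco : ∀ l : Fin n, co (0 : Mat n) l = 0 := by intro l; simp [co]
    rw [hd, minor]
    split_ifs with hM
    · subst hM
      have : cosum ∅ (0 : Mat n) = 0 := by simp [cosum, hco]
      rw [this, one_mul]
      simp only [Nat.cast_zero, zpow_zero, one_smul]
      exact Submodule.subset_span ⟨0, ⟨fun _ _ _ => rfl, fun l => by simp [ind]⟩, rfl⟩
    · simp
  · intro i hi ih
    have hd : (List.finRange n).drop i = ⟨i, hi⟩ :: (List.finRange n).drop (i + 1) := by
      rw [List.drop_eq_getElem_cons (by simpa using hi)]
      simp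
    have hpw := List.pairwise_lt_finRange n
    have hs : ∀ x ∈ (List.finRange n).drop (i + 1), (⟨i, hi⟩ : Fin n) < x := by
      have := hpw.sublist (List.drop_sublist i (List.finRange n))
      rw [hd, List.pairwise_cons] at this
      exact this.1
    -- At `k = n` row `i` of `A` is zero, so the extra shift `ro A i` is `0` and the induction
    -- hypothesis applies.
    have h1 : MinorInt (⟨i, hi⟩ : Fin n) ((List.finRange n).drop (i + 1)) n := by
      intro M A hA
      have hA' : ∀ s t : Fin n, (s : ℕ) < i + 1 → A s t = 0 := fun s t h =>
        hA s t ((Nat.lt_succ_iff_lt_or_eq.1 h).imp_right fun h => ⟨h, t.2⟩)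
      have hr : ∀ B : Mat n, (∀ s t : Fin n, (s : ℕ) < i + 1 → B s t = 0) → ro B ⟨i, hi⟩ = 0 := by
        intro B hB
        exact Finset.sum_eq_zero fun t _ => hB _ t (Nat.lt_succ_self i)
      rw [hr A hA']
      have := ih M A hA'
      simp only [Nat.cast_zero, zero_add]
      refine Submodule.span_mono (Set.image_mono ?_) this
      rintro B ⟨hB, hB'⟩
      exact ⟨fun s t h => hB s t (by rcases h with h | ⟨h, -⟩ <;> (simp at h; omega)), hr B hB, hB'⟩
    intro M A hA
    rw [hd, minor_cons]
    refine Submodule.span_mono (Set.image_mono ?_)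
      (HmInt.zero hs h1 M A fun s t h => hA s t (by simpa using h))
    rintro B ⟨hB, -, hB'⟩
    exact ⟨fun s t h => hB s t (Or.inl h), hB'⟩

/-- Left multiplication by the quantum determinant preserves the integral lattice. -/
theorem detq_mul_ZN_mem (A : Mat n) : detq n * ZN A ∈ Lat (Set.univ : Set (Mat n)) := by
  -- For the full set of columns the shift `cosum` is an empty sum.
  have h := minor_drop_int 0 (Nat.zero_le n) Finset.univ A (fun s t h => absurd h (Nat.not_lt_zero _))
  have hc : cosum Finset.univ A = 0 := by simp [cosum]
  rw [List.drop_zero, minor_eq_detq, hc, Nat.cast_zero, zpow_zero, one_smul] at h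
  exact Submodule.span_mono (Set.image_mono (Set.subset_univ _)) h

end

section

/-! ### Triangularity with respect to a height function -/

section Triangular

variable {ι V : Type*} [AddCommGroup V] [Module K V] (X : Module.Basis ι K V) (h : ι → ℕ)

lemma repr_of_mem_span {R : Subalgebra ℤ K} {S : Set ι} {x : V}
    (hx : x ∈ Submodule.span R (X '' S)) (B : ι) :
    X.repr x B ∈ R ∧ (X.repr x B ≠ 0 → B ∈ S) := by
  classical
  induction hx using Submodule.span_induction with
  | mem x hx =>
    obtain ⟨A, hA, rfl⟩ := hx
    rw [X.repr_self, Finsupp.single_apply]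
    split_ifs with e
    · subst e; exact ⟨one_mem _, fun _ => hA⟩
    · exact ⟨zero_mem _, fun h => absurd rfl h⟩
  | zero => simp
  | add x y _ _ hx hy =>
    rw [map_add, Finsupp.add_apply]
    refine ⟨add_mem hx.1 hy.1, fun hne => ?_⟩
    by_cases h0 : X.repr x B = 0
    · rw [h0, zero_add] at hne; exact hy.2 hne
    · exact hx.2 h0
  | smul c x _ hx =>
    have e : X.repr (c • x) B = (c : K) * X.repr x B := by
      change X.repr ((c : K) • x) B = _
      rw [map_smul, Finsupp.smul_apply, smul_eq_mul]
    rw [e]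
    exact ⟨mul_mem c.2 hx.1, fun hne => hx.2 (right_ne_zero_of_mul hne)⟩

lemma mem_span_of_repr {R : Subalgebra ℤ K} {S : Set ι} {x : V}
    (hx : ∀ B, X.repr x B ∈ R ∧ (X.repr x B ≠ 0 → B ∈ S)) :
    x ∈ Submodule.span R (X '' S) := by
  rw [← X.linearCombination_repr x, Finsupp.linearCombination_apply]
  refine Submodule.sum_mem _ fun B hB => ?_
  exact Submodule.smul_mem _ (⟨_, (hx B).1⟩ : R)
    (Submodule.subset_span ⟨B, (hx B).2 (Finsupp.mem_support_iff.1 hB), rfl⟩)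

/-- For `f` unitriangular with respect to the height, only `B = C` contributes to the coefficient at
`C` when `x` vanishes above `C`. -/
lemma repr_semilinear (f : V →ₛₗ[bar] V)
    (hf : ∀ A C, h A ≤ h C → X.repr (f (X A)) C = X.repr (X A) C) (x : V) (C : ι)
    (hx : ∀ B, h C < h B → X.repr x B = 0) : X.repr (f x) C = bar (X.repr x C) := by
  classical
  have e : X.repr (f x) C = ∑ B ∈ (X.repr x).support, bar (X.repr x B) * X.repr (f (X B)) C := by
    conv_lhs => rw [← X.linearCombination_repr x, Finsupp.linearCombination_apply, Finsupp.sum,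
      map_sum, map_sum, Finsupp.finsetSum_apply]
    refine Finset.sum_congr rfl fun B _ => ?_
    rw [map_smulₛₗ, map_smul, Finsupp.smul_apply, smul_eq_mul]
  rw [e, Finset.sum_eq_single C]
  · rw [hf C C le_rfl, X.repr_self, Finsupp.single_eq_same, mul_one]
  · intro B hB hBC
    have hle : h B ≤ h C := by
      by_contra hlt
      exact Finsupp.mem_support_iff.1 hB (hx B (not_le.1 hlt))
    rw [hf B C hle, X.repr_self, Finsupp.single_eq_of_ne' hBC, mul_zero]
  · intro hC
    rw [Finsupp.notMem_support_iff.1 hC, map_zero, zero_mul]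

/-- A nonzero vector has a support element of maximal height. With `repr_semilinear` this reduces
every vanishing statement below to one about scalars and `bar`. -/
lemma eq_zero_of_heights {x : V} (hx : ∀ C, (∀ B, h C < h B → X.repr x B = 0) → X.repr x C = 0) :
    x = 0 := by
  by_contra hne
  have hs : (X.repr x).support.Nonempty := by
    rw [Finsupp.support_nonempty_iff]
    simpa using hne
  obtain ⟨C, hC, hmax⟩ := Finset.exists_max_image _ h hs
  refine Finsupp.mem_support_iff.1 hC (hx C fun B hB => ?_)
  by_contra hB0
  exact absurd (hmax B (Finsupp.mem_support_iff.2 hB0)) (not_le.2 hB)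

lemma linearIndependent_of_triangular {b : ι → V}
    (hb : ∀ A C, h A ≤ h C → X.repr (b A) C = X.repr (X A) C) : LinearIndependent K b := by
  classical
  rw [linearIndependent_iff]
  intro l hl
  by_contra hne
  obtain ⟨C, hC, hmax⟩ := Finset.exists_max_image _ h (Finsupp.support_nonempty_iff.2 hne)
  refine Finsupp.mem_support_iff.1 hC ?_
  have e : X.repr (Finsupp.linearCombination K b l) C
      = ∑ B ∈ l.support, l B * X.repr (b B) C := by
    rw [Finsupp.linearCombination_apply, Finsupp.sum, map_sum, Finsupp.finsetSum_apply]
    refine Finset.sum_congr rfl fun B _ => ?_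
    rw [map_smul, Finsupp.smul_apply, smul_eq_mul]
  rw [hl, map_zero, Finsupp.zero_apply, Finset.sum_eq_single C] at e
  · rw [hb C C le_rfl, X.repr_self, Finsupp.single_eq_same, mul_one] at e
    exact e.symm
  · intro B hB hBC
    rw [hb B C (hmax B hB), X.repr_self, Finsupp.single_eq_of_ne' hBC, mul_zero]
  · intro h'; exact absurd hC h'

end Triangular

lemma span_eq_of_triangular {R ι V : Type*} [Ring R] [AddCommGroup V] [Module R V] {X b : ι → V}
    (h : ι → ℕ) (hb : ∀ A, b A - X A ∈ Submodule.span R (X '' {B | h B < h A})) :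
    Submodule.span R (Set.range b) = Submodule.span R (Set.range X) := by
  apply le_antisymm
  · rw [Submodule.span_le]
    rintro _ ⟨A, rfl⟩
    have := add_mem (Submodule.span_mono (Set.image_subset_range _ _) (hb A))
      (Submodule.subset_span (R := R) (Set.mem_range_self (f := X) A))
    rwa [sub_add_cancel] at this
  · rw [Submodule.span_le]
    rintro _ ⟨A, rfl⟩
    induction hA : h A using Nat.strong_induction_on generalizing A with
    | _ m ih =>
      have h1 : Submodule.span R (X '' {B | h B < h A}) ≤ Submodule.span R (Set.range b) := by
        rw [Submodule.span_le]
        rintro _ ⟨B, hB, rfl⟩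
        exact ih _ (hA ▸ hB) B rfl
      have := sub_mem (Submodule.subset_span (R := R) (Set.mem_range_self (f := b) A)) (h1 (hb A))
      rwa [sub_sub_cancel] at this

end

section

variable {n : ℕ}

/-! ### The leading term of the quantum determinant -/

lemma content_ofFn {m : ℕ} (f : Fin m → Fin n × Fin n) :
    content (List.ofFn f) = ∑ i, E (f i) := by
  have : ∀ w : List (Fin n × Fin n), content w = (w.map E).sum := by
    intro w
    induction w with
    | nil => rfl
    | cons p w ih => rw [content, ih, List.map_cons, List.sum_cons]
  rw [this, List.map_ofFn, List.sum_ofFn]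
  rfl

lemma pair_content (p : Fin n × Fin n) (w : List (Fin n × Fin n)) :
    pair p (content w) = (w.map (qc p)).sum := by
  induction w with
  | nil => simp [content]
  | cons r w ih => rw [content, pair_add, pair_E, ih, List.map_cons, List.sum_cons]

lemma wexp_append (w w' : List (Fin n × Fin n)) :
    wexp (w ++ w') = wexp w + wexp w' + (w.map fun p => pair p (content w')).sum := by
  induction w with
  | nil => simp [wexp]
  | cons p w ih =>
    rw [List.cons_append, wexp, wexp, ih, content_append, pair_add, List.map_cons, List.sum_cons]
    ring

/-- The word of a permutation. -/
def permWord (σ : Equiv.Perm (Fin n)) : List (Fin n × Fin n) := List.ofFn fun i => (i, σ i)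

/-- For the diagonal word, the row contribution of each entry of `content w` cancels its column
contribution. Hence the leading coefficient of a product with the determinant is `1`. -/
lemma wexp_permWord_one_append (w : List (Fin n × Fin n)) :
    wexp (permWord 1 ++ w) = wexp w := by
  have h1 : ∀ u : List (Fin n × Fin n), (∀ p ∈ u, ∀ r ∈ u, qc p r = 0) → wexp u = 0 := by
    intro u
    induction u with
    | nil => intro _; rfl
    | cons p u ih =>
      intro h
      rw [wexp, ih fun a ha b hb => h a (List.mem_cons_of_mem _ ha) b (List.mem_cons_of_mem _ hb),
        pair_content, add_zero]
      refine List.sum_eq_zero fun x hx => ?_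
      obtain ⟨r, hr, rfl⟩ := List.mem_map.1 hx
      exact h p List.mem_cons_self r (List.mem_cons_of_mem _ hr)
  have h2 : wexp (permWord (1 : Equiv.Perm (Fin n))) = 0 := by
    refine h1 _ fun p hp r hr => ?_
    simp only [permWord, List.mem_ofFn, Equiv.Perm.one_apply] at hp hr
    obtain ⟨i, rfl⟩ := hp
    obtain ⟨j, rfl⟩ := hr
    simp only [qc]
    split_ifs with h
    · rw [h]; simp
    · rfl
  rw [wexp_append, h2, zero_add, permWord, List.map_ofFn, List.sum_ofFn]
  simp only [Function.comp_apply, Equiv.Perm.one_apply, pair_eq, Finset.sum_add_distrib]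
  nth_rewrite 2 [Finset.sum_comm]
  rw [← Finset.sum_add_distrib, Finset.sum_eq_zero, add_zero]
  intro i _
  rw [← Finset.sum_add_distrib]
  refine Finset.sum_eq_zero fun j _ => ?_
  rw [sg_swap i j]; ring

lemma nw_sum {m : ℕ} (i k : Fin n) (f : Fin m → Mat n) : nw i k (∑ s, f s) = ∑ s, nw i k (f s) :=
  map_sum (⟨⟨nw i k, by simp [nw]⟩, nw_add i k⟩ : Mat n →+ ℕ) f Finset.univ

lemma ro_sum {m : ℕ} (f : Fin m → Mat n) : ro (∑ s, f s) = ∑ s, ro (f s) :=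
  map_sum (⟨⟨ro, by ext; simp [ro]⟩, ro_add⟩ : Mat n →+ (Fin n → ℕ)) f Finset.univ

lemma co_sum {m : ℕ} (f : Fin m → Mat n) : co (∑ s, f s) = ∑ s, co (f s) :=
  map_sum (⟨⟨co, by ext; simp [co]⟩, co_add⟩ : Mat n →+ (Fin n → ℕ)) f Finset.univ

lemma content_permWord_one : content (permWord (1 : Equiv.Perm (Fin n))) = 1 := by
  rw [permWord, content_ofFn]
  ext i j
  rw [Matrix.sum_apply, Matrix.one_apply]
  simp [E_apply, eq_comm, Finset.sum_ite, ite_and]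

lemma ro_permWord (σ : Equiv.Perm (Fin n)) : ro (content (permWord σ)) = 1 := by
  rw [permWord, content_ofFn, ro_sum]
  ext i
  simp [ro_E]

lemma co_permWord (σ : Equiv.Perm (Fin n)) : co (content (permWord σ)) = 1 := by
  rw [permWord, content_ofFn, co_sum]
  ext j
  rw [Finset.sum_apply]
  simp only [co_E]
  rw [Equiv.sum_comp σ (fun i => if j = i then 1 else 0)]
  simp

lemma nw_permWord (σ : Equiv.Perm (Fin n)) (i k : Fin n) :
    nw i k (content (permWord σ)) = ((Finset.Iic i).filter fun s => σ s ≤ k).card := by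
  rw [permWord, content_ofFn, nw_sum]
  simp only [nw_E]
  rw [← Finset.card_filter]
  congr 1
  ext s
  simp

/-- A north-west rectangle contains at most as many ones of a permutation matrix as its shorter
side, and the identity attains this bound everywhere. Strictness occurs at `(i, i)` for any `i < σ
i`. -/
lemma prec_permWord {σ : Equiv.Perm (Fin n)} (hσ : σ ≠ 1) :
    Prec (content (permWord σ)) (content (permWord 1)) := by
  have hlt : ∃ i, i < σ i := by
    by_contra! h
    refine hσ (Equiv.ext fun i => ?_)
    have h1 : ∑ i, (σ i : ℕ) = ∑ i : Fin n, (i : ℕ) :=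
      Equiv.sum_comp σ (fun i : Fin n => (i : ℕ))
    exact Fin.ext ((Finset.sum_eq_sum_iff_of_le (f := fun i => (σ i : ℕ)) (g := fun i : Fin n => (i : ℕ))
      fun i _ => h i).1 h1 i (Finset.mem_univ i))
  obtain ⟨i, hi⟩ := hlt
  refine Prec.of_nw_lt (by rw [ro_permWord, ro_permWord]) (by rw [co_permWord, co_permWord]) ?_ i i ?_
  · intro a b
    rw [nw_permWord, nw_permWord]
    rcases le_total a b with hab | hab
    · have : (Finset.Iic a).filter (fun s => (1 : Equiv.Perm (Fin n)) s ≤ b) = Finset.Iic a :=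
        Finset.filter_true_of_mem fun s hs => (Finset.mem_Iic.1 hs).trans hab
      rw [this]
      exact Finset.card_filter_le _ _
    · have : (Finset.Iic a).filter (fun s => (1 : Equiv.Perm (Fin n)) s ≤ b) = Finset.Iic b := by
        ext s
        rw [Finset.mem_filter, Finset.mem_Iic, Finset.mem_Iic]
        exact ⟨fun h => h.2, fun h => ⟨h.trans hab, h⟩⟩
      rw [this]
      refine Finset.card_le_card_of_injOn σ (fun s hs => ?_) σ.injective.injOn
      simpa using (Finset.mem_filter.1 hs).2
  · rw [nw_permWord, nw_permWord]
    have : (Finset.Iic i).filter (fun s => (1 : Equiv.Perm (Fin n)) s ≤ i) = Finset.Iic i :=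
      Finset.filter_true_of_mem fun s hs => Finset.mem_Iic.1 hs
    rw [this]
    refine Finset.card_lt_card (Finset.filter_ssubset.2 ⟨i, by simp, by simpa using hi⟩)

lemma detq_eq_sum (n : ℕ) :
    detq n = ∑ σ : Equiv.Perm (Fin n), (-q ^ 2) ^ len σ • wprod (permWord σ) := by
  refine Finset.sum_congr rfl fun σ _ => ?_
  rw [wprod, permWord, List.map_ofFn]
  rfl

/-- The leading term of a product with the quantum determinant. -/
theorem detq_mul_ZN_sub_mem (A : Mat n) : detq n * ZN A - ZN (1 + A) ∈ lower (1 + A) := by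
  classical
  obtain ⟨w, rfl, hw⟩ := exists_word A
  have key : ∀ σ : Equiv.Perm (Fin n), wprod (permWord σ) * ZN (content w)
      = q ^ (-wexp w) • wprod (permWord σ ++ w) := by
    intro σ
    rw [← hw, mul_smul_comm, wprod_append]
  rw [detq_eq_sum, Finset.sum_mul, ← Finset.add_sum_erase _ _ (Finset.mem_univ 1), add_sub_right_comm]
  refine add_mem ?_ (Submodule.sum_mem _ fun σ hσ => ?_)
  · have h := straighten (permWord 1 ++ w)
    rw [wexp_permWord_one_append, content_append, content_permWord_one] at h
    have hl : len (1 : Equiv.Perm (Fin n)) = 0 := by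
      rw [len, Finset.card_eq_zero]
      refine Finset.filter_false_of_mem fun p _ hp => lt_asymm hp.1 hp.2
    rwa [hl, pow_zero, one_smul, key]
  · have hp := (prec_permWord (Finset.ne_of_mem_erase hσ)).add_right (content w)
    rw [content_permWord_one] at hp
    have h := straighten (permWord σ ++ w)
    rw [content_append] at h
    have h2 := add_mem (lower_mono hp h) (ZN_mem_lower hp)
    rw [sub_add_cancel, smul_mem_iff_of_zpow] at h2
    rw [smul_mul_assoc, key]
    exact smul_mem_of_mem (pow_mem (neg_mem v_mem_Zqq) _) ((smul_mem_iff_of_zpow _).2 h2)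

end

section

variable {n : ℕ}

/-! ### Bar-invariant elements of `O_q(M(n))` -/

/-- The basis of normalized monomials. -/
def basisZN (n : ℕ) : Module.Basis (Mat n) K (OqM n) :=
  Module.Basis.mk (linearIndependent_ZN n) (span_ZN n).ge

lemma coe_basisZN (n : ℕ) : ⇑(basisZN n) = ZN := Module.Basis.coe_mk _ _

lemma repr_of_mem_Lat {S : Set (Mat n)} {x : OqM n} (hx : x ∈ Lat S) (B : Mat n) :
    (basisZN n).repr x B ∈ Zq ∧ ((basisZN n).repr x B ≠ 0 → B ∈ S) := by
  rw [Lat, ← coe_basisZN] at hx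
  exact repr_of_mem_span _ hx B

lemma mem_Lat_of_repr {S : Set (Mat n)} {x : OqM n}
    (hx : ∀ B, (basisZN n).repr x B ∈ Zq ∧ ((basisZN n).repr x B ≠ 0 → B ∈ S)) : x ∈ Lat S := by
  rw [Lat, ← coe_basisZN]
  exact mem_span_of_repr _ hx

lemma repr_of_mem_lower {A : Mat n} {x : OqM n} (hx : x ∈ lower A) (B : Mat n) :
    (basisZN n).repr x B ∈ Zqq ∧ ((basisZN n).repr x B ≠ 0 → Prec B A) := by
  rw [lower, ← coe_basisZN] at hx
  exact repr_of_mem_span _ hx B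

/-- `ph` as a semilinear map. -/
def phL (n : ℕ) : OqM n →ₛₗ[bar] OqM n where
  toFun := ph
  map_add' := ph_add
  map_smul' := ph_smul

lemma repr_ph {x : OqM n} {C : Mat n} (hx : ∀ B, mu C < mu B → (basisZN n).repr x B = 0) :
    (basisZN n).repr (ph x) C = bar ((basisZN n).repr x C) := by
  refine repr_semilinear (basisZN n) mu (phL n) (fun A C hAC => ?_) x C hx
  rw [coe_basisZN]
  have h := (repr_of_mem_lower (ph_ZN_sub_mem A) C).2
  rw [map_sub, Finsupp.sub_apply, sub_ne_zero] at h
  by_contra hne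
  exact absurd (h hne).2.2.2 (not_lt.2 hAC)

lemma ph_mem_lower {A : Mat n} {x : OqM n} (hx : x ∈ lower A) : ph x ∈ lower A := by
  induction hx using Submodule.span_induction with
  | mem x hx =>
    obtain ⟨B, hB, rfl⟩ := hx
    have := add_mem (lower_mono hB (ph_ZN_sub_mem B)) (ZN_mem_lower hB)
    rwa [sub_add_cancel] at this
  | zero => rw [ph_zero]; exact zero_mem _
  | add x y _ _ hx hy => rw [ph_add]; exact add_mem hx hy
  | smul c x _ hx =>
    have : ph ((c : K) • x) ∈ lower A := by
      rw [ph_smul]; exact smul_mem_of_mem (bar_mem_Zqq c.2) hx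
    exact this

/-- Descent on the height `m` bounding the support. At the top height `ph` acts on coefficients by
`bar`, so `exists_sub_bar` solves for them; subtracting that part keeps the element antiinvariant
and lowers the height. -/
lemma exists_eq_sub_ph (A : Mat n) (m : ℕ) : ∀ x ∈ lower A, ph x = -x →
    (∀ B, m ≤ mu B → (basisZN n).repr x B = 0) →
    ∃ y ∈ Lat {B | Prec B A}, x = q • y - ph (q • y) := by
  classical
  induction m with
  | zero =>
    intro x _ _ hx
    have : x = 0 := eq_zero_of_heights (basisZN n) mu fun C _ => hx C (Nat.zero_le _)
    exact ⟨0, zero_mem _, by rw [this, smul_zero, ph_zero, sub_zero]⟩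
  | succ m ih =>
    intro x hxA hx hm
    have hs : ∀ B : Mat n, ∃ s : K, s ∈ Zq ∧ (mu B = m →
        (basisZN n).repr x B = q * s - bar (q * s)) := by
      intro B
      by_cases hB : mu B = m
      · have h1 := repr_ph (x := x) (C := B) fun B' hB' => hm B' (by omega)
        rw [hx, map_neg, Finsupp.neg_apply] at h1
        obtain ⟨s, hs, e⟩ := exists_sub_bar (repr_of_mem_lower hxA B).1 h1.symm
        exact ⟨s, hs, fun _ => e⟩
      · exact ⟨0, zero_mem _, fun h => absurd h hB⟩
    choose s hsZ hs using hs
    set T := ((basisZN n).repr x).support.filter fun B => mu B = m with hT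
    have hTA : ∀ B ∈ T, Prec B A := fun B hB =>
      (repr_of_mem_lower hxA B).2 (Finsupp.mem_support_iff.1 (Finset.mem_filter.1 hB).1)
    set y₀ : OqM n := ∑ B ∈ T, s B • ZN B with hy₀
    have hy₀L : y₀ ∈ Lat {B | Prec B A} := Submodule.sum_mem _ fun B hB =>
      smul_mem_Lat (hsZ B) (Submodule.subset_span ⟨B, hTA B hB, rfl⟩)
    have hwlow : q • y₀ ∈ lower A := by
      refine smul_mem_of_mem q_mem_Zqq (Submodule.sum_mem _ fun B hB => ?_)
      exact smul_mem_of_mem (Zq_le_Zqq (hsZ B)) (ZN_mem_lower (hTA B hB))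
    have hwr : ∀ C, (basisZN n).repr (q • y₀) C = if C ∈ T then q * s C else 0 := by
      intro C
      rw [map_smul, Finsupp.smul_apply, hy₀, map_sum, Finsupp.finsetSum_apply]
      simp only [map_smul, Finsupp.smul_apply, ← coe_basisZN, Module.Basis.repr_self,
        Finsupp.single_apply, smul_eq_mul, mul_ite, mul_one, mul_zero, Finset.sum_ite_eq']
    obtain ⟨y, hy, e⟩ := ih (x - q • y₀ + ph (q • y₀))
      (add_mem (sub_mem hxA hwlow) (ph_mem_lower hwlow))
      (by rw [ph_add, ph_sub, ph_ph, hx]; abel) (by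
        intro C hC
        have h1 := repr_ph (x := q • y₀) (C := C) fun B hB => by
          rw [hwr, if_neg]
          intro h
          have := (Finset.mem_filter.1 h).2
          omega
        rw [map_add, map_sub, Finsupp.add_apply, Finsupp.sub_apply, h1, hwr]
        rcases hC.eq_or_lt with hC | hC
        · by_cases hCT : C ∈ T
          · rw [if_pos hCT, hs C hC.symm, sub_sub_cancel_left, neg_add_cancel]
          · have : (basisZN n).repr x C = 0 := by
              by_contra hne
              exact hCT (Finset.mem_filter.2 ⟨Finsupp.mem_support_iff.2 hne, hC.symm⟩)
            rw [if_neg hCT, this, map_zero, sub_zero, add_zero]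
        · have hCT : C ∉ T := fun h => by
            have := (Finset.mem_filter.1 h).2
            omega
          rw [if_neg hCT, hm C hC, map_zero, sub_zero, add_zero])
    refine ⟨y₀ + y, add_mem hy₀L hy, ?_⟩
    rw [smul_add, ph_add, add_sub_add_comm, ← e]
    abel

/-- Writing `ph (ZN A) - ZN A = q • y - ph (q • y)` makes `ZN A + q • y` fixed. -/
lemma exists_invariant (A : Mat n) :
    ∃ b : OqM n, ph b = b ∧ ∃ y ∈ Lat {B | Prec B A}, b = ZN A + q • y := by
  obtain ⟨y, hy, e⟩ := exists_eq_sub_ph A (mu A) _ (ph_ZN_sub_mem A)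
    (by rw [ph_sub, ph_ph]; abel) (fun B hB => by
      by_contra hne
      exact absurd ((repr_of_mem_lower (ph_ZN_sub_mem A) B).2 hne).2.2.2 (not_lt.2 hB))
  refine ⟨_, ?_, y, hy, rfl⟩
  rw [ph_add, eq_add_of_sub_eq e]
  abel

/-- The bar-invariant element with leading term `ZN A`. -/
def bM (A : Mat n) : OqM n := (exists_invariant A).choose

lemma ph_bM (A : Mat n) : ph (bM A) = bM A := (exists_invariant A).choose_spec.1

lemma bM_eq (A : Mat n) : ∃ y ∈ Lat {B | Prec B A}, bM A = ZN A + q • y :=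
  (exists_invariant A).choose_spec.2

/-! ### The quantum determinant is central -/

lemma detq_mul_mem {x : OqM n} (hx : x ∈ Lat (Set.univ : Set (Mat n))) :
    detq n * x ∈ Lat (Set.univ : Set (Mat n)) := by
  induction hx using Submodule.span_induction with
  | mem x hx => obtain ⟨B, _, rfl⟩ := hx; exact detq_mul_ZN_mem B
  | zero => rw [mul_zero]; exact zero_mem _
  | add x y _ _ hx hy => rw [mul_add]; exact add_mem hx hy
  | smul c x _ hx =>
    have : detq n * ((c : K) • x) ∈ Lat (Set.univ : Set (Mat n)) := by
      rw [mul_smul_comm]; exact smul_mem_Lat c.2 hx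
    exact this

lemma rt_mem {x : OqM n} (hx : x ∈ Lat (Set.univ : Set (Mat n))) :
    rt x ∈ Lat (Set.univ : Set (Mat n)) := by
  induction hx using Submodule.span_induction with
  | mem x hx =>
    obtain ⟨B, _, rfl⟩ := hx
    rw [rt_ZN]
    exact Submodule.subset_span ⟨_, trivial, rfl⟩
  | zero => rw [map_zero]; exact zero_mem _
  | add x y _ _ hx hy => rw [map_add]; exact add_mem hx hy
  | smul c x _ hx =>
    have : rt ((c : K) • x) ∈ Lat (Set.univ : Set (Mat n)) := by
      rw [map_smul]; exact smul_mem_Lat c.2 hx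
    exact this

lemma rt_rt (x : OqM n) : rt (rt x) = x := by
  have h : (rt ∘ₗ rt : OqM n →ₗ[K] OqM n) = LinearMap.id := by
    refine (basisZN n).ext fun A => ?_
    rw [coe_basisZN, LinearMap.comp_apply, rt_ZN, rt_ZN, LinearMap.id_apply]
    congr 1
    ext i j
    simp [rot]
  exact LinearMap.congr_fun h x

lemma mul_detq_mem {x : OqM n} (hx : x ∈ Lat (Set.univ : Set (Mat n))) :
    x * detq n ∈ Lat (Set.univ : Set (Mat n)) := by
  have := rt_mem (detq_mul_mem (rt_mem hx))
  rwa [rt_mul, rt_rt, rt_detq] at this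

lemma bM_mem (A : Mat n) : bM A ∈ Lat (Set.univ : Set (Mat n)) := by
  obtain ⟨y, hy, e⟩ := bM_eq A
  rw [e]
  exact add_mem (Submodule.subset_span ⟨A, trivial, rfl⟩)
    (smul_mem_Lat q_mem_Zq (Submodule.span_mono (Set.image_mono (Set.subset_univ _)) hy))

/-- Both factors are fixed by `ph`, so the commutator is negated, and it lies in the `ℤ[q]`-lattice.
A top coefficient `x` then has `x` and `bar x = -x` in `ℤ[q]`, whence `bar x = x` and `x = 0`. -/
lemma commute_detq_bM (A : Mat n) : detq n * bM A = bM A * detq n := by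
  set d := detq n * bM A - bM A * detq n with hd
  have hph : ph d = -d := by
    rw [hd, ph_sub, ph_mul, ph_mul, ph_detq, ph_bM, neg_sub]
  have hdL : d ∈ Lat (Set.univ : Set (Mat n)) :=
    sub_mem (detq_mul_mem (bM_mem A)) (mul_detq_mem (bM_mem A))
  have : d = 0 := by
    refine eq_zero_of_heights (basisZN n) mu fun C hC => ?_
    have h1 := repr_ph hC
    rw [hph, map_neg, Finsupp.neg_apply] at h1
    have hZ := (repr_of_mem_Lat hdL C).1
    have h2 := bar_eq_of_mem hZ (h1 ▸ neg_mem hZ)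
    rw [h2] at h1
    have : CharZero K := algebraRat.charZero K
    have h3 : (2 : K) * (basisZN n).repr d C = 0 := by
      rw [two_mul]; nth_rewrite 1 [← h1]; exact neg_add_cancel _
    exact (mul_eq_zero.1 h3).resolve_left two_ne_zero
  exact sub_eq_zero.1 this

lemma span_bM (n : ℕ) : Submodule.span K (Set.range (bM : Mat n → OqM n)) = ⊤ := by
  rw [← span_ZN]
  refine span_eq_of_triangular mu fun A => ?_
  obtain ⟨y, hy, e⟩ := bM_eq A
  rw [e, add_sub_cancel_left]
  clear e
  refine Submodule.smul_mem _ _ ?_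
  induction hy using Submodule.span_induction with
  | mem x hx =>
    obtain ⟨B, hB, rfl⟩ := hx
    exact Submodule.subset_span ⟨B, hB.2.2.2, rfl⟩
  | zero => exact zero_mem _
  | add x y _ _ hx hy => exact add_mem hx hy
  | smul c x _ hx => exact Submodule.smul_mem _ (c : K) hx

/-- The quantum determinant is central. -/
theorem commute_detq (x : OqM n) : detq n * x = x * detq n := by
  have hx : x ∈ Submodule.span K (Set.range (bM : Mat n → OqM n)) := by rw [span_bM]; trivial
  induction hx using Submodule.span_induction with
  | mem x hx => obtain ⟨A, rfl⟩ := hx; exact commute_detq_bM A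
  | zero => rw [mul_zero, zero_mul]
  | add x y _ _ hx hy => rw [mul_add, add_mul, hx, hy]
  | smul c x _ hx => rw [mul_smul_comm, smul_mul_assoc, hx]

/-- Left multiplication by the quantum determinant on normalized monomials. -/
theorem detq_mul_ZN (A : Mat n) : ∃ y ∈ Lat {B | Prec B (1 + A)}, detq n * ZN A = ZN (1 + A) + y := by
  refine ⟨detq n * ZN A - ZN (1 + A), mem_Lat_of_repr fun B => ⟨?_, ?_⟩, by rw [add_sub_cancel]⟩
  · exact (repr_of_mem_Lat (sub_mem (detq_mul_ZN_mem A)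
      (Submodule.subset_span ⟨1 + A, trivial, rfl⟩)) B).1
  · exact (repr_of_mem_lower (detq_mul_ZN_sub_mem A) B).2

end


/-- The ring structure of `O_q(SL(n))` underlying its `K`-algebra structure. -/
local instance ringOqSL {n : ℕ} : Ring (OqSL n) := Algebra.semiringToRing K
local instance subOqSL {n : ℕ} : Sub (OqSL n) := ringOqSL.toSub

variable {n : ℕ}

/-! ### The basis of `O_q(SL(n))` -/

lemma toSL_detq (n : ℕ) : toSL n (detq n) = 1 := by
  rw [toSL, RingQuot.mkAlgHom_rel K SLRel.det, map_one]

lemma toSL_surjective (n : ℕ) : Function.Surjective (toSL n) :=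
  RingQuot.mkAlgHom_surjective K (SLRel n)

/-- Because `detq n` is central, the left multiples of `detq n - 1` already form a two-sided ideal.
-/
lemma eq_detq_mul_sub_of_toSL_eq_zero {x : OqM n} (hx : toSL n x = 0) :
    ∃ z : OqM n, x = detq n * z - z := by
  have h1 : RingQuot.mkRingHom (SLRel n) x = RingQuot.mkRingHom (SLRel n) 0 := by
    rw [map_zero, ← RingQuot.mkAlgHom_coe K]; exact hx
  rw [RingQuot.mkRingHom_def] at h1
  have h2 : Relation.EqvGen (RingQuot.Rel (SLRel n)) x 0 :=
    Quot.eqvGen_exact (RingQuot.mk.inj h1)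
  have h3 : ∀ a b, RingQuot.Rel (SLRel n) a b → ∃ z : OqM n, a = b + (detq n * z - z) := by
    intro a b h
    induction h with
    | of h => cases h; exact ⟨1, by rw [mul_one, add_sub_cancel]⟩
    | @add_left a b c _ ih =>
      obtain ⟨z, rfl⟩ := ih
      exact ⟨z, add_right_comm _ _ _⟩
    | @mul_left a b c _ ih =>
      obtain ⟨z, rfl⟩ := ih
      exact ⟨z * c, by rw [add_mul, sub_mul, mul_assoc]⟩
    | @mul_right a b c _ ih =>
      obtain ⟨z, rfl⟩ := ih
      refine ⟨a * z, ?_⟩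
      rw [mul_add, mul_sub, ← mul_assoc, ← mul_assoc, commute_detq a]
  have h4 : ∀ a b, Relation.EqvGen (RingQuot.Rel (SLRel n)) a b →
      ∃ z : OqM n, a = b + (detq n * z - z) := by
    intro a b h
    induction h with
    | rel a b h => exact h3 a b h
    | refl a => exact ⟨0, by rw [mul_zero, sub_zero, add_zero]⟩
    | symm a b _ ih =>
      obtain ⟨z, rfl⟩ := ih
      refine ⟨-z, ?_⟩
      rw [mul_neg]; abel
    | trans a b c _ _ ih ih' =>
      obtain ⟨z, rfl⟩ := ih
      obtain ⟨z', rfl⟩ := ih'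
      refine ⟨z' + z, ?_⟩
      rw [mul_add]; abel
  obtain ⟨z, hz⟩ := h4 x 0 h2
  exact ⟨z, by rw [hz, zero_add]⟩

lemma repr_detq_mul {z : OqM n} {C : Mat n} (hz : ∀ B, mu C < mu B → (basisZN n).repr z B = 0) :
    (basisZN n).repr (detq n * z) (1 + C) = (basisZN n).repr z C := by
  classical
  have e : (basisZN n).repr (detq n * z) (1 + C) = ∑ B ∈ ((basisZN n).repr z).support,
      (basisZN n).repr z B * (basisZN n).repr (detq n * ZN B) (1 + C) := by
    conv_lhs => rw [← (basisZN n).linearCombination_repr z, Finsupp.linearCombination_apply,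
      Finsupp.sum, Finset.mul_sum, map_sum, Finsupp.finsetSum_apply]
    refine Finset.sum_congr rfl fun B _ => ?_
    rw [mul_smul_comm, map_smul, Finsupp.smul_apply, smul_eq_mul, coe_basisZN]
  have hB : ∀ B, mu B ≤ mu C → (basisZN n).repr (detq n * ZN B) (1 + C) = if B = C then 1 else 0 := by
    intro B hBC
    obtain ⟨y, hy, e⟩ := detq_mul_ZN B
    have hy0 : (basisZN n).repr y (1 + C) = 0 := by
      by_contra hne
      have := ((repr_of_mem_Lat hy _).2 hne).2.2.2
      rw [mu_add, mu_add] at this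
      omega
    rw [e, map_add (basisZN n).repr, Finsupp.add_apply, hy0, add_zero, ← coe_basisZN, Module.Basis.repr_self,
      Finsupp.single_apply]
    simp only [add_right_inj]
  rw [e, Finset.sum_eq_single C]
  · rw [hB C le_rfl, if_pos rfl, mul_one]
  · intro B hBs hBC
    have hle : mu B ≤ mu C := by
      by_contra hlt
      exact Finsupp.mem_support_iff.1 hBs (hz B (not_le.1 hlt))
    rw [hB B hle, if_neg hBC, mul_zero]
  · intro hC
    rw [Finsupp.notMem_support_iff.1 hC, zero_mul]

lemma mu_one_pos (hn : 1 ≤ n) : 0 < mu (1 : Mat n) := by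
  have h : (1 : Mat n) = E (⟨0, hn⟩, ⟨0, hn⟩) + (1 - E (⟨0, hn⟩, ⟨0, hn⟩) : Mat n) := by
    ext i j
    simp only [Matrix.add_apply, Matrix.sub_apply, E_apply, Matrix.one_apply, Prod.mk.injEq]
    split_ifs with h1 h2 h3
    · rfl
    · rfl
    · exact absurd (h3.1.trans h3.2.symm) h1
    · rfl
  have := mu_E_pos ((⟨0, hn⟩, ⟨0, hn⟩) : Fin n × Fin n)
  rw [h, mu_add]
  omega

/-- A top coefficient of `z` at `C` reappears in `detq n * z - z` at `1 + C`, above the support of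
`z`. The diagonal of `1 + C` is positive, so that coefficient is zero for an element of the span of
the index set. -/
theorem linearIndependent_X (hn : 1 ≤ n) : LinearIndependent K (fun A : Idx n => X A.1) := by
  have h1 : LinearIndependent K (fun A : Idx n => ZN A.1) :=
    (linearIndependent_ZN n).comp _ Subtype.val_injective
  refine h1.map (f := (toSL n).toLinearMap) ?_
  rw [Submodule.disjoint_def]
  intro x hx hx0
  obtain ⟨z, rfl⟩ := eq_detq_mul_sub_of_toSL_eq_zero (LinearMap.mem_ker.1 hx0)
  have hs : ∀ B : Mat n, (basisZN n).repr (detq n * z - z) B ≠ 0 → ∏ i, B i i = 0 := by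
    intro B
    generalize detq n * z - z = x at hx
    induction hx using Submodule.span_induction with
    | mem x hx =>
      obtain ⟨A, rfl⟩ := hx
      dsimp only
      rw [← coe_basisZN, Module.Basis.repr_self, Finsupp.single_apply]
      split_ifs with h
      · intro _; rw [← h]; exact A.2
      · exact fun h => absurd rfl h
    | zero => intro h; simp at h
    | add x y _ _ hx hy =>
      intro h
      rw [map_add, Finsupp.add_apply] at h
      by_cases h0 : (basisZN n).repr x B = 0
      · rw [h0, zero_add] at h; exact hy h
      · exact hx h0
    | smul c x _ hx =>
      intro h
      rw [map_smul, Finsupp.smul_apply, smul_eq_mul] at h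
      exact hx (right_ne_zero_of_mul h)
  have hz : z = 0 := by
    refine eq_zero_of_heights (basisZN n) mu fun C hC => ?_
    have h0 : (basisZN n).repr (detq n * z - z) (1 + C) = 0 := by
      by_contra hne
      have := hs _ hne
      rw [Finset.prod_eq_zero_iff] at this
      obtain ⟨i, -, hi⟩ := this
      simp at hi
    rw [map_sub, Finsupp.sub_apply, repr_detq_mul hC, hC (1 + C), sub_zero] at h0
    · exact h0
    · rw [mu_add]
      have := mu_one_pos hn
      omega
  rw [hz, mul_zero, sub_zero]

lemma LexLT.trans {A B C : Mat n} (h : LexLT A B) (h' : LexLT B C) : LexLT A C := by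
  obtain ⟨i, j, hij, h⟩ := h
  obtain ⟨i', j', hij', h'⟩ := h'
  rcases lt_trichotomy i i' with hi | rfl | hi
  · exact ⟨i, j, by rw [← h' i j (Or.inl hi)]; exact hij, fun s t hst =>
      (h s t hst).trans (h' s t (by rcases hst with g | ⟨rfl, -⟩; exacts [Or.inl (g.trans hi), Or.inl hi]))⟩
  · rcases lt_trichotomy j j' with hj | rfl | hj
    · exact ⟨i, j, by rw [← h' i j (Or.inr ⟨rfl, hj⟩)]; exact hij, fun s t hst =>
        (h s t hst).trans (h' s t (hst.imp_right fun g => ⟨g.1, g.2.trans hj⟩))⟩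
    · exact ⟨i, j, hij.trans hij', fun s t hst => (h s t hst).trans (h' s t hst)⟩
    · exact ⟨i, j', by rw [h i j' (Or.inr ⟨rfl, hj⟩)]; exact hij', fun s t hst =>
        (h s t (hst.imp_right fun g => ⟨g.1, g.2.trans hj⟩)).trans (h' s t hst)⟩
  · exact ⟨i', j', by rw [h i' j' (Or.inl hi)]; exact hij', fun s t hst =>
      (h s t (by rcases hst with g | ⟨rfl, -⟩; exacts [Or.inl (g.trans hi), Or.inl hi])).trans
        (h' s t hst)⟩

/-- `B` is below `A`, with row and column sums differing by a constant. -/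
def Below (B A : Mat n) : Prop :=
  (mu B < mu A ∧ LexLT B A) ∧ ∃ k : ℕ, (∀ i, ro A i = ro B i + k) ∧ ∀ j, co A j = co B j + k

lemma Below.trans {A B C : Mat n} (h : Below A B) (h' : Below B C) : Below A C := by
  obtain ⟨⟨h1, h2⟩, k, h3, h4⟩ := h
  obtain ⟨⟨h1', h2'⟩, k', h3', h4'⟩ := h'
  exact ⟨⟨h1.trans h1', h2.trans h2'⟩, k + k', fun i => by rw [h3', h3]; ring,
    fun i => by rw [h4', h4]; ring⟩

lemma Prec.below {A B : Mat n} (h : Prec B A) : Below B A :=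
  ⟨⟨h.2.2.2, h.lexLT⟩, 0, fun i => by rw [h.1, add_zero], fun i => by rw [h.2.1, add_zero]⟩

lemma below_one_add (hn : 1 ≤ n) (A : Mat n) : Below A (1 + A) := by
  refine ⟨⟨?_, ⟨0, hn⟩, ⟨0, hn⟩, ?_, ?_⟩, 1, fun i => ?_, fun i => ?_⟩
  · rw [mu_add]; have := mu_one_pos hn; omega
  · simp
  · rintro s t (h | ⟨-, h⟩) <;> simp [Fin.lt_def] at h
  · rw [ro_add, ← content_permWord_one, ro_permWord, Pi.add_apply, Pi.one_apply, add_comm]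
  · rw [co_add, ← content_permWord_one, co_permWord, Pi.add_apply, Pi.one_apply, add_comm]

/-- The `ℤ[q]`-span of the `X C`, for `C` in the index set and in `S`. -/
def XLat (S : Set (Mat n)) : Submodule Zq (OqSL n) :=
  Submodule.span Zq ((fun C : Idx n => X C.1) '' {C | C.1 ∈ S})

lemma XLat_mono {S T : Set (Mat n)} (h : S ⊆ T) : XLat S ≤ XLat T :=
  Submodule.span_mono (Set.image_mono fun _ hC => h hC)

lemma smul_mem_XLat {S : Set (Mat n)} {c : K} (hc : c ∈ Zq) {x : OqSL n} (hx : x ∈ XLat S) :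
    c • x ∈ XLat S := (XLat S).smul_mem ⟨c, hc⟩ hx

lemma toSL_mem_of_Lat {S T : Set (Mat n)} (h : ∀ B ∈ S, X B ∈ XLat T) {y : OqM n} (hy : y ∈ Lat S) :
    toSL n y ∈ XLat T := by
  induction hy using Submodule.span_induction with
  | mem x hx => obtain ⟨B, hB, rfl⟩ := hx; exact h B hB
  | zero => rw [map_zero]; exact zero_mem _
  | add x y _ _ hx hy => rw [map_add]; exact add_mem hx hy
  | smul c x _ hx =>
    have : toSL n ((c : K) • x) ∈ XLat T := by
      rw [map_smul]; exact smul_mem_XLat c.2 hx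
    exact this

/-- Every `X A` is an integral combination of basis elements `X C` with `C = A` or `C` below `A`. -/
theorem X_mem_XLat (hn : 1 ≤ n) (A : Mat n) : X A ∈ XLat {C | C = A ∨ Below C A} := by
  induction h : mu A using Nat.strong_induction_on generalizing A with
  | _ m ih =>
    by_cases hA : ∏ i, A i i = 0
    · exact Submodule.subset_span ⟨⟨A, hA⟩, Or.inl rfl, rfl⟩
    · have hex : ∃ A', A = 1 + A' := by
        refine ⟨fun i j => A i j - (1 : Mat n) i j, ?_⟩
        ext i j
        change A i j = (1 : Mat n) i j + (A i j - (1 : Mat n) i j)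
        rw [Matrix.one_apply]
        split_ifs with hij
        · subst hij
          have : A i i ≠ 0 := fun h0 => hA (Finset.prod_eq_zero (Finset.mem_univ i) h0)
          omega
        · simp
      obtain ⟨A', rfl⟩ := hex
      have hb : ∀ B, Below B (1 + A') → X B ∈ XLat {C | Below C (1 + A')} := by
        intro B hB
        refine XLat_mono ?_ (ih (mu B) (h ▸ hB.1.1) B rfl)
        rintro C (rfl | hC)
        · exact hB
        · exact hC.trans hB
      obtain ⟨y, hy, e⟩ := detq_mul_ZN A'
      -- The relation `detq n = 1` applied to `detq_mul_ZN`: every term on the right is strictly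
      -- below `1 + A'` and has coefficients in `ℤ[q]`.
      have e' : X (1 + A') = X A' - toSL n y := by
        rw [X, X, eq_sub_iff_add_eq, ← map_add, ← e, map_mul, toSL_detq, one_mul]
      rw [e']
      refine XLat_mono (fun C hC => Or.inr hC) (sub_mem (hb A' (below_one_add hn A')) ?_)
      exact toSL_mem_of_Lat (fun B hB => hb B hB.below) hy

theorem span_X (hn : 1 ≤ n) : Submodule.span K (Set.range fun A : Idx n => X A.1) = ⊤ := by
  have hX : ∀ S, ∀ x ∈ XLat S, x ∈ Submodule.span K (Set.range fun A : Idx n => X A.1) := by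
    intro S x hx
    induction hx using Submodule.span_induction with
    | mem x hx => obtain ⟨C, _, rfl⟩ := hx; exact Submodule.subset_span ⟨C, rfl⟩
    | zero => exact zero_mem _
    | add x y _ _ hx hy => exact add_mem hx hy
    | smul c x _ hx => exact Submodule.smul_mem _ (c : K) hx
  rw [eq_top_iff]
  rintro x -
  obtain ⟨y, rfl⟩ := toSL_surjective n x
  have hy : y ∈ Submodule.span K (Set.range (ZN : Mat n → OqM n)) := by rw [span_ZN]; trivial
  induction hy using Submodule.span_induction with
  | mem y hy => obtain ⟨A, rfl⟩ := hy; exact hX _ _ (X_mem_XLat hn A)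
  | zero => rw [map_zero]; exact zero_mem _
  | add x y _ _ hx hy => rw [map_add]; exact add_mem hx hy
  | smul c x _ hx => rw [map_smul]; exact Submodule.smul_mem _ c hx

section

variable {n : ℕ}

/-! ### The anti-automorphism of `O_q(SL(n))` -/

lemma IsPhi.map_toSL {φ : OqSL n ≃+* (OqSL n)ᵐᵒᵖ} (hφ : IsPhi φ) (y : OqM n) :
    φ (toSL n y) = MulOpposite.op (toSL n (ph y)) := by
  have hK : ∀ c : K, φ (algebraMap K (OqSL n) c)
      = MulOpposite.op (algebraMap K (OqSL n) (bar c)) := by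
    have h : φ.toRingHom.comp (algebraMap K (OqSL n))
        = (algebraMap K (OqSL n)ᵐᵒᵖ).comp bar := by
      refine K_hom_ext ?_
      change φ (algebraMap K (OqSL n) q) = algebraMap K (OqSL n)ᵐᵒᵖ (bar q)
      rw [hφ.map_q, bar_q]
      rfl
    intro c
    exact RingHom.congr_fun h c
  have hw : ∀ w : List (Fin n × Fin n),
      φ (toSL n (wprod w)) = MulOpposite.op (toSL n (ph (wprod w))) := by
    intro w
    induction w with
    | nil => rw [wprod_nil, ph_one, map_one, map_one, MulOpposite.op_one]
    | cons p w ih =>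
      rw [wprod_cons, map_mul, map_mul, ih, ph_mul, map_mul, Zp, ph_Z, hφ.map_gen,
        MulOpposite.op_mul]
  have hy : y ∈ Submodule.span K (Set.range (wprod : List (Fin n × Fin n) → OqM n)) := by
    rw [span_wprod]; trivial
  induction hy using Submodule.span_induction with
  | mem y hy => obtain ⟨w, rfl⟩ := hy; exact hw w
  | zero => rw [ph_zero, map_zero, map_zero, MulOpposite.op_zero]
  | add x y _ _ hx hy => rw [ph_add, map_add, map_add, map_add, hx, hy, MulOpposite.op_add]
  | smul c x _ hx =>
    rw [ph_smul, map_smul (toSL n), map_smul (toSL n), Algebra.smul_def c, map_mul, hK, hx, ← MulOpposite.op_mul,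
      ← Algebra.commutes, ← Algebra.smul_def]

/-- `ph` descends because it fixes `detq n`, and the induced map is bijective because `ph` is an
involution. -/
lemma exists_isPhi (n : ℕ) : ∃ φ : OqSL n ≃+* (OqSL n)ᵐᵒᵖ, IsPhi φ := by
  let f : OqM n →+* (OqSL n)ᵐᵒᵖ := (RingHom.op (toSL n).toRingHom).comp (phiM n)
  have hf : ∀ y, f y = MulOpposite.op (toSL n (ph y)) := fun y => rfl
  have hrel : ∀ ⦃a b⦄, SLRel n a b → f a = f b := by
    intro a b h
    cases h
    rw [hf, hf, ph_detq, ph_one, toSL_detq, map_one]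
  let g : OqSL n →+* (OqSL n)ᵐᵒᵖ := RingQuot.lift ⟨f, hrel⟩
  have hg : ∀ y, g (toSL n y) = MulOpposite.op (toSL n (ph y)) := by
    intro y
    have : toSL n y = RingQuot.mkRingHom (SLRel n) y := by
      rw [← RingQuot.mkAlgHom_coe K]; rfl
    rw [this, ← hf]
    exact RingQuot.lift_mkRingHom_apply f hrel y
  have hgg : ∀ x, g (MulOpposite.unop (g x)) = MulOpposite.op x := by
    intro x
    obtain ⟨y, rfl⟩ := toSL_surjective n x
    rw [hg, MulOpposite.unop_op, hg, ph_ph]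
  have hbij : Function.Bijective g := by
    constructor
    · intro x y hxy
      have := hgg x
      rw [hxy, hgg y] at this
      exact (MulOpposite.op_injective this).symm
    · intro w
      exact ⟨_, hgg w.unop⟩
  refine ⟨RingEquiv.ofBijective g hbij, ⟨?_, fun i j => ?_⟩⟩
  · have e : algebraMap K (OqSL n) q = toSL n (algebraMap K (OqM n) q) := ((toSL n).commutes q).symm
    rw [RingEquiv.ofBijective_apply, e, hg, ph_algebraMap, bar_q, AlgHom.commutes]
  · rw [RingEquiv.ofBijective_apply, hg, ph_Z]

lemma existsUnique_isPhi (n : ℕ) : ∃! φ : OqSL n ≃+* (OqSL n)ᵐᵒᵖ, IsPhi φ := by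
  obtain ⟨φ, hφ⟩ := exists_isPhi n
  refine ⟨φ, hφ, fun ψ hψ => RingEquiv.ext fun x => ?_⟩
  obtain ⟨y, rfl⟩ := toSL_surjective n x
  rw [hψ.map_toSL, hφ.map_toSL]

/-- The anti-automorphism as a semilinear self-map. -/
def IsPhi.toSemilinear {φ : OqSL n ≃+* (OqSL n)ᵐᵒᵖ} (hφ : IsPhi φ) : OqSL n →ₛₗ[bar] OqSL n where
  toFun x := (φ x).unop
  map_add' x y := by rw [map_add, MulOpposite.unop_add]
  map_smul' c x := by
    obtain ⟨y, rfl⟩ := toSL_surjective n x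
    rw [← map_smul, hφ.map_toSL, hφ.map_toSL, ph_smul, map_smul, MulOpposite.unop_op,
      MulOpposite.unop_op]

/-! ### The dual canonical basis of `O_q(SL(n))` -/

/-- The basis of the `X A`. -/
def basisX (hn : 1 ≤ n) : Module.Basis (Idx n) K (OqSL n) :=
  Module.Basis.mk (linearIndependent_X hn) (span_X hn).ge

lemma basisX_apply (hn : 1 ≤ n) (A : Idx n) : basisX hn A = X A.1 := by
  rw [basisX, Module.Basis.mk_apply]

/-- The height of an index. -/
def ht (A : Idx n) : ℕ := mu A.1

lemma repr_of_mem_XLat (hn : 1 ≤ n) {S : Set (Mat n)} {x : OqSL n} (hx : x ∈ XLat S) (C : Idx n) :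
    (basisX hn).repr x C ∈ Zq ∧ ((basisX hn).repr x C ≠ 0 → C.1 ∈ S) := by
  have e : (fun C : Idx n => X C.1) = basisX hn := funext fun C => (basisX_apply hn C).symm
  rw [XLat, e] at hx
  exact repr_of_mem_span _ hx C

/-- Rewriting in terms of the index set never raises the height, so `φ` stays unitriangular on the
quotient. -/
lemma repr_toSL_of_mem_lower (hn : 1 ≤ n) {A : Mat n} {y : OqM n} (hy : y ∈ lower A) (C : Idx n)
    (hC : mu A ≤ ht C) : (basisX hn).repr (toSL n y) C = 0 := by
  induction hy using Submodule.span_induction with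
  | mem y hy =>
    obtain ⟨B, hB, rfl⟩ := hy
    by_contra hne
    have h1 : mu C.1 ≤ mu B := by
      rcases (repr_of_mem_XLat hn (X_mem_XLat hn B) C).2 hne with h | h
      · rw [h]
      · exact h.1.1.le
    have h2 := hB.2.2.2
    have h3 : mu A ≤ mu C.1 := hC
    omega
  | zero => rw [map_zero, map_zero, Finsupp.zero_apply]
  | add x y _ _ hx hy => rw [map_add, map_add, Finsupp.add_apply, hx, hy, add_zero]
  | smul c x _ hx =>
    have : (basisX hn).repr (toSL n ((c : K) • x)) C = 0 := by
      rw [map_smul, map_smul, Finsupp.smul_apply, hx, smul_zero]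
    exact this

lemma IsPhi.repr (hn : 1 ≤ n) {φ : OqSL n ≃+* (OqSL n)ᵐᵒᵖ} (hφ : IsPhi φ) {x : OqSL n} {C : Idx n}
    (hx : ∀ B, ht C < ht B → (basisX hn).repr x B = 0) :
    (basisX hn).repr (φ x).unop C = bar ((basisX hn).repr x C) := by
  refine repr_semilinear (basisX hn) ht hφ.toSemilinear (fun A C hAC => ?_) x C hx
  have e : hφ.toSemilinear (basisX hn A) = X A.1 + toSL n (ph (ZN A.1) - ZN A.1) := by
    change (φ (basisX hn A)).unop = _
    rw [basisX_apply, map_sub, X, hφ.map_toSL, MulOpposite.unop_op, add_sub_cancel]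
  rw [e, map_add, Finsupp.add_apply, repr_toSL_of_mem_lower hn (ph_ZN_sub_mem A.1) C hAC, add_zero,
    basisX_apply]

lemma exists_finsupp_of_mem_span {ι : Type} {f : ι → OqSL n} {S : Set ι} {y : OqSL n}
    (hy : y ∈ Submodule.span Zq (f '' S)) :
    ∃ g : ι →₀ Zq, (∀ B ∈ g.support, B ∈ S) ∧ q • y = g.sum fun B c => (qZ * c) • f B := by
  rw [Finsupp.mem_span_image_iff_linearCombination] at hy
  obtain ⟨g, hg, rfl⟩ := hy
  refine ⟨g, fun B hB => (Finsupp.mem_supported _ _).1 hg hB, ?_⟩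
  change qZ • Finsupp.linearCombination Zq f g = _
  rw [Finsupp.linearCombination_apply, Finsupp.smul_sum]
  simp only [mul_smul]

lemma sum_mem_of_forall_mem {ι : Type} {f : ι → OqSL n} (hf : ∀ B, f B ∈ XLat (Set.univ : Set (Mat n)))
    (g : ι →₀ Zq) : ∃ y ∈ XLat (Set.univ : Set (Mat n)), (g.sum fun B c => (qZ * c) • f B) = q • y := by
  refine ⟨g.sum fun B c => c • f B, Submodule.sum_mem _ fun B _ => Submodule.smul_mem _ _ (hf B), ?_⟩
  change _ = (qZ • (g.sum fun B c => c • f B) : OqSL n)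
  rw [Finsupp.smul_sum]
  simp only [mul_smul]

/-- The invariant element with leading term `X A`. -/
def bSL (A : Idx n) : OqSL n := toSL n (bM A.1)

lemma X_mem_univ (hn : 1 ≤ n) (B : Mat n) : X B ∈ XLat (Set.univ : Set (Mat n)) :=
  XLat_mono (Set.subset_univ _) (X_mem_XLat hn B)

lemma toSL_mem_below (hn : 1 ≤ n) {A : Mat n} {y : OqM n} (hy : y ∈ Lat {B | Prec B A}) :
    toSL n y ∈ XLat {C | Below C A} := by
  refine toSL_mem_of_Lat (fun B hB => XLat_mono ?_ (X_mem_XLat hn B)) hy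
  rintro C (rfl | hC)
  · exact hB.below
  · exact hC.trans hB.below

lemma bSL_eq (hn : 1 ≤ n) (A : Idx n) :
    ∃ y ∈ XLat {C | Below C A.1}, bSL A = X A.1 + q • y := by
  obtain ⟨y, hy, e⟩ := bM_eq A.1
  exact ⟨toSL n y, toSL_mem_below hn hy, by rw [bSL, e, map_add, map_smul]; rfl⟩

lemma triangular_bSL : Triangular (bSL : Idx n → OqSL n) := by
  intro A
  obtain ⟨y, hy, e⟩ := bM_eq A.1
  have hy' : toSL n y ∈ Submodule.span Zq (X '' {B | Prec B A.1}) := by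
    clear e
    induction hy using Submodule.span_induction with
    | mem x hx => obtain ⟨B, hB, rfl⟩ := hx; exact Submodule.subset_span ⟨B, hB, rfl⟩
    | zero => rw [map_zero]; exact zero_mem _
    | add x y _ _ hx hy => rw [map_add]; exact add_mem hx hy
    | smul c x _ hx =>
      have : toSL n ((c : K) • x) ∈ Submodule.span Zq (X '' {B | Prec B A.1}) := by
        rw [map_smul]; exact Submodule.smul_mem _ c hx
      exact this
  obtain ⟨g, hg, hgy⟩ := exists_finsupp_of_mem_span hy'
  refine ⟨g, fun B hB => ⟨(hg B hB).lexLT, (hg B hB).1, (hg B hB).2.1⟩, ?_⟩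
  rw [← hgy, bSL, e, map_add, map_smul]
  rfl

lemma idxTriangular_bSL (hn : 1 ≤ n) : IdxTriangular (bSL : Idx n → OqSL n) := by
  intro A
  obtain ⟨y, hy, e⟩ := bSL_eq hn A
  obtain ⟨g, hg, hgy⟩ := exists_finsupp_of_mem_span hy
  exact ⟨g, fun B hB => ⟨(hg B hB).1.2, (hg B hB).2⟩, by rw [← hgy, e]⟩

lemma IsPhi.invariant_bSL {φ : OqSL n ≃+* (OqSL n)ᵐᵒᵖ} (hφ : IsPhi φ) : Invariant φ bSL := by
  intro A
  rw [bSL, hφ.map_toSL, ph_bM]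

lemma linearIndependent_bSL (hn : 1 ≤ n) : LinearIndependent K (bSL : Idx n → OqSL n) := by
  refine linearIndependent_of_triangular (basisX hn) ht fun A C hAC => ?_
  obtain ⟨y, hy, e⟩ := bSL_eq hn A
  have h0 : (basisX hn).repr y C = 0 := by
    by_contra hne
    exact absurd ((repr_of_mem_XLat hn hy C).2 hne).1.1 (not_lt.2 hAC)
  rw [e, map_add, Finsupp.add_apply, map_smul, Finsupp.smul_apply, h0, smul_zero, add_zero,
    basisX_apply]

lemma span_Zq_bSL (hn : 1 ≤ n) : Submodule.span Zq (Set.range (bSL : Idx n → OqSL n)) = lattice n := by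
  refine span_eq_of_triangular (R := Zq) (X := fun A : Idx n => X A.1) ht fun A => ?_
  obtain ⟨y, hy, e⟩ := bSL_eq hn A
  rw [e, add_sub_cancel_left]
  exact Submodule.smul_mem _ qZ
    (Submodule.span_mono (Set.image_mono fun C hC => hC.1.1) hy)

lemma span_K_bSL (hn : 1 ≤ n) : Submodule.span K (Set.range (bSL : Idx n → OqSL n)) = ⊤ := by
  rw [eq_top_iff, ← span_X hn, Submodule.span_le]
  rintro _ ⟨A, rfl⟩
  have h : X A.1 ∈ Submodule.span Zq (Set.range (bSL : Idx n → OqSL n)) := by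
    rw [span_Zq_bSL hn]; exact Submodule.subset_span ⟨A, rfl⟩
  change X A.1 ∈ _
  generalize X A.1 = x at h
  induction h using Submodule.span_induction with
  | mem x hx => exact Submodule.subset_span hx
  | zero => exact zero_mem _
  | add x y _ _ hx hy => exact add_mem hx hy
  | smul c x _ hx => exact Submodule.smul_mem _ (c : K) hx

/-- The difference is fixed and has coefficients in `qℤ[q]`, so each top coefficient is a
bar-invariant element of `qℤ[q]`. No order condition on the remainder is used, and hence one
argument covers both forms of triangularity. -/
lemma IsPhi.eq_bSL (hn : 1 ≤ n) {φ : OqSL n ≃+* (OqSL n)ᵐᵒᵖ} (hφ : IsPhi φ) {c : Idx n → OqSL n}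
    (hc : Invariant φ c)
    (ht : ∀ A, ∃ y ∈ XLat (Set.univ : Set (Mat n)), c A = X A.1 + q • y) : c = bSL := by
  funext A
  obtain ⟨y, hy, e⟩ := ht A
  obtain ⟨y', hy', e'⟩ := bSL_eq hn A
  have hd : c A - bSL A = q • (y - y') := by
    rw [e, e', add_sub_add_left_eq_sub, smul_sub]
  have hinv : (φ (c A - bSL A)).unop = c A - bSL A := by
    have h1 : φ (c A - bSL A) + φ (bSL A) = φ (c A) := by rw [← map_add, sub_add_cancel]
    rw [hc A, hφ.invariant_bSL A] at h1
    have h2 := congrArg MulOpposite.unop h1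
    rw [MulOpposite.unop_add, MulOpposite.unop_op, MulOpposite.unop_op] at h2
    exact eq_sub_of_add_eq h2
  have hyy : y - y' ∈ XLat (Set.univ : Set (Mat n)) :=
    sub_mem hy (XLat_mono (Set.subset_univ _) hy')
  rw [← sub_eq_zero]
  refine eq_zero_of_heights (basisX hn) QuantumSL.ht fun C hC => ?_
  have h1 := hφ.repr hn hC
  rw [hinv, hd, map_smul, Finsupp.smul_apply, smul_eq_mul] at h1
  rw [hd, map_smul, Finsupp.smul_apply, smul_eq_mul,
    eq_zero_of_bar_eq (repr_of_mem_XLat hn hyy C).1 h1.symm, mul_zero]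

lemma Triangular.exists_mem (hn : 1 ≤ n) {c : Idx n → OqSL n} (hc : Triangular c) (A : Idx n) :
    ∃ y ∈ XLat (Set.univ : Set (Mat n)), c A = X A.1 + q • y := by
  obtain ⟨g, -, e⟩ := hc A
  obtain ⟨y, hy, e'⟩ := sum_mem_of_forall_mem (X_mem_univ hn) g
  exact ⟨y, hy, by rw [e, e']⟩

lemma IdxTriangular.exists_mem (hn : 1 ≤ n) {c : Idx n → OqSL n} (hc : IdxTriangular c) (A : Idx n) :
    ∃ y ∈ XLat (Set.univ : Set (Mat n)), c A = X A.1 + q • y := by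
  obtain ⟨g, -, e⟩ := hc A
  obtain ⟨y, hy, e'⟩ := sum_mem_of_forall_mem (fun B : Idx n => X_mem_univ hn B.1) g
  exact ⟨y, hy, by rw [e, e']⟩

lemma linearIndependent_Zq_bSL (hn : 1 ≤ n) : LinearIndependent Zq (bSL : Idx n → OqSL n) := by
  rw [linearIndependent_iff']
  intro s g hg i hi
  have h := linearIndependent_iff'.1 (linearIndependent_bSL hn) s (fun i => (g i : K)) hg i hi
  exact Subtype.ext h

end

end

end QuantumSL

open QuantumSL in
theorem theorem6p2 (n : ℕ) (hn : 1 ≤ n) :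
    -- the `X(A)` form a basis of the algebra, so that their `ℤ[q]`-span is a direct sum
    (LinearIndependent K (fun A : Idx n => X A.1) ∧
      Submodule.span K (Set.range fun A : Idx n => X A.1) = ⊤) ∧
    -- the anti-automorphism `φ` exists and is unique
    (∃! φ : OqSL n ≃+* (OqSL n)ᵐᵒᵖ, IsPhi φ) ∧
    ∀ φ : OqSL n ≃+* (OqSL n)ᵐᵒᵖ, IsPhi φ →
      ∃ b : Idx n → OqSL n,
        -- `b` is a `ℤ[q]`-basis of the lattice and a `ℚ(q)`-basis of the algebra
        (LinearIndependent Zq b ∧ Submodule.span Zq (Set.range b) = lattice n) ∧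
        (LinearIndependent K b ∧ Submodule.span K (Set.range b) = ⊤) ∧
        Invariant φ b ∧ Triangular b ∧ IdxTriangular b ∧
        -- uniqueness
        ∀ c : Idx n → OqSL n, Invariant φ c → (Triangular c ∨ IdxTriangular c) → c = b :=
  ⟨⟨linearIndependent_X hn, span_X hn⟩, existsUnique_isPhi n, fun _ hφ =>
    ⟨bSL, ⟨linearIndependent_Zq_bSL hn, span_Zq_bSL hn⟩, ⟨linearIndependent_bSL hn, span_K_bSL hn⟩,
      hφ.invariant_bSL, triangular_bSL, idxTriangular_bSL hn, fun _ hc h =>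
      hφ.eq_bSL hn hc (h.elim (fun h => h.exists_mem hn) fun h => h.exists_mem hn)⟩⟩
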